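/- Let $n\ge 1$, $L>0$ and $R>0$, write $x=(x',x_n)\in\mathbb R^{n-1}\times\mathbb R$ for the points of $\mathbb R^n$, and let $B_\rho:=B_\rho(0)\subset\mathbb R^n$. For an open set $U\subseteq\mathbb R^n$ let $\mathcal P^{\log}_b(U)$ be the set of measurable functions $p\colon U\to[1,\infty)$ with $p^+:=\operatorname{ess\,sup}_U p<\infty$ for which there are $c\ge 0$ and $p_\infty\in\mathbb R$ with $$|p(x)-p(y)|\le\frac{c}{\log(\mathrm e+1/|x-y|)}\quad\text{for all } x\ne y \text{ in } U,\qquad |p(x)-p_\infty|\le\frac{c}{\log(\mathrm e+|x|)}\quad\text{for all } x\in U,$$ and put $p^-:=\operatorname{ess\,inf}_U p$. For such $p$ let $L^{p(\cdot)}(U;\mathbb R^{n\times n})$ be the space of measurable $f\colon U\to\mathbb R^{n\times n}$ with $\int_U|f(x)|^{p(x)}\,\mathrm dx<\infty$, where $|\cdot|$ is the Frobenius norm, with the norm $$\|f\|_{L^{p(\cdot)}(U)}:=\inf\Big\{\lambda>0:\int_U\Big|\frac{f(x)}{\lambda}\Big|^{p(x)}\,\mathrm dx\le 1\Big\}.$$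 For $u\in W^{1,1}(U;\mathbb R^n)$ let $eu:=\frac12(\nabla u+\nabla u^T)$ be the symmetric part of the weak gradient. There is a radius $r=r(R,L,n)$ with $0<r<R$ such that the following holds. Let $\phi\colon\mathbb R^{n-1}\to\mathbb R$ be Lipschitz with constant $L$ and $\phi(0)=0$, and let $$\Omega:=\{x=(x',x_n)\in\mathbb R^{n-1}\times\mathbb R : x_n<\phi(x')\}.$$ Let $p,q\in\mathcal P^{\log}_b(B_R\cap\Omega)$ with $p\le q$ a.e. in $B_R\cap\Omega$. Then there is a constant $C=C(R,L,n,p,q)>0$ such that, for all $u\in W^{1,1}(B_R\cap\Omega;\mathbb R^n)$, $f\in L^{p(\cdot)}(B_R\cap\Omega;\mathbb R^{n\times n})$ and $g\in L^{q(\cdot)}(B_R\cap\Omega;\mathbb R^{n\times n})$ with $$eu=f+g\quad\text{a.e. in }B_R\cap\Omega,$$ there exist $\tilde p,\tilde q\in\mathcal P^{\log}_b(B_r)$, $\tilde u\in W^{1,1}(B_r;\mathbb R^n)$, $\tilde f\in L^{\tilde p(\cdot)}(B_r;\mathbb R^{n\times n})$ and $\tilde g\in L^{\tilde q(\cdot)}(B_r;\mathbb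 R^{n\times n})$ satisfying \begin{align*} &\tilde p=p,\quad \tilde q=q,\quad \tilde u=u,\quad \tilde f=f,\quad \tilde g=g &&\text{a.e. in } B_r\cap\Omega,\\ &p^-\le\tilde p^-\le\tilde p^+\le p^+,\quad q^-\le\tilde q^-\le\tilde q^+\le q^+,\\ &\tilde p\le\tilde q,\quad e\tilde u=\tilde f+\tilde g &&\text{a.e. in } B_r, \end{align*} and $$\|\tilde f\|_{L^{\tilde p(\cdot)}(B_r)}\le C\|f\|_{L^{p(\cdot)}(B_R\cap\Omega)},\qquad \|\tilde g\|_{L^{\tilde q(\cdot)}(B_r)}\le C\|g\|_{L^{q(\cdot)}(B_R\cap\Omega)}.$$ -/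

import Mathlib

open MeasureTheory
open scoped NNReal ENNReal ContDiff

noncomputable section

namespace VarExp

/-- Euclidean space `ℝⁿ`. -/
abbrev Rn (n : ℕ) := EuclideanSpace ℝ (Fin n)

/-- Square real matrices. -/
abbrev Mat (n : ℕ) := Matrix (Fin n) (Fin n) ℝ

/-- The first `m` coordinates `x'` of a point `x = (x', xₙ)` of `ℝⁿ`, where `n = m + 1`. -/
def firstCoords {m : ℕ} (x : Rn (m + 1)) : Rn m :=
  WithLp.toLp 2 (fun i : Fin m => x i.castSucc)

/-- The open subgraph `{x = (x', xₙ) : xₙ < φ(x')}`. -/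
def subgraph {m : ℕ} (φ : Rn m → ℝ) : Set (Rn (m + 1)) :=
  {x | x (Fin.last m) < φ (firstCoords x)}

/-- The norm of a matrix induced by the scalar product `A : B = ∑ i j, A i j * B i j`. -/
def matNorm {n : ℕ} (A : Mat n) : ℝ := √(∑ i, ∑ j, A i j ^ 2)

/-- The symmetric part `(A + Aᵀ) / 2` of a matrix. -/
def symPart {n : ℕ} (A : Mat n) : Mat n := (1 / 2 : ℝ) • (A + A.transpose)

/-! ### Variable exponents

Functions "on `S`" are represented by functions on the whole space, of which only the restriction
to `S` is used. -/

/-- `p⁻`, the essential infimum of `p` over `S` (as an extended real, so that it always exists). -/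
def expInf {n : ℕ} (S : Set (Rn n)) (p : Rn n → ℝ) : EReal :=
  essInf (fun x => (p x : EReal)) (volume.restrict S)

/-- `p⁺`, the essential supremum of `p` over `S` (as an extended real). -/
def expSup {n : ℕ} (S : Set (Rn n)) (p : Rn n → ℝ) : EReal :=
  essSup (fun x => (p x : EReal)) (volume.restrict S)

/-- The class `𝒫_b(S)` of bounded variable exponents: measurable functions `p : S → [1, ∞)` with
`p⁺ < ∞`. -/
structure IsExponent {n : ℕ} (S : Set (Rn n)) (p : Rn n → ℝ) : Prop where
  measurable : AEMeasurable p (volume.restrict S)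
  one_le : ∀ x ∈ S, 1 ≤ p x
  sup_lt_top : expSup S p < ⊤

/-- Local log-Hölder continuity on `S`. -/
def LocallyLogHolder {n : ℕ} (S : Set (Rn n)) (a : Rn n → ℝ) : Prop :=
  ∃ c : ℝ, 0 ≤ c ∧ ∀ x ∈ S, ∀ y ∈ S, x ≠ y →
    |a x - a y| ≤ c / Real.log (Real.exp 1 + 1 / ‖x - y‖)

/-- The log-Hölder decay condition on `S`. -/
def LogHolderDecay {n : ℕ} (S : Set (Rn n)) (a : Rn n → ℝ) : Prop :=
  ∃ aInf c : ℝ, 0 ≤ c ∧ ∀ x ∈ S, |a x - aInf| ≤ c / Real.log (Real.exp 1 + ‖x‖)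

/-- The class `𝒫_b^log(S)` of globally log-Hölder continuous bounded variable exponents. -/
structure IsLogExponent {n : ℕ} (S : Set (Rn n)) (p : Rn n → ℝ) : Prop where
  isExponent : IsExponent S p
  locallyLogHolder : LocallyLogHolder S p
  logHolderDecay : LogHolderDecay S p

/-! ### Variable exponent Lebesgue spaces of matrix fields -/

/-- The modular `∫_S |f(x) / t|^{p(x)} dx` of `f / t`, where `t > 0`. -/
def modular {n : ℕ} (S : Set (Rn n)) (p : Rn n → ℝ) (f : Rn n → Mat n) (t : ℝ) : ℝ≥0∞ :=
  ∫⁻ x in S, ENNReal.ofReal ((matNorm (f x) / t) ^ p x)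

/-- `f ∈ L^{p(·)}(S; ℝ^{n × n})`: `f` is measurable and has finite modular. -/
structure MemLpVar {n : ℕ} (S : Set (Rn n)) (p : Rn n → ℝ) (f : Rn n → Mat n) : Prop where
  measurable : ∀ i j, AEMeasurable (fun x => f x i j) (volume.restrict S)
  modular_lt_top : modular S p f 1 < ⊤

/-- The Luxemburg norm `‖f‖_{L^{p(·)}(S)}`. -/
def normLpVar {n : ℕ} (S : Set (Rn n)) (p : Rn n → ℝ) (f : Rn n → Mat n) : ℝ :=
  sInf {t : ℝ | 0 < t ∧ modular S p f t ≤ 1}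

/-! ### Sobolev maps -/

/-- `v` is the weak partial derivative `∂ⱼ w` on `S`, tested against `C_c^∞(S)`. -/
def IsWeakPartialDeriv {n : ℕ} (S : Set (Rn n)) (w : Rn n → ℝ) (j : Fin n) (v : Rn n → ℝ) :
    Prop :=
  ∀ η : Rn n → ℝ, ContDiff ℝ ∞ η → HasCompactSupport η → tsupport η ⊆ S →
    ∫ x in S, w x * fderiv ℝ η x (EuclideanSpace.single j 1) = - ∫ x in S, v x * η x

/-- `u ∈ W^{1,1}(S; ℝⁿ)` with weak gradient `∇u = G` on the open set `S`, where
`(∇u)ᵢⱼ = ∂ⱼ uᵢ`. The gradient is determined by `u` almost everywhere on `S`. -/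
structure IsW11WithGrad {n : ℕ} (S : Set (Rn n)) (u : Rn n → Rn n) (G : Rn n → Mat n) :
    Prop where
  integrable : ∀ i, IntegrableOn (fun x => u x i) S
  grad_integrable : ∀ i j, IntegrableOn (fun x => G x i j) S
  isWeakPartialDeriv : ∀ i j, IsWeakPartialDeriv S (fun x => u x i) j (fun x => G x i j)

end VarExp

end

/-!
The extension is Nitsche's reflection, averaged along vertical lines. Let `δ` be a regularised
distance to the graph of `φ`: above the graph it is comparable with the height
`h(x) = xₙ - φ(x')`, with `2 h ≤ δ ≤ K h`, and it is twice differentiable with `|∇δ| ≤ K` and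
`δ |∇²δ| ≤ K`. Then `x ↦ x - s δ(x) eₙ`, for `1 < s ≤ 2`, takes points above the graph to points
below it. For a weight `ψ` on `[1, 2]` with `∫ ψ = 1` and `∫ s ψ = 0`, the map `u` is continued above
the graph by the `ψ`-average of its pullbacks, as a covector field, under these reflections
(`reflMap`, `extMap`). Covariance has the effect that the gradient of the continuation is `T(∇u)`
for a *linear* operator `T` (`reflGrad`, `extGrad`) that commutes with taking the symmetric part:
its only second order term has the symmetric coefficient `∇²δ`, and an integration by parts in `s`
turns the factor `u` there into `δ ∂ₙuₙ`, which is where `∫ s ψ = 0` enters. Hence `eu = f + g`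
is continued by `f' = T f` and `g' = T g` separately, and `eu' = f' + g'`.

That `T(∇u)` is the weak gradient of the continuation across the graph
(`isW11WithGrad_extMap`) is proved for smooth maps, whose extension is Lipschitz, and then passes
to the limit: Sobolev maps below a Lipschitz graph are approximated up to the graph by mollification
with kernels supported on the upper side (`exists_smooth_approx`), and both operators are bounded on
`L¹` by a Hardy-type inequality for vertical averages (`lintegral_vertical_average_le`). That
inequality uses `2 h ≤ δ` only, and no derivative of `δ`. The regularised distance is `c / Φ` with
`Φ(x) = ∫ |x - y|^{-(n + 1)} dy` over the subgraph (`exists_isRegDist`); its constant depends on the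
dimension and the Lipschitz constant alone.

The exponents are not reflected. With `ω(t) = 1 / log(e + 1 / t)`, which is increasing and
subadditive, `p` is extended by the McShane formula `p'(x) = sup_y (p(y) - A ω(|x - y|))`, truncated
at `p⁻` (`exists_extension_exponents`). Using the same large `A` for `p` and `q` preserves `p ≤ q`.
If `A` is large, then `p'(x) ≤ p(z)` for every point `z` of the domain whose distance from `x` is
comparable with the distance of `x` from the domain, in particular for all points
`z = x - s δ(x) eₙ`. Since `T` is bounded pointwise by averages over such points, Jensen's inequality
with the exponent `p'(x)` and `a^{p'(x)} ≤ 1 + a^{p(z)}` bound the modular of `T f` by the measure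
of a ball plus the modular of `f` (`ReflectsInto.modular_extGrad_le`), which gives the norm estimates.
-/

noncomputable section

namespace VarExp

/-! ### The graph of `φ` and vertical averages -/

/-- The vertical unit vector `eₙ`. -/
def vert {m : ℕ} : Rn (m + 1) := EuclideanSpace.single (Fin.last m) 1

/-- The signed vertical distance `xₙ - φ(x')` of `x` from the graph of `φ`; the subgraph is
`{height φ < 0}`. -/
def height {m : ℕ} (φ : Rn m → ℝ) (x : Rn (m + 1)) : ℝ := x (Fin.last m) - φ (firstCoords x)

/-- The open region above the graph of `φ`. -/
def upper {m : ℕ} (φ : Rn m → ℝ) : Set (Rn (m + 1)) := {x | 0 < height φ x}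

variable {m : ℕ} {φ : Rn m → ℝ}

lemma mem_subgraph {x : Rn (m + 1)} : x ∈ subgraph φ ↔ height φ x < 0 := by
  simp [subgraph, height]

lemma mem_upper {x : Rn (m + 1)} : x ∈ upper φ ↔ 0 < height φ x := Iff.rfl

@[simp] lemma norm_vert : ‖(vert : Rn (m + 1))‖ = 1 := by simp [vert]

@[simp] lemma vert_last : (vert : Rn (m + 1)) (Fin.last m) = 1 := by simp [vert]

lemma firstCoords_add_smul_vert (x : Rn (m + 1)) (t : ℝ) :
    firstCoords (x + t • vert) = firstCoords x := by
  ext i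
  simp [firstCoords, vert]

lemma height_add_smul_vert (x : Rn (m + 1)) (t : ℝ) :
    height φ (x + t • vert) = height φ x + t := by
  simp only [height, firstCoords_add_smul_vert]
  simp
  ring

lemma height_sub_smul_vert (x : Rn (m + 1)) (t : ℝ) :
    height φ (x - t • vert) = height φ x - t := by
  have := height_add_smul_vert (φ := φ) x (-t)
  rw [neg_smul, ← sub_eq_add_neg] at this
  rw [this]; ring

lemma norm_firstCoords_sub_le (x y : Rn (m + 1)) :
    ‖firstCoords x - firstCoords y‖ ≤ ‖x - y‖ := by
  rw [EuclideanSpace.norm_eq, EuclideanSpace.norm_eq]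
  refine Real.sqrt_le_sqrt ?_
  rw [Fin.sum_univ_castSucc (n := m)]
  simp only [firstCoords, PiLp.sub_apply]
  have := sq_nonneg ‖x (Fin.last m) - y (Fin.last m)‖
  linarith

lemma continuous_firstCoords : Continuous (firstCoords : Rn (m + 1) → Rn m) := by
  unfold firstCoords
  fun_prop

lemma abs_height_sub_le {L : ℝ≥0} (hφ : LipschitzWith L φ) (x y : Rn (m + 1)) :
    |height φ x - height φ y| ≤ (1 + L) * ‖x - y‖ := by
  have h1 : |x (Fin.last m) - y (Fin.last m)| ≤ ‖x - y‖ := by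
    simpa using PiLp.norm_apply_le (x - y) (Fin.last m)
  have h2 : |φ (firstCoords x) - φ (firstCoords y)| ≤ L * ‖x - y‖ := by
    have := hφ.dist_le_mul (firstCoords x) (firstCoords y)
    rw [Real.dist_eq, dist_eq_norm] at this
    exact this.trans (mul_le_mul_of_nonneg_left (norm_firstCoords_sub_le x y) L.2)
  have h3 : height φ x - height φ y = (x (Fin.last m) - y (Fin.last m))
      - (φ (firstCoords x) - φ (firstCoords y)) := by simp only [height]; ring
  rw [h3]
  refine (abs_sub _ _).trans ?_
  linarith

lemma continuous_height (hφ : Continuous φ) : Continuous (height φ) := by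
  unfold height
  exact (by fun_prop : Continuous fun x : Rn (m + 1) => x (Fin.last m)).sub
    (hφ.comp continuous_firstCoords)

lemma isOpen_upper (hφ : Continuous φ) : IsOpen (upper φ) :=
  isOpen_lt continuous_const (continuous_height hφ)

lemma isOpen_subgraph (hφ : Continuous φ) : IsOpen (subgraph φ) := by
  have : subgraph φ = {x | height φ x < 0} := by ext x; exact mem_subgraph
  rw [this]
  exact isOpen_lt (continuous_height hφ) continuous_const

/-- The graph of a continuous function is a null set: almost every vertical translate of a point misses it, so
Tonelli's theorem applies. -/
lemma volume_graph_eq_zero (hφ : Continuous φ) :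
    volume {x : Rn (m + 1) | height φ x = 0} = 0 := by
  set Γ : Set (Rn (m + 1)) := {x | height φ x = 0}
  have hΓ : MeasurableSet Γ := (isClosed_eq (continuous_height hφ) continuous_const).measurableSet
  have h1 : ∀ t : ℝ, ∫⁻ x, Γ.indicator 1 (x + t • vert) = volume Γ := fun t => by
    rw [lintegral_add_right_eq_self (μ := volume) (Γ.indicator (1 : Rn (m + 1) → ℝ≥0∞)) (t • vert),
      lintegral_indicator_one hΓ]
  have hm : Measurable (Function.uncurry fun (t : ℝ) (x : Rn (m + 1)) =>
      Γ.indicator (1 : Rn (m + 1) → ℝ≥0∞) (x + t • vert)) := by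
    refine (measurable_one.indicator hΓ).comp ?_
    fun_prop
  have h2 : ∫⁻ t : ℝ in Set.Icc 0 1, ∫⁻ x, Γ.indicator 1 (x + t • vert) = volume Γ := by
    simp [h1]
  rw [← h2, lintegral_lintegral_swap hm.aemeasurable]
  refine (lintegral_congr fun x => ?_).trans lintegral_zero
  have h3 : ∀ᵐ t : ℝ ∂volume.restrict (Set.Icc 0 1), t ≠ - height φ x :=
    ae_restrict_of_ae (Measure.ae_ne volume _)
  refine (lintegral_congr_ae (h3.mono fun t ht => ?_)).trans lintegral_zero
  refine Set.indicator_of_notMem ?_ _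
  intro h
  have h' : height φ (x + t • vert) = 0 := h
  rw [height_add_smul_vert] at h'
  exact ht (by linarith)

/-- The substitution `t = s a` in an average over `1 < s ≤ 2`. -/
lemma lintegral_dilate {F : ℝ → ℝ≥0∞} (hF : Measurable F) {a : ℝ} (ha : 0 < a) :
    ∫⁻ s in Set.Ioc 1 2, F (s * a)
      = ∫⁻ t, (Set.Ioc a (2 * a)).indicator (fun t => ENNReal.ofReal a⁻¹ * F t) t := by
  have hm : Measurable ((Set.Ioc a (2 * a)).indicator (fun t => ENNReal.ofReal a⁻¹ * F t)) :=
    (hF.const_mul _).indicator measurableSet_Ioc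
  conv_rhs => rw [← Real.smul_map_volume_mul_right ha.ne']
  rw [lintegral_smul_measure, lintegral_map hm (by fun_prop),
    ← lintegral_indicator measurableSet_Ioc, smul_eq_mul, ← lintegral_const_mul _ (by fun_prop)]
  refine lintegral_congr fun s => ?_
  have hs : s ∈ Set.Ioc (1 : ℝ) 2 ↔ s * a ∈ Set.Ioc a (2 * a) := by
    simp only [Set.mem_Ioc]
    constructor
    · rintro ⟨h1, h2⟩
      exact ⟨by nlinarith, by nlinarith⟩
    · rintro ⟨h1, h2⟩
      exact ⟨by nlinarith, by nlinarith⟩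
  by_cases h : s ∈ Set.Ioc (1 : ℝ) 2
  · rw [Set.indicator_of_mem h, Set.indicator_of_mem (hs.1 h), ← mul_assoc,
      ← ENNReal.ofReal_mul (abs_nonneg _), abs_of_pos ha, mul_inv_cancel₀ ha.ne']
    simp
  · rw [Set.indicator_of_notMem h, Set.indicator_of_notMem (fun h' => h (hs.2 h')), mul_zero]

/-- The Hardy-type estimate for vertical averages: reflecting `x` to `x - s δ(x) eₙ` and averaging
over `s ∈ [1, 2]` is bounded from `L¹` of the subgraph to `L¹` of the region above it. After the
substitution `t = s δ(x)` and a translation by `t eₙ`, it comes down to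
`∫ 1[δ ≤ t ≤ 2 δ] dt / δ ≤ 2`, where `δ` is evaluated at `y + t eₙ`. -/
theorem lintegral_vertical_average_le (hφ : Continuous φ) {δ : Rn (m + 1) → ℝ} (hδ : Measurable δ)
    (hδ2 : ∀ x ∈ upper φ, 2 * height φ x ≤ δ x) {F : Rn (m + 1) → ℝ≥0∞} (hF : Measurable F) :
    ∫⁻ x in upper φ, ∫⁻ s in Set.Ioc (1 : ℝ) 2, F (x - (s * δ x) • vert)
      ≤ 2 * ∫⁻ x in subgraph φ, F x := by
  have hup : MeasurableSet (upper φ) := (isOpen_upper hφ).measurableSet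
  set A : Set (Rn (m + 1) × ℝ) :=
    (Prod.fst ⁻¹' upper φ) ∩ ({z | δ z.1 < z.2} ∩ {z | z.2 ≤ 2 * δ z.1}) with hA
  have mem_A : ∀ x t, (x, t) ∈ A ↔ x ∈ upper φ ∧ δ x < t ∧ t ≤ 2 * δ x := fun x t => Iff.rfl
  set W : Rn (m + 1) → ℝ → ℝ≥0∞ := fun x t =>
    A.indicator (fun z => ENNReal.ofReal (δ z.1)⁻¹) (x, t) with hW
  have hWm : Measurable (Function.uncurry W) := by
    refine Measurable.indicator (f := fun z : Rn (m + 1) × ℝ => ENNReal.ofReal (δ z.1)⁻¹)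
      (by fun_prop) ?_
    refine (measurable_fst hup).inter ((measurableSet_lt ?_ ?_).inter (measurableSet_le ?_ ?_))
    all_goals fun_prop
  have h1 : ∫⁻ x in upper φ, ∫⁻ s in Set.Ioc (1 : ℝ) 2, F (x - (s * δ x) • vert)
      = ∫⁻ x, ∫⁻ t, W x t * F (x - t • vert) := by
    rw [← lintegral_indicator hup]
    refine lintegral_congr fun x => ?_
    by_cases hx : x ∈ upper φ
    · have hpos : 0 < δ x := by
        have := hδ2 x hx
        have := mem_upper.1 hx
        linarith
      rw [Set.indicator_of_mem hx, lintegral_dilate (F := fun t => F (x - t • vert))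
        (by fun_prop) hpos]
      refine lintegral_congr fun t => ?_
      by_cases ht : t ∈ Set.Ioc (δ x) (2 * δ x)
      · rw [Set.indicator_of_mem ht, hW]
        beta_reduce
        rw [Set.indicator_of_mem ((mem_A _ _).2 ⟨hx, ht⟩)]
      · rw [Set.indicator_of_notMem ht, hW]
        beta_reduce
        rw [Set.indicator_of_notMem (fun h => ht ((mem_A _ _).1 h).2), zero_mul]
    · rw [Set.indicator_of_notMem hx]
      refine (lintegral_zero.symm.trans (lintegral_congr fun t => ?_))
      rw [hW]
      beta_reduce
      rw [Set.indicator_of_notMem (fun h => hx ((mem_A _ _).1 h).1), zero_mul]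
  have hm1 : Measurable (Function.uncurry fun x t => W x t * F (x - t • vert)) := by
    refine hWm.mul (hF.comp ?_)
    fun_prop
  have hm2 : Measurable (Function.uncurry fun (t : ℝ) (y : Rn (m + 1)) =>
      W (y + t • vert) t * F y) := by
    refine (hWm.comp (f := fun z : ℝ × Rn (m + 1) => (z.2 + z.1 • vert, z.1)) ?_).mul ?_ <;>
      fun_prop
  -- Translation by `t eₙ`, for fixed `t`, avoids any change of variables involving `δ`.
  have h2 : ∀ t : ℝ, ∫⁻ x, W x t * F (x - t • vert) = ∫⁻ y, W (y + t • vert) t * F y := fun t => by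
    rw [← lintegral_add_right_eq_self (μ := volume) _ (t • (vert : Rn (m + 1)))]
    simp
  rw [h1, lintegral_lintegral_swap hm1.aemeasurable, lintegral_congr h2,
    lintegral_lintegral_swap hm2.aemeasurable,
    ← lintegral_indicator (isOpen_subgraph hφ).measurableSet,
    ← lintegral_const_mul _ (hF.indicator (isOpen_subgraph hφ).measurableSet)]
  refine lintegral_mono fun y => ?_
  have hWy : Measurable fun t => W (y + t • vert) t := by
    refine hWm.comp (f := fun t : ℝ => (y + t • vert, t)) ?_
    fun_prop
  rw [lintegral_mul_const _ hWy]
  set D : ℝ := - height φ y with hD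
  -- With `x = y + t eₙ`, `2 h(x) ≤ δ(x)` and `δ(x) < t ≤ 2 δ(x)` force `D < t ≤ 2 D`, and then
  -- `1 / δ(x) ≤ 2 / t ≤ 2 / D`.
  have key : ∀ t, W (y + t • vert) t
      ≤ (Set.Ioc D (2 * D)).indicator (fun _ => ENNReal.ofReal (2 / D)) t := by
    intro t
    by_cases h : (y + t • vert ∈ upper φ ∧ δ (y + t • vert) < t ∧ t ≤ 2 * δ (y + t • vert))
    · obtain ⟨ha, hb, hc⟩ := h
      have hh := hδ2 _ ha
      rw [height_add_smul_vert] at hh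
      have ha' := mem_upper.1 ha
      rw [height_add_smul_vert] at ha'
      have hDt : t ∈ Set.Ioc D (2 * D) := ⟨by linarith, by linarith⟩
      have hD0 : 0 < D := by linarith [hDt.1, hDt.2]
      rw [Set.indicator_of_mem hDt]
      simp only [hW]
      rw [Set.indicator_of_mem ((mem_A _ _).2 ⟨ha, hb, hc⟩)]
      refine ENNReal.ofReal_le_ofReal ?_
      rw [inv_eq_one_div, div_le_div_iff₀ (by linarith [hDt.1]) hD0]
      linarith [hDt.1]
    · simp only [hW]
      rw [Set.indicator_of_notMem (mt (mem_A _ _).1 h)]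
      exact zero_le
  by_cases hy : y ∈ subgraph φ
  · have hD0 : 0 < D := by have := mem_subgraph.1 hy; linarith
    rw [Set.indicator_of_mem hy]
    refine mul_le_mul_left (a := F y) ?_ |>.trans le_rfl
    calc ∫⁻ t, W (y + t • vert) t
        ≤ ∫⁻ t, (Set.Ioc D (2 * D)).indicator (fun _ => ENNReal.ofReal (2 / D)) t :=
          lintegral_mono key
      _ = ENNReal.ofReal (2 / D * D) := by
          rw [lintegral_indicator measurableSet_Ioc, setLIntegral_const, Real.volume_Ioc,
            ← ENNReal.ofReal_mul (by positivity)]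
          congr 2; ring
      _ = 2 := by rw [div_mul_cancel₀ _ hD0.ne']; simp
  · have hD0 : 2 * D ≤ D := by have := mt mem_subgraph.2 hy; linarith
    have : ∫⁻ t, W (y + t • vert) t = 0 := by
      refine le_antisymm ((lintegral_mono key).trans ?_) zero_le
      rw [Set.Ioc_eq_empty (by linarith)]
      simp
    rw [this, zero_mul]
    exact zero_le

/-! ### Integrals of homogeneous kernels -/

/-- A kernel on `ℝⁿ`, smooth away from the origin and positively homogeneous of degree `-s`. -/
structure IsHomKernel {n : ℕ} {F : Type*} [NormedAddCommGroup F] [NormedSpace ℝ F] (s : ℕ)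
    (k : Rn n → F) : Prop where
  contDiffAt : ∀ z, z ≠ 0 → ContDiffAt ℝ ∞ k z
  smul : ∀ t : ℝ, 0 < t → ∀ z, k (t • z) = (t⁻¹) ^ s • k z

section HomKernel

variable {n : ℕ} {F : Type*} [NormedAddCommGroup F] [NormedSpace ℝ F] {s : ℕ} {k : Rn n → F}

lemma IsHomKernel.fderiv (hk : IsHomKernel s k) : IsHomKernel (s + 1) (fderiv ℝ k) where
  contDiffAt z hz := (hk.contDiffAt z hz).fderiv_right (by simp)
  smul t ht z := by
    have h1 : _root_.fderiv ℝ (fun z => k (t • z)) z = t • _root_.fderiv ℝ k (t • z) :=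
      fderiv_comp_smul t
    have h2 : (fun z => k (t • z)) = (t⁻¹) ^ s • k := funext fun z => hk.smul t ht z
    rw [h2, fderiv_const_smul_field] at h1
    rw [Pi.smul_apply] at h1
    rw [pow_succ', mul_smul, h1, smul_smul, inv_mul_cancel₀ ht.ne', one_smul]

/-- A homogeneous kernel is bounded by the power of the norm with the same homogeneity, by
compactness of the unit sphere. -/
lemma IsHomKernel.exists_norm_le (hk : IsHomKernel s k) :
    ∃ C : ℝ, 0 ≤ C ∧ ∀ z, z ≠ 0 → ‖k z‖ ≤ C * (‖z‖⁻¹) ^ s := by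
  have hc : ContinuousOn k (Metric.sphere 0 1) := fun z hz =>
    (hk.contDiffAt z (by rintro rfl; simp at hz)).continuousAt.continuousWithinAt
  obtain ⟨C, hC⟩ := (isCompact_sphere (0 : Rn n) 1).exists_bound_of_continuousOn hc
  refine ⟨max C 0, le_max_right _ _, fun z hz => ?_⟩
  have hz' : 0 < ‖z‖ := norm_pos_iff.2 hz
  have h1 : z = ‖z‖ • (‖z‖⁻¹ • z) := by rw [smul_smul, mul_inv_cancel₀ hz'.ne', one_smul]
  have h2 : ‖k (‖z‖⁻¹ • z)‖ ≤ max C 0 := (hC _ (by simp [norm_smul, hz'.ne'])).trans (le_max_left _ _)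
  conv_lhs => rw [h1]
  rw [hk.smul _ hz', norm_smul, norm_pow, norm_inv, norm_norm, mul_comm]
  gcongr

variable {A : Set (Rn n)} {x : Rn n} {ρ : ℝ}

lemma integrableOn_inv_norm_pow (hs : n < s) (hA : MeasurableSet A) (hρ : 0 < ρ)
    (h : ∀ y ∈ A, ρ ≤ ‖x - y‖) : IntegrableOn (fun y => (‖x - y‖⁻¹) ^ s) A := by
  have h1 : Integrable (fun y : Rn n => (1 + ρ⁻¹) ^ s * (1 + ‖x - y‖) ^ (-(s : ℝ))) := by
    refine ((integrable_one_add_norm (μ := volume) (E := Rn n) (r := s) ?_).comp_sub_left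
      x).const_mul _
    simpa using hs
  refine Integrable.mono' h1.integrableOn (by fun_prop) ?_
  refine (ae_restrict_iff' hA).2 (ae_of_all _ fun y hy => ?_)
  have hz : 0 < ‖x - y‖ := hρ.trans_le (h y hy)
  rw [Real.norm_of_nonneg (by positivity), Real.rpow_neg (by positivity), Real.rpow_natCast,
    ← inv_pow, ← mul_pow]
  gcongr
  rw [← div_eq_mul_inv, inv_eq_one_div, div_le_div_iff₀ hz (by positivity), add_mul, one_mul]
  have : 1 ≤ ρ⁻¹ * ‖x - y‖ := by
    rw [← div_eq_inv_mul, one_le_div hρ]; exact h y hy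
  linarith

lemma IsHomKernel.continuousOn (hk : IsHomKernel s k) (h : ∀ y ∈ A, x - y ≠ 0) :
    ContinuousOn (fun y => k (x - y)) A := fun y hy =>
  (ContinuousAt.comp (f := fun y => x - y) (hk.contDiffAt _ (h y hy)).continuousAt
    (by fun_prop)).continuousWithinAt

lemma IsHomKernel.integrableOn (hk : IsHomKernel s k) (hs : n < s)
    (hA : MeasurableSet A) (hρ : 0 < ρ) (h : ∀ y ∈ A, ρ ≤ ‖x - y‖) :
    IntegrableOn (fun y => k (x - y)) A := by
  obtain ⟨C, -, hC⟩ := hk.exists_norm_le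
  have hne : ∀ y ∈ A, x - y ≠ 0 := fun y hy => norm_pos_iff.1 (hρ.trans_le (h y hy))
  refine Integrable.mono' ((integrableOn_inv_norm_pow hs hA hρ h).const_mul C)
    ((hk.continuousOn hne).aestronglyMeasurable hA) ?_
  exact (ae_restrict_iff' hA).2 (ae_of_all _ fun y hy => hC _ (hne y hy))

/-- Differentiation under the integral sign for a homogeneous kernel, away from the domain of
integration. -/
lemma IsHomKernel.hasFDerivAt_integral (hk : IsHomKernel s k) (hs : n < s)
    (hA : MeasurableSet A) (hρ : 0 < ρ) (h : ∀ y ∈ A, ρ ≤ ‖x - y‖) :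
    HasFDerivAt (fun x => ∫ y in A, k (x - y)) (∫ y in A, _root_.fderiv ℝ k (x - y)) x := by
  obtain ⟨C, hC0, hC⟩ := hk.fderiv.exists_norm_le
  have hb : ∀ z ∈ Metric.ball x (ρ / 2), ∀ y ∈ A, ‖x - y‖ / 2 ≤ ‖z - y‖ := by
    intro z hz y hy
    have h1 : ‖x - y‖ ≤ ‖z - y‖ + ‖z - x‖ := by
      have := norm_sub_le (z - y) (z - x)
      rwa [sub_sub_sub_cancel_left] at this
    have h2 : ‖z - x‖ < ρ / 2 := by rwa [← dist_eq_norm]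
    have := h y hy
    linarith
  have hne : ∀ z ∈ Metric.ball x (ρ / 2), ∀ y ∈ A, z - y ≠ 0 := fun z hz y hy =>
    norm_pos_iff.1 ((half_pos (hρ.trans_le (h y hy))).trans_le (hb z hz y hy))
  have hx : x ∈ Metric.ball x (ρ / 2) := Metric.mem_ball_self (half_pos hρ)
  refine hasFDerivAt_integral_of_dominated_of_fderiv_le (F := fun x y => k (x - y))
    (F' := fun x y => _root_.fderiv ℝ k (x - y))
    (bound := fun y => C * (2 ^ (s + 1) * (‖x - y‖⁻¹) ^ (s + 1)))
    (Metric.ball_mem_nhds x (half_pos hρ)) ?_ (hk.integrableOn hs hA hρ h)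
    ((hk.fderiv.continuousOn (hne x hx)).aestronglyMeasurable hA) ?_
    (((integrableOn_inv_norm_pow (hs.trans (Nat.lt_succ_self s)) hA hρ h).const_mul _).const_mul C)
    ?_
  · filter_upwards [Metric.ball_mem_nhds x (half_pos hρ)] with z hz
    exact (hk.continuousOn (hne z hz)).aestronglyMeasurable hA
  · refine (ae_restrict_iff' hA).2 (ae_of_all _ fun y hy z hz => ?_)
    refine (hC _ (hne z hz y hy)).trans ?_
    rw [← mul_pow]
    have h1 := hb z hz y hy
    have h2 := hρ.trans_le (h y hy)
    have h3 : ‖z - y‖⁻¹ ≤ 2 * ‖x - y‖⁻¹ := by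
      rw [← div_eq_mul_inv, inv_eq_one_div, div_le_div_iff₀ (by linarith) h2]
      linarith
    gcongr
  · refine (ae_restrict_iff' hA).2 (ae_of_all _ fun y hy z hz => ?_)
    have h1 := ((hk.contDiffAt _ (hne z hz y hy)).differentiableAt (by simp)).hasFDerivAt
    exact h1.comp (f := fun z => z - y) z ((hasFDerivAt_id z).sub_const y)

/-- Surplus homogeneity `j` of the kernel turns into the factor `ρ⁻ʲ`. -/
lemma norm_integral_kernel_le {C : ℝ} (hC0 : 0 ≤ C)
    (hC : ∀ z, z ≠ 0 → ‖k z‖ ≤ C * (‖z‖⁻¹) ^ s) {r j : ℕ} (hs : s = r + j) (hr : n < r)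
    (hA : MeasurableSet A) (hρ : 0 < ρ) (h : ∀ y ∈ A, ρ ≤ ‖x - y‖) :
    ‖∫ y in A, k (x - y)‖ ≤ C * (ρ⁻¹) ^ j * ∫ y in A, (‖x - y‖⁻¹) ^ r := by
  have hi := (integrableOn_inv_norm_pow hr hA hρ h).const_mul (C * (ρ⁻¹) ^ j)
  rw [← integral_const_mul]
  refine norm_integral_le_of_norm_le hi ((ae_restrict_iff' hA).2 (ae_of_all _ fun y hy => ?_))
  have h1 := h y hy
  refine (hC _ (norm_pos_iff.1 (hρ.trans_le h1))).trans ?_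
  rw [hs, pow_add, mul_assoc, mul_comm ((‖x - y‖⁻¹) ^ r)]
  gcongr

end HomKernel

lemma isHomKernel_inv_norm_pow (n s : ℕ) : IsHomKernel s (fun z : Rn n => (‖z‖⁻¹) ^ s) where
  contDiffAt z hz := ((contDiffAt_norm ℝ hz).inv (norm_ne_zero_iff.2 hz)).pow s
  smul t ht z := by
    rw [norm_smul, Real.norm_of_nonneg ht.le, mul_inv, mul_pow, smul_eq_mul]

/-- By scaling, `∫_{|z| ≥ ρ} |z|^{-(n+1)} dz` is a multiple of `1 / ρ`. -/
lemma exists_integral_inv_norm_pow_le (n : ℕ) : ∃ I : ℝ, 0 < I ∧ ∀ (A : Set (Rn n)) (x : Rn n)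
    (ρ : ℝ), MeasurableSet A → 0 < ρ → (∀ y ∈ A, ρ ≤ ‖x - y‖) →
    ∫ y in A, (‖x - y‖⁻¹) ^ (n + 1) ≤ I / ρ := by
  set B : ℝ → Set (Rn n) := fun ρ => {z | ρ ≤ ‖z‖}
  have hB : ∀ ρ, MeasurableSet (B ρ) := fun ρ => measurableSet_le measurable_const measurable_norm
  have hBi : ∀ ρ, 0 < ρ → Integrable ((B ρ).indicator fun z => (‖z‖⁻¹) ^ (n + 1)) := by
    intro ρ hρ
    rw [integrable_indicator_iff (hB ρ)]
    have := integrableOn_inv_norm_pow (x := (0 : Rn n)) (Nat.lt_succ_self n) (hB ρ) hρ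
      (fun y hy => by rw [zero_sub, norm_neg]; exact hy)
    simpa using this
  set J : ℝ := ∫ z, (B 1).indicator (fun z => (‖z‖⁻¹) ^ (n + 1)) z with hJ
  have hJ0 : 0 ≤ J := integral_nonneg fun z => Set.indicator_nonneg (fun _ _ => by positivity) z
  refine ⟨J + 1, by linarith, fun A x ρ hA hρ h => ?_⟩
  have h1 : ∫ z, (B ρ).indicator (fun z => (‖z‖⁻¹) ^ (n + 1)) z = J / ρ := by
    have h2 : ∀ z : Rn n, (B ρ).indicator (fun z => (‖z‖⁻¹) ^ (n + 1)) z
        = (ρ⁻¹) ^ (n + 1) * (B 1).indicator (fun z => (‖z‖⁻¹) ^ (n + 1)) (ρ⁻¹ • z) := by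
      intro z
      have hn : ‖ρ⁻¹ • z‖ = ρ⁻¹ * ‖z‖ := by
        rw [norm_smul, Real.norm_of_nonneg (inv_nonneg.2 hρ.le)]
      have hiff : z ∈ B ρ ↔ ρ⁻¹ • z ∈ B 1 := by
        change ρ ≤ ‖z‖ ↔ 1 ≤ ‖ρ⁻¹ • z‖
        rw [hn, ← div_eq_inv_mul, one_le_div hρ]
      by_cases hz : z ∈ B ρ
      · rw [Set.indicator_of_mem hz, Set.indicator_of_mem (hiff.1 hz), hn, ← mul_pow, mul_inv,
          inv_inv, ← mul_assoc, inv_mul_cancel₀ hρ.ne', one_mul]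
      · rw [Set.indicator_of_notMem hz, Set.indicator_of_notMem (fun h => hz (hiff.2 h)), mul_zero]
    rw [integral_congr_ae (ae_of_all _ h2), integral_const_mul,
      Measure.integral_comp_smul volume ((B 1).indicator fun z => (‖z‖⁻¹) ^ (n + 1)) ρ⁻¹, ← hJ]
    simp only [finrank_euclideanSpace, Fintype.card_fin, smul_eq_mul]
    rw [abs_of_pos (by positivity), inv_pow, inv_pow, inv_inv, pow_succ]
    field_simp
  calc ∫ y in A, (‖x - y‖⁻¹) ^ (n + 1)
      = ∫ y, A.indicator (fun y => (‖x - y‖⁻¹) ^ (n + 1)) y := (integral_indicator hA).symm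
    _ ≤ ∫ y, (B ρ).indicator (fun z => (‖z‖⁻¹) ^ (n + 1)) (x - y) := by
        refine integral_mono
          ((integrableOn_inv_norm_pow (Nat.lt_succ_self n) hA hρ h).integrable_indicator hA)
          ((hBi ρ hρ).comp_sub_left x) fun y => ?_
        by_cases hy : y ∈ A
        · have : x - y ∈ B ρ := h y hy
          simp only [Set.indicator_of_mem hy, Set.indicator_of_mem this]
          exact le_rfl
        · rw [Set.indicator_of_notMem hy]
          exact Set.indicator_nonneg (fun _ _ => by positivity) _
    _ = J / ρ := by
        rw [integral_sub_left_eq_self ((B ρ).indicator fun z => (‖z‖⁻¹) ^ (n + 1)) volume x, h1]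
    _ ≤ (J + 1) / ρ := by gcongr; linarith

/-- A lower bound for the integral of `|x - y|^{-(n+1)}` over a set that contains a ball whose size
is comparable with its distance from `x`. -/
lemma exists_le_integral_inv_norm_pow (n : ℕ) : ∃ c : ℝ, 0 < c ∧ ∀ (A : Set (Rn n)) (x z : Rn n)
    (ρ d M : ℝ), MeasurableSet A → 0 < ρ → (∀ y ∈ A, ρ ≤ ‖x - y‖) → 0 < d → 0 < M →
    Metric.ball z d ⊆ A → (∀ y ∈ Metric.ball z d, ‖x - y‖ ≤ M * d) →
    c / (M ^ (n + 1) * d) ≤ ∫ y in A, (‖x - y‖⁻¹) ^ (n + 1) := by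
  refine ⟨volume.real (Metric.ball (0 : Rn n) 1), ?_, fun A x z ρ d M hA hρ h hd hM hz hxy => ?_⟩
  · exact ENNReal.toReal_pos (Metric.measure_ball_pos _ _ one_pos).ne' measure_ball_lt_top.ne
  have hi := integrableOn_inv_norm_pow (s := n + 1) (Nat.lt_succ_self n) hA hρ h
  have h1 : volume.real (Metric.ball z d) = d ^ n * volume.real (Metric.ball (0 : Rn n) 1) := by
    have := Measure.addHaar_ball_of_pos volume z hd
    rw [measureReal_def, this, ENNReal.toReal_mul, ENNReal.toReal_ofReal (by positivity)]
    simp [measureReal_def]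
  calc volume.real (Metric.ball (0 : Rn n) 1) / (M ^ (n + 1) * d)
      = ∫ y in Metric.ball z d, ((M * d)⁻¹) ^ (n + 1) := by
        rw [setIntegral_const, h1, smul_eq_mul, inv_pow, mul_pow, pow_succ d]
        field_simp
    _ ≤ ∫ y in Metric.ball z d, (‖x - y‖⁻¹) ^ (n + 1) := by
        refine setIntegral_mono_on (integrableOn_const measure_ball_lt_top.ne) (hi.mono_set hz)
          measurableSet_ball fun y hy => ?_
        have : 0 < ‖x - y‖ := hρ.trans_le (h y (hz hy))
        have := hxy y hy
        gcongr
    _ ≤ _ := setIntegral_mono_set hi (ae_of_all _ fun y => by positivity)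
        (LE.le.eventuallyLE hz)

/-! ### The regularised distance to a Lipschitz graph -/

/-- `δ` is a regularised distance to the graph of `φ` with constant `K`: above the graph it is
comparable with the vertical distance, twice differentiable, and its first two derivatives have
the size of those of a function homogeneous of degree one. -/
structure IsRegDist {m : ℕ} (φ : Rn m → ℝ) (K : ℝ) (δ : Rn (m + 1) → ℝ) : Prop where
  measurable : Measurable δ
  two_mul_height_le : ∀ x ∈ upper φ, 2 * height φ x ≤ δ x
  le_mul_height : ∀ x ∈ upper φ, δ x ≤ K * height φ x
  differentiableAt : ∀ x ∈ upper φ, DifferentiableAt ℝ δ x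
  differentiableAt_fderiv : ∀ x ∈ upper φ, DifferentiableAt ℝ (fderiv ℝ δ) x
  norm_fderiv_le : ∀ x ∈ upper φ, ‖fderiv ℝ δ x‖ ≤ K
  mul_norm_fderiv_fderiv_le : ∀ x ∈ upper φ, δ x * ‖fderiv ℝ (fderiv ℝ δ) x‖ ≤ K

lemma norm_smul_add_smulRight_le {E : Type*} [NormedAddCommGroup E] [NormedSpace ℝ E] (a b : ℝ)
    (T : E →L[ℝ] E →L[ℝ] ℝ) (S : E →L[ℝ] ℝ) :
    ‖a • T + (b • S).smulRight S‖ ≤ |a| * ‖T‖ + |b| * ‖S‖ * ‖S‖ := by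
  refine (norm_add_le (a • T) ((b • S).smulRight S)).trans ?_
  have h1 := ContinuousLinearMap.opNorm_smul_le a T
  rw [ContinuousLinearMap.norm_smulRight_apply, norm_smul b S, Real.norm_eq_abs]
  exact add_le_add h1 le_rfl

/-- A regularised distance with constant depending only on the dimension and the Lipschitz
constant: `δ = c / Φ`, where `Φ(x) = ∫ |x - y|^{-(n + 1)} dy` over the subgraph. Here `Φ` is
comparable with the inverse of the height, and each derivative of the kernel costs one power of
the distance to the subgraph. -/
theorem exists_isRegDist (m : ℕ) (L : ℝ≥0) : ∃ K : ℝ, 0 < K ∧ ∀ φ : Rn m → ℝ, LipschitzWith L φ →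
    ∃ δ, IsRegDist φ K δ := by
  obtain ⟨I, hI0, hI⟩ := exists_integral_inv_norm_pow_le (m + 1)
  obtain ⟨c₀, hc₀, hc₀'⟩ := exists_le_integral_inv_norm_pow (m + 1)
  set κ : Rn (m + 1) → ℝ := fun z => (‖z‖⁻¹) ^ (m + 1 + 1) with hκ
  have hk : IsHomKernel (m + 1 + 1) κ := isHomKernel_inv_norm_pow (m + 1) (m + 1 + 1)
  obtain ⟨C₁, hC₁0, hC₁⟩ := hk.fderiv.exists_norm_le
  obtain ⟨C₂, hC₂0, hC₂⟩ := hk.fderiv.fderiv.exists_norm_le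
  set Λ : ℝ := 1 + L with hΛ
  have hΛ1 : 1 ≤ Λ := by simp [hΛ]
  -- As `Φ ≤ I Λ / h`, this choice of `c` gives `c / Φ ≥ 2 h`.
  set c : ℝ := 2 * I * Λ with hc
  have hcpos : 0 < c := by positivity
  set M : ℝ := 2 * Λ + 2 with hM
  set K₀ : ℝ := c * M ^ (m + 1 + 1) / c₀ with hK₀
  have hK₀pos : 0 < K₀ := by positivity
  refine ⟨K₀ + K₀ * (C₁ * Λ) + K₀ ^ 2 * (C₂ * Λ ^ 2 + 2 * (C₁ * Λ) ^ 2), by positivity,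
    fun φ hφ => ?_⟩
  set A := subgraph φ with hAdef
  have hA : MeasurableSet A := (isOpen_subgraph hφ.continuous).measurableSet
  set Φ : Rn (m + 1) → ℝ := fun x => ∫ y in A, κ (x - y) with hΦ
  set Φ₁ : Rn (m + 1) → Rn (m + 1) →L[ℝ] ℝ := fun x => ∫ y in A, fderiv ℝ κ (x - y) with hΦ₁
  set Φ₂ : Rn (m + 1) → Rn (m + 1) →L[ℝ] Rn (m + 1) →L[ℝ] ℝ :=
    fun x => ∫ y in A, fderiv ℝ (fderiv ℝ κ) (x - y) with hΦ₂
  have hn2 : m + 1 < m + 1 + 1 := Nat.lt_succ_self _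
  have hρ : ∀ x ∈ upper φ, 0 < height φ x / Λ := fun x hx => by
    have := mem_upper.1 hx; positivity
  have hdist : ∀ x ∈ upper φ, ∀ y ∈ A, height φ x / Λ ≤ ‖x - y‖ := fun x hx y hy => by
    rw [div_le_iff₀' (by positivity)]
    have h1 := abs_height_sub_le hφ x y
    have h2 := mem_subgraph.1 hy
    have h3 := le_abs_self (height φ x - height φ y)
    linarith
  have hΦ1 : ∀ x ∈ upper φ, HasFDerivAt Φ (Φ₁ x) x := fun x hx =>
    hk.hasFDerivAt_integral hn2 hA (hρ x hx) (hdist x hx)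
  have hΦ2 : ∀ x ∈ upper φ, HasFDerivAt Φ₁ (Φ₂ x) x := fun x hx =>
    hk.fderiv.hasFDerivAt_integral (hn2.trans (Nat.lt_succ_self _)) hA (hρ x hx) (hdist x hx)
  have hΦle : ∀ x ∈ upper φ, Φ x ≤ I * Λ / height φ x := fun x hx => by
    refine (hI A x _ hA (hρ x hx) (hdist x hx)).trans (le_of_eq ?_)
    rw [div_div_eq_mul_div]
  -- The ball of radius `h(x)` about `x - (2 Λ + 1) h(x) eₙ` lies below the graph.
  have hΦge : ∀ x ∈ upper φ, c₀ / (M ^ (m + 1 + 1) * height φ x) ≤ Φ x := fun x hx => by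
    have hx' := mem_upper.1 hx
    refine hc₀' A x (x - ((2 * Λ + 1) * height φ x) • vert) _ (height φ x) M hA (hρ x hx)
      (hdist x hx) hx' (by positivity) (fun y hy => ?_) fun y hy => ?_
    · rw [Metric.mem_ball, dist_eq_norm] at hy
      have h1 := (le_abs_self _).trans (abs_height_sub_le hφ y (x - ((2 * Λ + 1) * height φ x) • vert))
      rw [height_sub_smul_vert, ← hΛ] at h1
      refine mem_subgraph.2 ?_
      nlinarith
    · rw [Metric.mem_ball, dist_eq_norm] at hy
      have h1 : x - y = ((2 * Λ + 1) * height φ x) • vert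
          - (y - (x - ((2 * Λ + 1) * height φ x) • vert)) := by abel
      rw [h1]
      refine (norm_sub_le _ _).trans ?_
      rw [norm_smul, norm_vert, Real.norm_of_nonneg (by positivity)]
      simp only [hM]
      linarith
  have hΦpos : ∀ x ∈ upper φ, 0 < Φ x := fun x hx =>
    lt_of_lt_of_le (by have := mem_upper.1 hx; positivity) (hΦge x hx)
  have hΦ₁le : ∀ x ∈ upper φ, ‖Φ₁ x‖ ≤ C₁ * Λ / height φ x * Φ x := fun x hx => by
    refine (norm_integral_kernel_le hC₁0 hC₁ (r := m + 1 + 1) (j := 1) rfl hn2 hA (hρ x hx)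
      (hdist x hx)).trans (le_of_eq ?_)
    rw [pow_one, inv_div, mul_div_assoc]
  have hΦ₂le : ∀ x ∈ upper φ, ‖Φ₂ x‖ ≤ C₂ * Λ ^ 2 / height φ x ^ 2 * Φ x := fun x hx => by
    refine (norm_integral_kernel_le hC₂0 hC₂ (r := m + 1 + 1) (j := 2) rfl hn2 hA (hρ x hx)
      (hdist x hx)).trans (le_of_eq ?_)
    rw [inv_div, div_pow, mul_div_assoc]
  set δ : Rn (m + 1) → ℝ := fun x => c * (Φ x)⁻¹ with hδ
  have hδle : ∀ x ∈ upper φ, δ x ≤ K₀ * height φ x := fun x hx => by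
    have h1 := hΦge x hx
    have hx' := mem_upper.1 hx
    calc c * (Φ x)⁻¹ ≤ c * (c₀ / (M ^ (m + 1 + 1) * height φ x))⁻¹ := by gcongr
      _ = K₀ * height φ x := by rw [inv_div, hK₀]; ring
  have hδ1 : ∀ x ∈ upper φ, HasFDerivAt δ ((-c * ((Φ x)⁻¹) ^ 2) • Φ₁ x) x := fun x hx => by
    have h1 := ((hasDerivAt_inv (hΦpos x hx).ne').comp_hasFDerivAt x (hΦ1 x hx)).const_mul c
    refine h1.congr_fderiv ?_
    rw [smul_smul, inv_pow]
    congr 1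
    ring
  have hδf : ∀ x ∈ upper φ, fderiv ℝ δ =ᶠ[nhds x] fun x => (-c * ((Φ x)⁻¹) ^ 2) • Φ₁ x :=
    fun x hx => Filter.mem_of_superset ((isOpen_upper hφ.continuous).mem_nhds hx)
      fun y hy => (hδ1 y hy).fderiv
  have hδ2 : ∀ x ∈ upper φ, HasFDerivAt (fderiv ℝ δ) ((-c * ((Φ x)⁻¹) ^ 2) • Φ₂ x
      + ((2 * c * ((Φ x)⁻¹) ^ 3) • Φ₁ x).smulRight (Φ₁ x)) x := fun x hx => by
    have h1 : HasFDerivAt (fun x => -c * ((Φ x)⁻¹) ^ 2) ((2 * c * ((Φ x)⁻¹) ^ 3) • Φ₁ x) x := by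
      have h2 := ((hasDerivAt_inv (hΦpos x hx).ne').pow 2).const_mul (-c)
      have h3 := h2.comp_hasFDerivAt x (hΦ1 x hx)
      refine h3.congr_fderiv ?_
      congr 1
      have := (hΦpos x hx).ne'
      simp
      field_simp
    exact (h1.smul (hΦ2 x hx)).congr_of_eventuallyEq (hδf x hx)
  have hb1 : ∀ x ∈ upper φ, ‖fderiv ℝ δ x‖ ≤ C₁ * Λ / height φ x * δ x := fun x hx => by
    have hp := hΦpos x hx
    rw [(hδ1 x hx).fderiv, norm_smul, Real.norm_eq_abs, abs_mul, abs_neg, abs_of_pos hcpos,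
      abs_of_pos (by positivity)]
    calc c * ((Φ x)⁻¹) ^ 2 * ‖Φ₁ x‖
        ≤ c * ((Φ x)⁻¹) ^ 2 * (C₁ * Λ / height φ x * Φ x) := by gcongr; exact hΦ₁le x hx
      _ = _ := by simp only [hδ]; field_simp
  have hb2 : ∀ x ∈ upper φ, ‖fderiv ℝ (fderiv ℝ δ) x‖
      ≤ (C₂ * Λ ^ 2 + 2 * (C₁ * Λ) ^ 2) / height φ x ^ 2 * δ x := fun x hx => by
    have hp := hΦpos x hx
    have hx' := mem_upper.1 hx
    rw [(hδ2 x hx).fderiv]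
    refine (norm_smul_add_smulRight_le _ _ _ _).trans ?_
    rw [abs_mul, abs_neg, abs_of_pos hcpos, abs_of_pos (by positivity),
      abs_of_pos (by positivity)]
    calc c * ((Φ x)⁻¹) ^ 2 * ‖Φ₂ x‖ + 2 * c * ((Φ x)⁻¹) ^ 3 * ‖Φ₁ x‖ * ‖Φ₁ x‖
        ≤ c * ((Φ x)⁻¹) ^ 2 * (C₂ * Λ ^ 2 / height φ x ^ 2 * Φ x) + 2 * c * ((Φ x)⁻¹) ^ 3
          * (C₁ * Λ / height φ x * Φ x) * (C₁ * Λ / height φ x * Φ x) := by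
          have h1 := hΦ₁le x hx
          have h2 := hΦ₂le x hx
          gcongr
      _ = _ := by simp only [hδ]; field_simp
  have hpos2 : 0 ≤ K₀ ^ 2 * (C₂ * Λ ^ 2 + 2 * (C₁ * Λ) ^ 2) := by positivity
  have hpos1 : 0 ≤ K₀ * (C₁ * Λ) := by positivity
  refine ⟨δ, ?_, fun x hx => ?_, fun x hx => ?_, fun x hx => (hδ1 x hx).differentiableAt,
    fun x hx => (hδ2 x hx).differentiableAt, fun x hx => ?_, fun x hx => ?_⟩
  · have : StronglyMeasurable fun z : Rn (m + 1) × Rn (m + 1) => κ (z.1 - z.2) :=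
      Measurable.stronglyMeasurable (by simp only [hκ]; fun_prop)
    exact (this.integral_prod_right (ν := volume.restrict A)).measurable.inv.const_mul c
  · have hx' := mem_upper.1 hx
    have hp := hΦpos x hx
    have h1 := hΦle x hx
    rw [le_div_iff₀ hx'] at h1
    simp only [hδ]
    rw [← div_eq_mul_inv, le_div_iff₀ hp, hc]
    nlinarith
  · have hx' := mem_upper.1 hx
    refine (hδle x hx).trans ?_
    gcongr
    linarith
  · have hx' := mem_upper.1 hx
    refine (hb1 x hx).trans ?_
    calc C₁ * Λ / height φ x * δ x ≤ C₁ * Λ / height φ x * (K₀ * height φ x) := by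
          gcongr; exact hδle x hx
      _ = K₀ * (C₁ * Λ) := by field_simp
      _ ≤ _ := by linarith
  · have hx' := mem_upper.1 hx
    have hδ0 : 0 ≤ δ x := mul_nonneg hcpos.le (inv_nonneg.2 (hΦpos x hx).le)
    calc δ x * ‖fderiv ℝ (fderiv ℝ δ) x‖
        ≤ (K₀ * height φ x) * ((C₂ * Λ ^ 2 + 2 * (C₁ * Λ) ^ 2) / height φ x ^ 2
          * (K₀ * height φ x)) := by
          have h1 := hδle x hx
          refine mul_le_mul h1 ((hb2 x hx).trans ?_) (norm_nonneg (fderiv ℝ (fderiv ℝ δ) x)) (by positivity)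
          gcongr
      _ = K₀ ^ 2 * (C₂ * Λ ^ 2 + 2 * (C₁ * Λ) ^ 2) := by field_simp
      _ ≤ _ := by linarith

/-! ### Nitsche's reflection across a Lipschitz graph -/

/-- The `j`-th standard basis vector. -/
def basisVec {n : ℕ} (j : Fin n) : Rn n := EuclideanSpace.single j 1

@[simp] lemma norm_basisVec {n : ℕ} (j : Fin n) : ‖(basisVec j : Rn n)‖ = 1 := by simp [basisVec]

/-- The weighted average `∫₁² θ(s) h(x - s δ(x) eₙ) ds`. -/
def vavg (δ : Rn (m + 1) → ℝ) (θ : ℝ → ℝ) (h : Rn (m + 1) → ℝ) (x : Rn (m + 1)) : ℝ :=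
  ∫ s in (1 : ℝ)..2, θ s * h (x - (s * δ x) • vert)

/-- The weight `ψ` with `∫₁² ψ = 1` and `∫₁² s ψ(s) ds = 0`. Together they make the
traces on the graph match; the second also permits the integration by parts that compensates the
singularity of the Hessian of `δ`. -/
def psi (s : ℝ) : ℝ := 28 - 18 * s

/-- The primitive of `s ψ(s)` that vanishes at both `1` and `2`. -/
def psiPrim (s : ℝ) : ℝ := 14 * (s ^ 2 - 1) - 6 * (s ^ 3 - 1)

/-- The reflected map: the average with weight `ψ` of the pullbacks (as covectors) of `u` under
the reflections `x ↦ x - s δ(x) eₙ`. -/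
def reflMap (δ : Rn (m + 1) → ℝ) (u : Rn (m + 1) → Rn (m + 1)) (x : Rn (m + 1)) :
    Rn (m + 1) := WithLp.toLp 2 fun i =>
  vavg δ psi (fun y => u y i) x
    - fderiv ℝ δ x (basisVec i) * vavg δ (fun s => s * psi s) (fun y => u y (Fin.last m)) x

/-- The operator taking the gradient of `u` to the gradient of its reflection `reflMap δ u`. It
commutes with taking the symmetric part, since the Hessian of `δ` is symmetric. -/
def reflGrad (δ : Rn (m + 1) → ℝ) (G : Rn (m + 1) → Mat (m + 1)) (x : Rn (m + 1)) :
    Mat (m + 1) := fun i j =>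
  vavg δ psi (fun y => G y i j) x
    - fderiv ℝ δ x (basisVec i) * vavg δ (fun s => s * psi s) (fun y => G y (Fin.last m) j) x
    - fderiv ℝ δ x (basisVec j) * vavg δ (fun s => s * psi s) (fun y => G y i (Fin.last m)) x
    + fderiv ℝ δ x (basisVec i) * fderiv ℝ δ x (basisVec j)
      * vavg δ (fun s => s ^ 2 * psi s) (fun y => G y (Fin.last m) (Fin.last m)) x
    - δ x * fderiv ℝ (fderiv ℝ δ) x (basisVec j) (basisVec i)
      * vavg δ psiPrim (fun y => G y (Fin.last m) (Fin.last m)) x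

section Weights

lemma continuous_psi : Continuous psi := by unfold psi; fun_prop

lemma continuous_psiPrim : Continuous psiPrim := by unfold psiPrim; fun_prop

lemma abs_psi_le {s : ℝ} (hs : s ∈ Set.Icc (1 : ℝ) 2) : |psi s| ≤ 10 := by
  rw [psi, abs_le]; constructor <;> linarith [hs.1, hs.2]

lemma abs_mul_psi_le {s : ℝ} (hs : s ∈ Set.Icc (1 : ℝ) 2) : |s * psi s| ≤ 20 := by
  rw [abs_mul, abs_of_nonneg (by linarith [hs.1])]
  nlinarith [abs_psi_le hs, hs.2, hs.1, abs_nonneg (psi s)]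

lemma abs_sq_mul_psi_le {s : ℝ} (hs : s ∈ Set.Icc (1 : ℝ) 2) : |s ^ 2 * psi s| ≤ 40 := by
  have h := abs_mul_psi_le hs
  rw [pow_two, mul_assoc, abs_mul, abs_of_nonneg (by linarith [hs.1] : (0 : ℝ) ≤ s)]
  nlinarith [hs.2, hs.1, abs_nonneg (s * psi s)]

lemma abs_psiPrim_le {s : ℝ} (hs : s ∈ Set.Icc (1 : ℝ) 2) : |psiPrim s| ≤ 84 := by
  obtain ⟨h1, h2⟩ := hs
  have h3 : s ^ 2 ≤ 4 := by nlinarith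
  have h4 : 1 ≤ s ^ 2 := by nlinarith
  have h5 : s ^ 3 ≤ 8 := by nlinarith
  have h6 : 1 ≤ s ^ 3 := by nlinarith
  rw [psiPrim, abs_le]
  constructor <;> linarith

lemma integral_psi : ∫ s in (1 : ℝ)..2, psi s = 1 := by
  unfold psi
  rw [intervalIntegral.integral_sub (by simp) (by apply Continuous.intervalIntegrable; fun_prop),
    intervalIntegral.integral_const_mul, integral_id]
  norm_num

lemma hasDerivAt_psiPrim (s : ℝ) : HasDerivAt psiPrim (s * psi s) s := by
  have h := (((hasDerivAt_pow 2 s).sub_const 1).const_mul 14).sub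
    (((hasDerivAt_pow 3 s).sub_const 1).const_mul 6)
  refine h.congr_deriv ?_
  simp [psi]
  ring

end Weights

section Smooth

variable {δ : Rn (m + 1) → ℝ} {θ : ℝ → ℝ} {h : Rn (m + 1) → ℝ} {x : Rn (m + 1)}

lemma intervalIntegrable_vavg (hθ : Continuous θ) (hh : Continuous h) :
    IntervalIntegrable (fun s => θ s * h (x - (s * δ x) • vert)) volume 1 2 := by
  apply Continuous.intervalIntegrable
  fun_prop

lemma abs_vavg_le {W N : ℝ} (hW : ∀ s ∈ Set.Icc (1 : ℝ) 2, |θ s| ≤ W) (hN : ∀ y, |h y| ≤ N) :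
    |vavg δ θ h x| ≤ W * N := by
  have hb := intervalIntegral.norm_integral_le_of_norm_le_const (a := 1) (b := 2) (C := W * N)
    (f := fun s => θ s * h (x - (s * δ x) • vert)) fun s hs => ?_
  · rw [abs_of_pos (by norm_num)] at hb
    unfold vavg
    rw [← Real.norm_eq_abs]
    linarith
  · rw [Set.uIoc_of_le (by norm_num)] at hs
    rw [norm_mul]
    exact mul_le_mul (hW s ⟨hs.1.le, hs.2⟩) (hN _) (norm_nonneg _)
      ((abs_nonneg _).trans (hW s ⟨hs.1.le, hs.2⟩))

/-- The gradient of a vertical average of a `C¹` function. -/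
lemma hasFDerivAt_vavg {U : Set (Rn (m + 1))} (hU : U ∈ nhds x) {K M : ℝ}
    (hδ : ∀ z ∈ U, DifferentiableAt ℝ δ z) (hK : ∀ z ∈ U, ‖fderiv ℝ δ z‖ ≤ K)
    (hθ : Continuous θ) (hh : ContDiff ℝ 1 h) (hM : ∀ y, ‖fderiv ℝ h y‖ ≤ M) :
    ∃ D : Rn (m + 1) →L[ℝ] ℝ, HasFDerivAt (vavg δ θ h) D x ∧ ∀ v,
      D v = vavg δ θ (fun y => fderiv ℝ h y v) x
        - fderiv ℝ δ x v * vavg δ (fun s => s * θ s) (fun y => fderiv ℝ h y vert) x := by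
  have hh1 : Continuous (fderiv ℝ h) := hh.continuous_fderiv (by simp)
  have hM0 : 0 ≤ M := (norm_nonneg _).trans (hM x)
  set F' : Rn (m + 1) → ℝ → Rn (m + 1) →L[ℝ] ℝ := fun z s =>
    θ s • (fderiv ℝ h (z - (s * δ z) • vert)).comp
      (ContinuousLinearMap.id ℝ _ - (s • fderiv ℝ δ z).smulRight vert) with hF'
  have hF'c : Continuous (F' x) := by
    refine hθ.smul (Continuous.clm_comp (hh1.comp (by fun_prop)) ?_)
    refine continuous_const.sub ?_
    have : (fun s : ℝ => (s • fderiv ℝ δ x).smulRight (vert : Rn (m + 1)))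
        = fun s => s • (fderiv ℝ δ x).smulRight (vert : Rn (m + 1)) := by
      ext s v
      simp [mul_assoc]
    rw [this]
    fun_prop
  have hD : HasFDerivAt (vavg δ θ h) (∫ s in (1 : ℝ)..2, F' x s) x := by
    refine intervalIntegral.hasFDerivAt_integral_of_dominated_of_fderiv_le
      (F := fun z s => θ s * h (z - (s * δ z) • vert)) (F' := F')
      (bound := fun s => |θ s| * (M * (1 + 2 * K))) hU ?_ (intervalIntegrable_vavg hθ hh.continuous)
      hF'c.aestronglyMeasurable ?_ ?_ ?_
    · have := hh.continuous
      exact Filter.Eventually.of_forall fun z =>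
        (by fun_prop : Continuous fun s => θ s * h (z - (s * δ z) • vert)).aestronglyMeasurable
    · refine ae_of_all _ fun s hs z hz => ?_
      rw [Set.uIoc_of_le (by norm_num)] at hs
      rw [hF', norm_smul, Real.norm_eq_abs]
      refine mul_le_mul_of_nonneg_left ?_ (abs_nonneg _)
      refine (ContinuousLinearMap.opNorm_comp_le _ _).trans ?_
      refine mul_le_mul (hM _) ((norm_sub_le _ _).trans ?_) (norm_nonneg _) hM0
      rw [ContinuousLinearMap.norm_smulRight_apply, norm_smul, norm_vert, mul_one]
      refine add_le_add ContinuousLinearMap.norm_id_le ?_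
      rw [Real.norm_of_nonneg (by linarith [hs.1])]
      exact mul_le_mul hs.2 (hK z hz) (norm_nonneg _) (by norm_num)
    · apply Continuous.intervalIntegrable
      fun_prop
    · refine ae_of_all _ fun s _ z hz => ?_
      have h1 : HasFDerivAt (fun z => z - (s * δ z) • (vert : Rn (m + 1)))
          (ContinuousLinearMap.id ℝ _ - (s • fderiv ℝ δ z).smulRight vert) z :=
        (hasFDerivAt_id z).sub (((hδ z hz).hasFDerivAt.const_mul s).smul_const vert)
      have h2 := ((hh.differentiable (by simp)) (z - (s * δ z) • vert)).hasFDerivAt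
      exact (h2.comp z h1).const_mul (θ s)
  refine ⟨_, hD, fun v => ?_⟩
  rw [ContinuousLinearMap.intervalIntegral_apply (hF'c.intervalIntegrable _ _)]
  have hc : ∀ v, Continuous fun y => fderiv ℝ h y v := fun v => by fun_prop
  unfold vavg
  rw [← intervalIntegral.integral_const_mul, ← intervalIntegral.integral_sub
    (intervalIntegrable_vavg hθ (hc v))
    ((intervalIntegrable_vavg (θ := fun s => s * θ s) (by fun_prop) (hc vert)).const_mul _)]
  refine intervalIntegral.integral_congr fun s _ => ?_
  simp [hF']
  ring

/-- Integration by parts in the averaging parameter: the factor `δ` gained compensates the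
singularity of the Hessian of `δ`. -/
lemma delta_mul_vavg_psiPrim (hh : ContDiff ℝ 1 h) :
    δ x * vavg δ psiPrim (fun y => fderiv ℝ h y vert) x = vavg δ (fun s => s * psi s) h x := by
  have hh1 : Continuous (fderiv ℝ h) := hh.continuous_fderiv (by simp)
  have hv : ∀ s ∈ Set.uIcc (1 : ℝ) 2, HasDerivAt (fun s => h (x - (s * δ x) • vert))
      (-(δ x * fderiv ℝ h (x - (s * δ x) • vert) vert)) s := fun s _ => by
    have h1 : HasDerivAt (fun s : ℝ => x - (s * δ x) • (vert : Rn (m + 1)))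
        (-(δ x • vert)) s := by
      have := (((hasDerivAt_id s).mul_const (δ x)).smul_const (vert : Rn (m + 1))).const_sub x
      simpa using this
    have h2 := ((hh.differentiable (by simp)) (x - (s * δ x) • vert)).hasFDerivAt
    refine (h2.comp_hasDerivAt s h1).congr_deriv ?_
    simp
  have := intervalIntegral.integral_mul_deriv_eq_deriv_mul (a := 1) (b := 2)
    (u := psiPrim) (fun s _ => hasDerivAt_psiPrim s) hv
    (Continuous.intervalIntegrable (by have := continuous_psi; fun_prop) _ _)
    (Continuous.intervalIntegrable (by fun_prop) _ _)
  have h1 : psiPrim 1 = 0 := by norm_num [psiPrim]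
  have h2 : psiPrim 2 = 0 := by norm_num [psiPrim]
  rw [h1, h2, zero_mul, zero_mul, sub_zero, zero_sub] at this
  unfold vavg
  rw [← neg_inj, ← this, ← intervalIntegral.integral_const_mul, ← intervalIntegral.integral_neg]
  refine intervalIntegral.integral_congr fun s _ => ?_
  ring

variable {K : ℝ} {w : Rn (m + 1) → Rn (m + 1)} {M : ℝ}

lemma IsRegDist.nonneg (hδ : IsRegDist φ K δ) : 0 ≤ K := by
  have hx : (0 : Rn (m + 1)) + (1 - height φ 0) • vert ∈ upper φ := by
    rw [mem_upper, height_add_smul_vert]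
    linarith
  exact (norm_nonneg _).trans (hδ.norm_fderiv_le _ hx)

/-- The gradient of a smooth map, as a matrix field. -/
def gradMat {n : ℕ} (w : Rn n → Rn n) (x : Rn n) : Mat n :=
  fun i j => fderiv ℝ (fun y => w y i) x (basisVec j)

/-- For smooth maps `reflGrad` is the gradient of the reflection. The Hessian of `δ` only occurs
multiplied by `δ`, after an integration by parts in the averaging parameter. -/
lemma reflMap_fderiv (hφ : Continuous φ) (hδ : IsRegDist φ K δ)
    (hw : ∀ i, ContDiff ℝ 1 fun y => w y i) (hM : ∀ i y, ‖fderiv ℝ (fun y => w y i) y‖ ≤ M)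
    (hx : x ∈ upper φ) (i : Fin (m + 1)) :
    ∃ D : Rn (m + 1) →L[ℝ] ℝ, HasFDerivAt (fun x => reflMap δ w x i) D x ∧
      (∀ j, D (basisVec j) = reflGrad δ (gradMat w) x i j) ∧
      ‖D‖ ≤ (10 + 124 * K + 40 * K ^ 2) * M := by
  have hK0 := hδ.nonneg
  have hM0 : 0 ≤ M := (norm_nonneg _).trans (hM i x)
  have hU : upper φ ∈ nhds x := (isOpen_upper hφ).mem_nhds hx
  have hpc := continuous_psi
  obtain ⟨D₁, hD₁, hD₁'⟩ := hasFDerivAt_vavg hU hδ.differentiableAt hδ.norm_fderiv_le hpc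
    (hw i) (hM i)
  obtain ⟨D₂, hD₂, hD₂'⟩ := hasFDerivAt_vavg hU hδ.differentiableAt hδ.norm_fderiv_le
    (θ := fun s => s * psi s) (by fun_prop) (hw (Fin.last m)) (hM (Fin.last m))
  have hg : HasFDerivAt (fun x => fderiv ℝ δ x (basisVec i))
      ((ContinuousLinearMap.apply ℝ ℝ (basisVec i)).comp (fderiv ℝ (fderiv ℝ δ) x)) x :=
    (ContinuousLinearMap.apply ℝ ℝ (basisVec i : Rn (m + 1))).hasFDerivAt.comp x
      (hδ.differentiableAt_fderiv x hx).hasFDerivAt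
  have hD := hD₁.sub (hg.mul hD₂)
  have hibp := delta_mul_vavg_psiPrim (δ := δ) (x := x) (hw (Fin.last m))
  have hval : ∀ v, (D₁ - (fderiv ℝ δ x (basisVec i) • D₂
      + vavg δ (fun s => s * psi s) (fun y => w y (Fin.last m)) x •
        (ContinuousLinearMap.apply ℝ ℝ (basisVec i)).comp (fderiv ℝ (fderiv ℝ δ) x))) v =
      vavg δ psi (fun y => fderiv ℝ (fun y => w y i) y v) x
        - fderiv ℝ δ x (basisVec i) * vavg δ (fun s => s * psi s)
          (fun y => fderiv ℝ (fun y => w y (Fin.last m)) y v) x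
        - fderiv ℝ δ x v * vavg δ (fun s => s * psi s)
          (fun y => fderiv ℝ (fun y => w y i) y vert) x
        + fderiv ℝ δ x (basisVec i) * fderiv ℝ δ x v * vavg δ (fun s => s ^ 2 * psi s)
          (fun y => fderiv ℝ (fun y => w y (Fin.last m)) y vert) x
        - δ x * fderiv ℝ (fderiv ℝ δ) x v (basisVec i) * vavg δ psiPrim
          (fun y => fderiv ℝ (fun y => w y (Fin.last m)) y vert) x := by
    intro v
    have hs : (fun s : ℝ => s * (s * psi s)) = fun s => s ^ 2 * psi s := by ext s; ring
    simp only [sub_apply, add_apply, smul_apply,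
      ContinuousLinearMap.comp_apply, ContinuousLinearMap.apply_apply, hD₁', hD₂', smul_eq_mul,
      ← hibp, hs]
    ring
  refine ⟨_, hD, fun j => ?_, ?_⟩
  · rw [hval]
    rfl
  refine ContinuousLinearMap.opNorm_le_bound _ (by positivity) fun v => ?_
  rw [hval, Real.norm_eq_abs]
  have hv : ∀ k y, |fderiv ℝ (fun y => w y k) y v| ≤ M * ‖v‖ := fun k y =>
    ((fderiv ℝ (fun y => w y k) y).le_opNorm v).trans
      (mul_le_mul_of_nonneg_right (hM k y) (norm_nonneg _))
  have hn : ∀ k y, |fderiv ℝ (fun y => w y k) y vert| ≤ M := fun k y => by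
    have := (fderiv ℝ (fun y => w y k) y).le_opNorm vert
    rw [norm_vert, mul_one] at this
    exact this.trans (hM k y)
  have g1 : |fderiv ℝ δ x (basisVec i)| ≤ K := by
    have := (fderiv ℝ δ x).le_opNorm (basisVec i)
    rw [norm_basisVec, mul_one] at this
    exact this.trans (hδ.norm_fderiv_le x hx)
  have g2 : |fderiv ℝ δ x v| ≤ K * ‖v‖ :=
    ((fderiv ℝ δ x).le_opNorm v).trans
      (mul_le_mul_of_nonneg_right (hδ.norm_fderiv_le x hx) (norm_nonneg _))
  have hδ0 : 0 ≤ δ x := by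
    have h1 := hδ.two_mul_height_le x hx
    have h2 := mem_upper.1 hx
    linarith
  have g3 : |δ x * fderiv ℝ (fderiv ℝ δ) x v (basisVec i)| ≤ K * ‖v‖ := by
    have h1 := (fderiv ℝ (fderiv ℝ δ) x v).le_opNorm (basisVec i)
    have h2 := (fderiv ℝ (fderiv ℝ δ) x).le_opNorm v
    rw [norm_basisVec, mul_one] at h1
    rw [abs_mul, abs_of_nonneg hδ0]
    calc δ x * |fderiv ℝ (fderiv ℝ δ) x v (basisVec i)|
        ≤ δ x * (‖fderiv ℝ (fderiv ℝ δ) x‖ * ‖v‖) :=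
          mul_le_mul_of_nonneg_left (h1.trans h2) hδ0
      _ = δ x * ‖fderiv ℝ (fderiv ℝ δ) x‖ * ‖v‖ := by ring
      _ ≤ _ := mul_le_mul_of_nonneg_right (hδ.mul_norm_fderiv_fderiv_le x hx) (norm_nonneg _)
  have t1 : |vavg δ psi (fun y => fderiv ℝ (fun y => w y i) y v) x| ≤ 10 * (M * ‖v‖) :=
    abs_vavg_le (fun s hs => abs_psi_le hs) (hv i)
  have t2 := abs_vavg_le (δ := δ) (x := x) (fun s hs => abs_mul_psi_le hs) (hv (Fin.last m))
  have t3 := abs_vavg_le (δ := δ) (x := x) (fun s hs => abs_mul_psi_le hs) (hn i)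
  have t4 := abs_vavg_le (δ := δ) (x := x) (fun s hs => abs_sq_mul_psi_le hs) (hn (Fin.last m))
  have t5 := abs_vavg_le (δ := δ) (x := x) (fun s hs => abs_psiPrim_le hs) (hn (Fin.last m))
  have hv0 := norm_nonneg v
  refine (abs_sub _ _).trans ((add_le_add ((abs_add_le _ _).trans (add_le_add ((abs_sub _ _).trans
    (add_le_add ((abs_sub _ _).trans (add_le_add t1
      ((abs_mul _ _).trans_le (mul_le_mul g1 t2 (abs_nonneg _) hK0))))
      ((abs_mul _ _).trans_le (mul_le_mul g2 t3 (abs_nonneg _) (by positivity)))))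
      ((abs_mul _ _).trans_le (mul_le_mul ((abs_mul _ _).trans_le
        (mul_le_mul g1 g2 (abs_nonneg _) hK0)) t4 (abs_nonneg _) (by positivity)))))
      ((abs_mul _ _).trans_le (mul_le_mul g3 t5 (abs_nonneg _) (by positivity)))).trans
        (le_of_eq ?_))
  ring

/-- The reflection of a smooth map agrees with the map on the graph, to first order in the
height. -/
lemma abs_reflMap_sub_le (hδ : IsRegDist φ K δ)
    (hw : ∀ i, ContDiff ℝ 1 fun y => w y i) (hM : ∀ i y, ‖fderiv ℝ (fun y => w y i) y‖ ≤ M)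
    (hx : x ∈ upper φ) (i : Fin (m + 1)) :
    |reflMap δ w x i - w x i| ≤ (20 + 84 * K) * K * M * height φ x := by
  have hK0 := hδ.nonneg
  have hM0 : 0 ≤ M := (norm_nonneg _).trans (hM i x)
  have hx' := mem_upper.1 hx
  have hδ0 : 0 ≤ δ x := by
    have h1 := hδ.two_mul_height_le x hx
    linarith
  have g1 : |fderiv ℝ δ x (basisVec i)| ≤ K := by
    have := (fderiv ℝ δ x).le_opNorm (basisVec i)
    rw [norm_basisVec, mul_one] at this
    exact this.trans (hδ.norm_fderiv_le x hx)
  have t5 : |vavg δ psiPrim (fun y => fderiv ℝ (fun y => w y (Fin.last m)) y vert) x| ≤ 84 * M :=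
    abs_vavg_le (fun s hs => abs_psiPrim_le hs) fun y => by
      have := (fderiv ℝ (fun y => w y (Fin.last m)) y).le_opNorm vert
      rw [norm_vert, mul_one] at this
      exact this.trans (hM _ y)
  have t1 : |vavg δ psi (fun y => w y i) x - w x i| ≤ 20 * M * δ x := by
    have h1 : vavg δ psi (fun y => w y i) x - w x i
        = ∫ s in (1 : ℝ)..2, psi s * (w (x - (s * δ x) • vert) i - w x i) := by
      conv_lhs => rw [← one_mul (w x i), ← integral_psi, ← intervalIntegral.integral_mul_const]
      unfold vavg
      rw [← intervalIntegral.integral_sub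
        (intervalIntegrable_vavg continuous_psi (hw i).continuous)
        (Continuous.intervalIntegrable (by have := continuous_psi; fun_prop) _ _)]
      refine intervalIntegral.integral_congr fun s _ => ?_
      ring
    rw [h1]
    have h2 := intervalIntegral.norm_integral_le_of_norm_le_const (a := 1) (b := 2)
      (C := 10 * (M * (2 * δ x)))
      (f := fun s => psi s * (w (x - (s * δ x) • vert) i - w x i)) fun s hs => ?_
    · rw [abs_of_pos (by norm_num), Real.norm_eq_abs] at h2
      linarith
    · rw [Set.uIoc_of_le (by norm_num)] at hs
      rw [norm_mul]
      refine mul_le_mul (abs_psi_le ⟨hs.1.le, hs.2⟩) ?_ (norm_nonneg _) (by norm_num)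
      have h3 := Convex.norm_image_sub_le_of_norm_fderiv_le (𝕜 := ℝ) (s := Set.univ)
        (f := fun y => w y i) (x := x) (y := x - (s * δ x) • vert)
        (fun y _ => (hw i).differentiable (by simp) y) (fun y _ => hM i y) convex_univ
        (Set.mem_univ _) (Set.mem_univ _)
      refine h3.trans (mul_le_mul_of_nonneg_left ?_ hM0)
      rw [sub_sub_cancel_left, norm_neg, norm_smul, norm_vert, mul_one,
        Real.norm_of_nonneg (mul_nonneg (by linarith [hs.1]) hδ0)]
      exact mul_le_mul_of_nonneg_right hs.2 hδ0
  have h4 : reflMap δ w x i - w x i = (vavg δ psi (fun y => w y i) x - w x i)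
      - fderiv ℝ δ x (basisVec i) * (δ x *
        vavg δ psiPrim (fun y => fderiv ℝ (fun y => w y (Fin.last m)) y vert) x) := by
    rw [delta_mul_vavg_psiPrim (hw (Fin.last m))]
    simp only [reflMap]
    ring
  rw [h4]
  refine (abs_sub _ _).trans ?_
  rw [abs_mul, abs_mul, abs_of_nonneg hδ0]
  calc _ ≤ 20 * M * δ x + K * (δ x * (84 * M)) := by gcongr
    _ = (20 + 84 * K) * M * δ x := by ring
    _ ≤ (20 + 84 * K) * M * (K * height φ x) := by
        gcongr
        exact hδ.le_mul_height x hx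
    _ = _ := by ring

end Smooth

/-- A function that vanishes outside the region above a Lipschitz graph, is bounded by the height
and has bounded gradient there, is Lipschitz: two points of that region can be joined inside it
unless their distance is at least comparable with their heights. -/
lemma lipschitzWith_of_upper {L : ℝ≥0} (hφ : LipschitzWith L φ) {v : Rn (m + 1) → ℝ} {a b : ℝ}
    (ha : 0 ≤ a) (hb : 0 ≤ b) (h0 : ∀ x, x ∉ upper φ → v x = 0)
    (hh : ∀ x ∈ upper φ, |v x| ≤ a * height φ x)
    (hd : ∀ x ∈ upper φ, ∃ D : Rn (m + 1) →L[ℝ] ℝ, HasFDerivAt v D x ∧ ‖D‖ ≤ b) :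
    LipschitzWith (Real.toNNReal (3 * (1 + L) * a + b)) v := by
  set Λ : ℝ := 1 + L with hΛ
  have hΛ0 : 0 < Λ := by positivity
  have hpos : 0 ≤ 3 * Λ * a + b := by positivity
  have key : ∀ x y, x ∈ upper φ → |v x - v y| ≤ (3 * Λ * a + b) * ‖x - y‖ := by
    intro x y hx
    have hx' := mem_upper.1 hx
    by_cases hxy : ‖x - y‖ < height φ x / Λ
    · have hsub : ∀ z ∈ Metric.ball x (height φ x / Λ), z ∈ upper φ := fun z hz => by
        rw [Metric.mem_ball', dist_eq_norm, lt_div_iff₀' hΛ0] at hz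
        have h1 := (le_abs_self _).trans (abs_height_sub_le hφ x z)
        rw [← hΛ] at h1
        exact mem_upper.2 (by linarith)
      have h1 := Convex.norm_image_sub_le_of_norm_fderiv_le (𝕜 := ℝ) (f := v) (C := b)
        (s := Metric.ball x (height φ x / Λ)) (x := y) (y := x)
        (fun z hz => (hd z (hsub z hz)).choose_spec.1.differentiableAt)
        (fun z hz => by
          rw [(hd z (hsub z hz)).choose_spec.1.fderiv]
          exact (hd z (hsub z hz)).choose_spec.2) (convex_ball _ _)
        (by rwa [Metric.mem_ball', dist_eq_norm]) (Metric.mem_ball_self (by positivity))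
      refine h1.trans (mul_le_mul_of_nonneg_right ?_ (norm_nonneg _))
      linarith [show 0 ≤ 3 * Λ * a by positivity]
    · rw [not_lt, div_le_iff₀' hΛ0] at hxy
      have h1 := (neg_le_abs _).trans (abs_height_sub_le hφ x y)
      rw [← hΛ] at h1
      have h2 : |v y| ≤ a * (2 * (Λ * ‖x - y‖)) := by
        by_cases hy : y ∈ upper φ
        · exact (hh y hy).trans (mul_le_mul_of_nonneg_left (by linarith) ha)
        · rw [h0 y hy, abs_zero]
          positivity
      have h3 : |v x| ≤ a * (Λ * ‖x - y‖) := (hh x hx).trans (mul_le_mul_of_nonneg_left hxy ha)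
      refine (abs_sub _ _).trans ?_
      nlinarith [mul_nonneg hb (norm_nonneg (x - y))]
  refine LipschitzWith.of_dist_le_mul fun x y => ?_
  rw [Real.dist_eq, dist_eq_norm, Real.coe_toNNReal _ hpos]
  by_cases hx : x ∈ upper φ
  · exact key x y hx
  by_cases hy : y ∈ upper φ
  · rw [abs_sub_comm, norm_sub_rev]
    exact key y x hy
  · rw [h0 x hx, h0 y hy, sub_zero, abs_zero]
    exact mul_nonneg hpos (norm_nonneg _)

open Classical in
/-- The extension of `u` by its reflection above the graph. -/
def extMap (φ : Rn m → ℝ) (δ : Rn (m + 1) → ℝ) (u : Rn (m + 1) → Rn (m + 1)) :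
    Rn (m + 1) → Rn (m + 1) := (upper φ).piecewise (reflMap δ u) u

open Classical in
/-- The extension of a matrix field, such as the gradient of `u` or a part of it, that goes with
`extMap`. -/
def extGrad (φ : Rn m → ℝ) (δ : Rn (m + 1) → ℝ) (G : Rn (m + 1) → Mat (m + 1)) :
    Rn (m + 1) → Mat (m + 1) := (upper φ).piecewise (reflGrad δ G) G

section Extension

variable {δ : Rn (m + 1) → ℝ} {u : Rn (m + 1) → Rn (m + 1)} {G : Rn (m + 1) → Mat (m + 1)}
  {x : Rn (m + 1)}

lemma extMap_of_mem (hx : x ∈ upper φ) : extMap φ δ u x = reflMap δ u x := by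
  classical exact Set.piecewise_eq_of_mem _ _ _ hx

lemma extMap_of_notMem (hx : x ∉ upper φ) : extMap φ δ u x = u x := by
  classical exact Set.piecewise_eq_of_notMem _ _ _ hx

lemma extGrad_of_mem (hx : x ∈ upper φ) : extGrad φ δ G x = reflGrad δ G x := by
  classical exact Set.piecewise_eq_of_mem _ _ _ hx

lemma extGrad_of_notMem (hx : x ∉ upper φ) : extGrad φ δ G x = G x := by
  classical exact Set.piecewise_eq_of_notMem _ _ _ hx

lemma notMem_upper (hx : x ∈ subgraph φ) : x ∉ upper φ := fun h =>
  lt_asymm (mem_subgraph.1 hx) (mem_upper.1 h)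

end Extension

/-- For smooth maps the extension is Lipschitz, so the weak gradient may be computed almost
everywhere. -/
lemma integral_extMap_mul_fderiv {L : ℝ≥0} (hφ : LipschitzWith L φ) {K M : ℝ}
    {δ : Rn (m + 1) → ℝ} (hδ : IsRegDist φ K δ) {w : Rn (m + 1) → Rn (m + 1)}
    (hw : ∀ i, ContDiff ℝ 1 fun y => w y i) (hM : ∀ i y, ‖fderiv ℝ (fun y => w y i) y‖ ≤ M)
    {η : Rn (m + 1) → ℝ} (hη : ContDiff ℝ ∞ η) (hηc : HasCompactSupport η) (i j : Fin (m + 1)) :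
    ∫ x, extMap φ δ w x i * fderiv ℝ η x (basisVec j)
      = -∫ x, extGrad φ δ (gradMat w) x i j * η x := by
  have hM0 : 0 ≤ M := (norm_nonneg _).trans (hM i 0)
  have hK0 := hδ.nonneg
  have hup := isOpen_upper hφ.continuous
  have hlow := isOpen_subgraph hφ.continuous
  set v : Rn (m + 1) → ℝ := fun x => extMap φ δ w x i - w x i with hv
  have hvup : ∀ x ∈ upper φ, v x = reflMap δ w x i - w x i := fun x hx => by
    simp only [hv, extMap_of_mem hx]
  have hlip1 : LipschitzWith (Real.toNNReal M) fun x => w x i :=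
    lipschitzWith_of_nnnorm_fderiv_le ((hw i).differentiable (by simp)) fun x => by
      rw [← NNReal.coe_le_coe, coe_nnnorm, Real.coe_toNNReal _ hM0]
      exact hM i x
  have hDer : ∀ x ∈ upper φ, ∃ D : Rn (m + 1) →L[ℝ] ℝ,
      HasFDerivAt (fun x => extMap φ δ w x i) D x ∧
      (∀ j, D (basisVec j) = reflGrad δ (gradMat w) x i j) ∧
      ‖D‖ ≤ (10 + 124 * K + 40 * K ^ 2) * M := fun x hx => by
    obtain ⟨D, hD, hD'⟩ := reflMap_fderiv hφ.continuous hδ hw hM hx i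
    refine ⟨D, hD.congr_of_eventuallyEq ?_, hD'⟩
    filter_upwards [hup.mem_nhds hx] with y hy
    rw [extMap_of_mem hy]
  have hlip2 := lipschitzWith_of_upper hφ (v := v) (a := (20 + 84 * K) * K * M)
    (b := (10 + 124 * K + 40 * K ^ 2) * M + M) (by positivity) (by positivity)
    (fun x hx => by simp only [hv, extMap_of_notMem hx, sub_self])
    (fun x hx => by rw [hvup x hx]; exact abs_reflMap_sub_le hδ hw hM hx i)
    (fun x hx => by
      obtain ⟨D, hD, -, hD'⟩ := hDer x hx
      refine ⟨_, hD.sub ((hw i).differentiable (by simp) x).hasFDerivAt, ?_⟩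
      exact (norm_sub_le _ _).trans (add_le_add hD' (hM i x)))
  have hlip := hlip1.add hlip2
  have hsum : (fun x => w x i + v x) = fun x => extMap φ δ w x i := by
    ext x
    simp [hv]
  rw [hsum] at hlip
  have hηlip := hη.lipschitzWith_of_hasCompactSupport hηc (by simp)
  obtain ⟨C, hC⟩ := hηlip
  have hibp := hlip.integral_lineDeriv_mul_eq (μ := volume) hC hηc (basisVec j)
  have h1 : ∀ x, lineDeriv ℝ η x (-basisVec j) = -fderiv ℝ η x (basisVec j) := fun x => by
    rw [(hη.differentiable (by simp) x).lineDeriv_eq_fderiv, map_neg]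
  have h2 : ∀ᵐ x : Rn (m + 1), lineDeriv ℝ (fun x => extMap φ δ w x i) x (basisVec j)
      = extGrad φ δ (gradMat w) x i j := by
    have h0 : ∀ᵐ x : Rn (m + 1), height φ x ≠ 0 :=
      measure_eq_zero_iff_ae_notMem.1 (volume_graph_eq_zero hφ.continuous)
    filter_upwards [h0] with x hx
    rcases lt_or_gt_of_ne hx with hx | hx
    · have hx' : x ∈ subgraph φ := mem_subgraph.2 hx
      have hD : HasFDerivAt (fun x => extMap φ δ w x i) (fderiv ℝ (fun y => w y i) x) x := by
        refine ((hw i).differentiable (by simp) x).hasFDerivAt.congr_of_eventuallyEq ?_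
        filter_upwards [hlow.mem_nhds hx'] with y hy
        rw [extMap_of_notMem (notMem_upper hy)]
      rw [hD.differentiableAt.lineDeriv_eq_fderiv, hD.fderiv]
      rw [extGrad_of_notMem (notMem_upper hx')]
      rfl
    · obtain ⟨D, hD, hD', -⟩ := hDer x hx
      rw [hD.differentiableAt.lineDeriv_eq_fderiv, hD.fderiv, hD']
      rw [extGrad_of_mem (mem_upper.2 hx)]
  rw [integral_congr_ae (h2.mono fun x hx => by
    show _ = extGrad φ δ (gradMat w) x i j * η x
    rw [hx])] at hibp
  rw [hibp, ← integral_neg]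
  refine integral_congr_ae (ae_of_all _ fun x => ?_)
  simp only [h1]
  ring

/-! ### Smooth approximation up to the graph -/

section Mollification

variable {n : ℕ}

/-- Translation is continuous in `L¹`. -/
lemma exists_lintegral_translate_sub_le {h : Rn n → ℝ} (hi : Integrable h) {ε : ℝ≥0∞}
    (hε : 0 < ε) : ∃ ρ : ℝ, 0 < ρ ∧ ∀ z : Rn n, ‖z‖ < ρ → ∫⁻ x, ‖h (x - z) - h x‖ₑ ≤ ε := by
  let g : C(Rn n, C(Rn n, Rn n)) :=
    ContinuousMap.curry ⟨fun p : Rn n × Rn n => p.2 - p.1, by fun_prop⟩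
  have hg : ∀ z x, g z x = x - z := fun z x => rfl
  have hmp : ∀ z : Rn n, MeasurePreserving (g z) volume volume := fun z =>
    measurePreserving_sub_right volume z
  have hL : MemLp h 1 := memLp_one_iff_integrable.2 hi
  have hc : Continuous fun z : Rn n => Lp.compMeasurePreserving (p := 1) (g z) (hmp z) (hL.toLp h) :=
    continuous_const.compMeasurePreservingLp g.continuous hmp (by simp)
  have h0 := (EMetric.tendsto_nhds.1 (hc.tendsto 0)) ε hε
  obtain ⟨ρ, hρ, hρ'⟩ := Metric.eventually_nhds_iff_ball.1 h0
  refine ⟨ρ, hρ, fun z hz => ?_⟩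
  have h1 := (hρ' z (by simpa using hz)).le
  rw [Lp.edist_def, eLpNorm_one_eq_lintegral_enorm] at h1
  refine le_of_eq_of_le (lintegral_congr_ae ?_) h1
  have e1 := Lp.coeFn_compMeasurePreserving (hL.toLp h) (hmp z)
  have e2 := Lp.coeFn_compMeasurePreserving (hL.toLp h) (hmp 0)
  have e3 := hL.coeFn_toLp
  have e4 := (hmp z).quasiMeasurePreserving.ae_eq_comp e3
  have e5 := (hmp 0).quasiMeasurePreserving.ae_eq_comp e3
  filter_upwards [e1, e2, e4, e5] with x f1 f2 f4 f5
  simp only [Pi.sub_apply]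
  rw [f1, f2, f4, f5]
  simp only [Function.comp_apply, hg, sub_zero]

/-- The mollification `h ∗ ρ`. -/
def mollify (ρ h : Rn n → ℝ) (x : Rn n) : ℝ := ∫ z, ρ z * h (x - z)

variable {ρ h : Rn n → ℝ}

lemma mollify_eq_convolution : mollify ρ h = convolution h ρ (ContinuousLinearMap.mul ℝ ℝ) volume := by
  ext x
  rw [convolution_mul_swap]
  simp only [mollify, mul_comm]

lemma mollify_eq_integral (x : Rn n) : mollify ρ h x = ∫ t, h t * ρ (x - t) := by
  rw [mollify_eq_convolution, convolution_mul]

lemma contDiff_mollify (hρ : ContDiff ℝ ∞ ρ) (hρc : HasCompactSupport ρ) (hi : Integrable h) :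
    ContDiff ℝ ∞ (mollify ρ h) := by
  rw [mollify_eq_convolution]
  exact hρc.contDiff_convolution_right _ hi.locallyIntegrable hρ

lemma fderiv_mollify (hρ : ContDiff ℝ ∞ ρ) (hρc : HasCompactSupport ρ) (hi : Integrable h)
    (x v : Rn n) : fderiv ℝ (mollify ρ h) x v = ∫ t, h t * fderiv ℝ ρ (x - t) v := by
  have h1 := hρc.hasFDerivAt_convolution_right (ContinuousLinearMap.mul ℝ ℝ)
    hi.locallyIntegrable (hρ.of_le (by simp)) x
  rw [mollify_eq_convolution, h1.fderiv, convolution_precompR_apply _ hi.locallyIntegrable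
    (hρc.fderiv ℝ) (hρ.continuous_fderiv (by simp)), convolution_mul]

lemma hasCompactSupport_mollify (hρc : HasCompactSupport ρ) (hc : HasCompactSupport h) :
    HasCompactSupport (mollify ρ h) := by
  rw [mollify_eq_convolution]
  exact hc.convolution _ hρc

/-- Mollification is close to the identity in `L¹` as soon as the translations by vectors in the
support of the kernel are. -/
lemma lintegral_mollify_sub_le (hρ : Continuous ρ) (hρc : HasCompactSupport ρ) (hρ0 : ∀ z, 0 ≤ ρ z)
    (hρ1 : ∫ z, ρ z = 1) (hm : Measurable h) (hi : Integrable h) {ε : ℝ≥0∞}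
    (hε : ∀ z, ρ z ≠ 0 → ∫⁻ x, ‖h (x - z) - h x‖ₑ ≤ ε) :
    ∫⁻ x, ‖mollify ρ h x - h x‖ₑ ≤ ε := by
  have hρi : Integrable ρ := hρ.integrable_of_hasCompactSupport hρc
  obtain ⟨B, hB⟩ := hρ.bounded_above_of_compact_support hρc
  have h1 : ∀ x, ‖mollify ρ h x - h x‖ₑ ≤ ∫⁻ z, ENNReal.ofReal (ρ z) * ‖h (x - z) - h x‖ₑ := by
    intro x
    have h2 : mollify ρ h x - h x = ∫ z, ρ z * (h (x - z) - h x) := by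
      conv_lhs => rw [← one_mul (h x), ← hρ1, ← integral_mul_const]
      unfold mollify
      rw [← integral_sub _ (hρi.mul_const _)]
      · refine integral_congr_ae (ae_of_all _ fun z => ?_)
        ring
      · exact (hi.comp_sub_left x).bdd_mul hρ.aestronglyMeasurable (ae_of_all _ hB)
    rw [h2]
    refine (enorm_integral_le_lintegral_enorm _).trans (lintegral_mono fun z => ?_)
    rw [enorm_mul, Real.enorm_of_nonneg (hρ0 z)]
  have hm2 : Measurable (Function.uncurry fun x z : Rn n =>
      ENNReal.ofReal (ρ z) * ‖h (x - z) - h x‖ₑ) := by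
    have := hρ.measurable
    fun_prop
  have hm3 : ∀ z, Measurable fun x => ‖h (x - z) - h x‖ₑ := fun z => by fun_prop
  calc ∫⁻ x, ‖mollify ρ h x - h x‖ₑ
      ≤ ∫⁻ x, ∫⁻ z, ENNReal.ofReal (ρ z) * ‖h (x - z) - h x‖ₑ := lintegral_mono h1
    _ = ∫⁻ z, ENNReal.ofReal (ρ z) * ∫⁻ x, ‖h (x - z) - h x‖ₑ := by
        rw [lintegral_lintegral_swap hm2.aemeasurable]
        exact lintegral_congr fun z => lintegral_const_mul _ (hm3 z)
    _ ≤ ∫⁻ z, ENNReal.ofReal (ρ z) * ε := by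
        refine lintegral_mono fun z => ?_
        by_cases hz : ρ z = 0
        · simp [hz]
        · gcongr
          exact hε z hz
    _ = ε := by
        rw [lintegral_mul_const _ (by have := hρ.measurable; fun_prop),
          ← ofReal_integral_eq_lintegral_ofReal hρi (ae_of_all _ hρ0), hρ1, ENNReal.ofReal_one,
          one_mul]

lemma fderiv_mollify_of_weak {S : Set (Rn n)} (hρ : ContDiff ℝ ∞ ρ)
    (hρc : HasCompactSupport ρ) (hi : Integrable h) {D : Rn n → ℝ} {j : Fin n}
    (hh0 : ∀ x, x ∉ S → h x = 0) (hD0 : ∀ x, x ∉ S → D x = 0)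
    (hw : IsWeakPartialDeriv S h j D) {x : Rn n} (hx : ∀ z ∈ tsupport ρ, x - z ∈ S) :
    fderiv ℝ (mollify ρ h) x (basisVec j) = mollify ρ D x := by
  have h1 := hw (fun t => ρ (x - t)) (hρ.comp (by fun_prop))
    (hρc.comp_homeomorph (Homeomorph.subLeft x)) (by
      refine (tsupport_comp_subset_preimage ρ (f := fun t => x - t) (by fun_prop)).trans ?_
      intro t ht
      have := hx (x - t) ht
      rwa [sub_sub_cancel] at this)
  have h2 : ∀ t, fderiv ℝ (fun t => ρ (x - t)) t (EuclideanSpace.single j 1)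
      = -fderiv ℝ ρ (x - t) (basisVec j) := fun t => by
    have := ((hρ.differentiable (by simp) (x - t)).hasFDerivAt).comp (f := fun t => x - t) t
      ((hasFDerivAt_id t).const_sub x)
    have h3 : HasFDerivAt (fun t => ρ (x - t)) _ t := this
    rw [h3.fderiv]
    simp [basisVec]
  simp only [h2, mul_neg, integral_neg, neg_inj] at h1
  rw [fderiv_mollify hρ hρc hi, mollify_eq_integral]
  rw [setIntegral_eq_integral_of_forall_compl_eq_zero (fun t ht => by rw [hh0 t ht, zero_mul]),
    setIntegral_eq_integral_of_forall_compl_eq_zero (fun t ht => by rw [hD0 t ht, zero_mul])] at h1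
  exact h1

end Mollification

/-- A Sobolev map on the part of a ball below a Lipschitz graph is approximated, on a smaller
ball and up to the graph, by smooth maps on the whole space. The mollification kernel lives in a
small ball centred at a point of the positive `eₙ`-axis, so that only values below the graph are
used. -/
theorem exists_smooth_approx {L : ℝ≥0} (hφ : LipschitzWith L φ) {R R' : ℝ} (hR : R' < R)
    {u : Rn (m + 1) → Rn (m + 1)} {G : Rn (m + 1) → Mat (m + 1)}
    (hum : ∀ i, Measurable fun x => u x i) (hGm : ∀ i j, Measurable fun x => G x i j)
    (hui : ∀ i, Integrable fun x => u x i) (hGi : ∀ i j, Integrable fun x => G x i j)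
    (hu0 : ∀ x, x ∉ Metric.ball 0 R ∩ subgraph φ → u x = 0)
    (hG0 : ∀ x, x ∉ Metric.ball 0 R ∩ subgraph φ → G x = 0)
    (hw : ∀ i j, IsWeakPartialDeriv (Metric.ball 0 R ∩ subgraph φ) (fun x => u x i) j
      fun x => G x i j) {ε : ℝ≥0∞} (hε : 0 < ε) :
    ∃ (w : Rn (m + 1) → Rn (m + 1)) (M : ℝ), (∀ i, ContDiff ℝ 1 fun y => w y i) ∧
      (∀ i y, ‖fderiv ℝ (fun y => w y i) y‖ ≤ M) ∧
      (∀ i, ∫⁻ x, ‖w x i - u x i‖ₑ ≤ ε) ∧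
      ∀ i j, ∫⁻ x in Metric.ball 0 R' ∩ subgraph φ, ‖gradMat w x i j - G x i j‖ₑ ≤ ε := by
  choose ρu hρu0 hρu using fun i => exists_lintegral_translate_sub_le (hui i) hε
  choose ρG hρG0 hρG using fun i j => exists_lintegral_translate_sub_le (hGi i j) hε
  obtain ⟨ρ₀, hρ₀, hρ₀u, hρ₀G, hρ₀R⟩ : ∃ ρ₀ : ℝ, 0 < ρ₀ ∧ (∀ i, ρ₀ ≤ ρu i) ∧
      (∀ i j, ρ₀ ≤ ρG i j) ∧ ρ₀ ≤ R - R' := by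
    obtain ⟨i₀, hi₀⟩ := Finite.exists_min ρu
    obtain ⟨p₀, hp₀⟩ := Finite.exists_min fun p : Fin (m + 1) × Fin (m + 1) => ρG p.1 p.2
    refine ⟨min (ρu i₀) (min (ρG p₀.1 p₀.2) (R - R')),
      lt_min (hρu0 i₀) (lt_min (hρG0 _ _) (by linarith)), fun i => (min_le_left _ _).trans (hi₀ i),
      fun i j => ((min_le_right _ _).trans (min_le_left _ _)).trans (hp₀ (i, j)),
      (min_le_right _ _).trans (min_le_right _ _)⟩
  set Λ : ℝ := 1 + L with hΛ
  have hΛ0 : 0 < Λ := by positivity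
  set b : ℝ := ρ₀ / (2 * (1 + Λ)) with hb
  have hb0 : 0 < b := by positivity
  have hbρ : (1 + Λ) * b < ρ₀ := by
    have : (1 + Λ) * b = ρ₀ / 2 := by rw [hb]; field_simp
    linarith
  let f : ContDiffBump ((Λ * b) • (vert : Rn (m + 1))) := ⟨b / 2, b, by linarith, by linarith⟩
  set ρ : Rn (m + 1) → ℝ := f.normed volume with hρ
  have hρs : ContDiff ℝ ∞ ρ := f.contDiff_normed
  have hρc : HasCompactSupport ρ := f.hasCompactSupport_normed
  have hsupp : tsupport ρ = Metric.closedBall ((Λ * b) • vert) b := f.tsupport_normed_eq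
  have hnorm : ∀ z ∈ tsupport ρ, ‖z‖ < ρ₀ := fun z hz => by
    rw [hsupp, Metric.mem_closedBall, dist_eq_norm] at hz
    have h1 : ‖z‖ ≤ ‖z - (Λ * b) • vert‖ + ‖(Λ * b) • (vert : Rn (m + 1))‖ := by
      have := norm_add_le (z - (Λ * b) • vert) ((Λ * b) • (vert : Rn (m + 1)))
      rwa [sub_add_cancel] at this
    rw [norm_smul, norm_vert, mul_one, Real.norm_of_nonneg (by positivity)] at h1
    linarith
  have happ : ∀ {h : Rn (m + 1) → ℝ} {ρ' : ℝ}, Measurable h → Integrable h → ρ₀ ≤ ρ' →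
      (∀ z, ‖z‖ < ρ' → ∫⁻ x, ‖h (x - z) - h x‖ₑ ≤ ε) → ∫⁻ x, ‖mollify ρ h x - h x‖ₑ ≤ ε :=
    fun hm hi hρ' hz => lintegral_mollify_sub_le hρs.continuous hρc (fun z => f.nonneg_normed z)
      f.integral_normed hm hi fun z hρz =>
        hz z ((hnorm z (subset_tsupport _ hρz)).trans_le hρ')
  have hucs : ∀ i, HasCompactSupport fun x => u x i := fun i =>
    HasCompactSupport.intro (isCompact_closedBall (0 : Rn (m + 1)) R) fun x hx => by
      rw [hu0 x fun h => hx (Metric.ball_subset_closedBall h.1)]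
      rfl
  have hcd : ∀ i, ContDiff ℝ ∞ (mollify ρ fun x => u x i) := fun i =>
    contDiff_mollify hρs hρc (hui i)
  choose B hB using fun i => ((hcd i).continuous_fderiv (by simp)).bounded_above_of_compact_support
    ((hasCompactSupport_mollify hρc (hucs i)).fderiv ℝ)
  obtain ⟨i₁, hi₁⟩ := Finite.exists_max B
  refine ⟨fun x => WithLp.toLp 2 fun i => mollify ρ (fun x => u x i) x, B i₁,
    fun i => (hcd i).of_le (by simp), fun i y => (hB i y).trans (hi₁ i),
    fun i => happ (hum i) (hui i) (hρ₀u i) (hρu i), fun i j => ?_⟩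
  have hSm' : MeasurableSet (Metric.ball 0 R' ∩ subgraph φ) :=
    measurableSet_ball.inter (isOpen_subgraph hφ.continuous).measurableSet
  refine le_trans ?_ (happ (hGm i j) (hGi i j) (hρ₀G i j) (hρG i j))
  rw [← lintegral_indicator hSm']
  refine lintegral_mono fun x => ?_
  by_cases hx : x ∈ Metric.ball 0 R' ∩ subgraph φ
  · rw [Set.indicator_of_mem hx]
    refine le_of_eq ?_
    congr 2
    refine fderiv_mollify_of_weak hρs hρc (hui i) (fun x hx => by rw [hu0 x hx]; rfl)
      (fun x hx => by rw [hG0 x hx]; rfl) (hw i j) fun z hz => ⟨?_, ?_⟩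
    · have h1 := hnorm z hz
      have h2 := mem_ball_zero_iff.1 hx.1
      rw [mem_ball_zero_iff]
      refine (norm_sub_le _ _).trans_lt ?_
      linarith
    · rw [hsupp, Metric.mem_closedBall, dist_eq_norm] at hz
      rw [mem_subgraph]
      have h1 := mem_subgraph.1 hx.2
      have h2 := (le_abs_self _).trans (abs_height_sub_le hφ (x - z) (x - (Λ * b) • vert))
      rw [height_sub_smul_vert, sub_sub_sub_cancel_left, norm_sub_rev, ← hΛ] at h2
      nlinarith
  · rw [Set.indicator_of_notMem hx]
    exact zero_le

/-! ### `L¹` bounds for the extension operators -/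

section MatNorm

variable {n : ℕ} (A : Mat n)

lemma matNorm_nonneg : 0 ≤ matNorm A := Real.sqrt_nonneg _

lemma abs_apply_le_matNorm (i j : Fin n) : |A i j| ≤ matNorm A := by
  rw [matNorm, ← Real.sqrt_sq_eq_abs]
  refine Real.sqrt_le_sqrt ?_
  exact (Finset.single_le_sum (f := fun j => A i j ^ 2) (fun j _ => sq_nonneg _)
    (Finset.mem_univ j)).trans (Finset.single_le_sum (f := fun i => ∑ j, A i j ^ 2)
    (fun i _ => Finset.sum_nonneg fun j _ => sq_nonneg _) (Finset.mem_univ i))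

lemma matNorm_le_sum : matNorm A ≤ ∑ i, ∑ j, |A i j| := by
  have h0 : ∀ i, 0 ≤ ∑ j, |A i j| := fun i => Finset.sum_nonneg fun j _ => abs_nonneg _
  refine Real.sqrt_le_iff.2 ⟨Finset.sum_nonneg fun i _ => h0 i, ?_⟩
  calc ∑ i, ∑ j, A i j ^ 2 ≤ ∑ i, (∑ j, |A i j|) ^ 2 := by
        refine Finset.sum_le_sum fun i _ => ?_
        simp only [← sq_abs (A i _)]
        exact Finset.sum_sq_le_sq_sum_of_nonneg fun j _ => abs_nonneg _
    _ ≤ _ := Finset.sum_sq_le_sq_sum_of_nonneg fun i _ => h0 i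

lemma measurable_matNorm {α : Type*} [MeasurableSpace α] {G : α → Mat n}
    (hG : ∀ i j, Measurable fun x => G x i j) : Measurable fun x => matNorm (G x) := by
  unfold matNorm
  fun_prop

lemma ofReal_matNorm_le_sum : ENNReal.ofReal (matNorm A) ≤ ∑ i, ∑ j, ‖A i j‖ₑ := by
  have h : ∀ a : Fin n → Fin n → ℝ,
      ENNReal.ofReal (∑ i, ∑ j, |a i j|) = ∑ i, ∑ j, ‖a i j‖ₑ := fun a => by
    rw [ENNReal.ofReal_sum_of_nonneg fun i _ => Finset.sum_nonneg fun j _ => abs_nonneg _]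
    refine Finset.sum_congr rfl fun i _ => ?_
    rw [ENNReal.ofReal_sum_of_nonneg fun j _ => abs_nonneg _]
    simp only [Real.enorm_eq_ofReal_abs]
  exact (ENNReal.ofReal_le_ofReal (matNorm_le_sum A)).trans_eq (h A)

lemma enorm_apply_le_matNorm (i j : Fin n) : ‖A i j‖ₑ ≤ ENNReal.ofReal (matNorm A) := by
  rw [Real.enorm_eq_ofReal_abs]
  exact ENNReal.ofReal_le_ofReal (abs_apply_le_matNorm A i j)

end MatNorm

/-- The reflections `x ↦ x - s δ(x) eₙ`, `1 < s ≤ 2`, take the part of `V` above the graph to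
`S`, and `S` contains the part of `V` below the graph. -/
structure ReflectsInto {m : ℕ} (φ : Rn m → ℝ) (δ : Rn (m + 1) → ℝ) (V S : Set (Rn (m + 1))) :
    Prop where
  measurableSet_left : MeasurableSet V
  measurableSet_right : MeasurableSet S
  subset_subgraph : S ⊆ subgraph φ
  inter_subset : V ∩ subgraph φ ⊆ S
  mem : ∀ x ∈ V ∩ upper φ, ∀ s ∈ Set.Ioc (1 : ℝ) 2, x - (s * δ x) • vert ∈ S

section Bounds

variable {δ : Rn (m + 1) → ℝ} {θ : ℝ → ℝ} {V S : Set (Rn (m + 1))} {K : ℝ} {x : Rn (m + 1)}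

lemma ReflectsInto.lintegral_le (hV : ReflectsInto φ δ V S) (hφ : Continuous φ)
    (hδ : IsRegDist φ K δ) {F : Rn (m + 1) → ℝ≥0∞} (hF : Measurable F) :
    ∫⁻ x in V ∩ upper φ, ∫⁻ s in Set.Ioc (1 : ℝ) 2, F (x - (s * δ x) • vert)
      ≤ 2 * ∫⁻ x in S, F x := by
  have hup := (isOpen_upper hφ).measurableSet
  calc ∫⁻ x in V ∩ upper φ, ∫⁻ s in Set.Ioc (1 : ℝ) 2, F (x - (s * δ x) • vert)
      ≤ ∫⁻ x in V ∩ upper φ, ∫⁻ s in Set.Ioc (1 : ℝ) 2,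
          S.indicator F (x - (s * δ x) • vert) := by
        refine setLIntegral_mono' (hV.measurableSet_left.inter hup) fun x hx => ?_
        refine setLIntegral_mono' measurableSet_Ioc fun s hs => ?_
        rw [Set.indicator_of_mem (hV.mem x hx s hs)]
    _ ≤ ∫⁻ x in upper φ, ∫⁻ s in Set.Ioc (1 : ℝ) 2, S.indicator F (x - (s * δ x) • vert) :=
        lintegral_mono_set Set.inter_subset_right
    _ ≤ 2 * ∫⁻ x in subgraph φ, S.indicator F x :=
        lintegral_vertical_average_le hφ hδ.measurable hδ.two_mul_height_le
          (hF.indicator hV.measurableSet_right)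
    _ ≤ 2 * ∫⁻ x in S, F x := by
        refine mul_le_mul' le_rfl ?_
        rw [← lintegral_indicator hV.measurableSet_right F]
        exact setLIntegral_le_lintegral _ _

/-- Integrability of `h` along the segment on which `vavg δ θ h x` averages. -/
def AvgIntegrable (δ : Rn (m + 1) → ℝ) (h : Rn (m + 1) → ℝ) (x : Rn (m + 1)) : Prop :=
  IntegrableOn (fun s => h (x - (s * δ x) • vert)) (Set.Ioc 1 2)

lemma AvgIntegrable.intervalIntegrable {h : Rn (m + 1) → ℝ} (ha : AvgIntegrable δ h x)
    (hθ : Continuous θ) :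
    IntervalIntegrable (fun s => θ s * h (x - (s * δ x) • vert)) volume 1 2 :=
  ((intervalIntegrable_iff_integrableOn_Ioc_of_le (by norm_num)).2 ha).continuousOn_mul
    hθ.continuousOn

lemma ReflectsInto.ae_avgIntegrable (hV : ReflectsInto φ δ V S) (hφ : Continuous φ)
    (hδ : IsRegDist φ K δ) {h : Rn (m + 1) → ℝ} (hm : Measurable h) (hi : IntegrableOn h S) :
    ∀ᵐ x ∂volume.restrict (V ∩ upper φ),
      AvgIntegrable δ h x := by
  have hm2 : Measurable (Function.uncurry fun (x : Rn (m + 1)) (s : ℝ) =>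
      ‖h (x - (s * δ x) • vert)‖ₑ) := by
    have := hδ.measurable
    fun_prop
  have h1 : ∫⁻ x in V ∩ upper φ, ∫⁻ s in Set.Ioc (1 : ℝ) 2, ‖h (x - (s * δ x) • vert)‖ₑ ≠ ⊤ := by
    refine ne_top_of_le_ne_top ?_ (hV.lintegral_le hφ hδ (F := fun x => ‖h x‖ₑ) (by fun_prop))
    exact ENNReal.mul_ne_top (by simp) hi.2.ne
  have h2 := ae_lt_top (Measurable.lintegral_prod_right' hm2) h1
  filter_upwards [h2] with x hx
  exact ⟨(by fun_prop : Measurable fun s => h (x - (s * δ x) • vert)).aestronglyMeasurable, hx⟩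

/-- An extension whose values above the graph are bounded by vertical averages is bounded in
`L¹`. -/
lemma ReflectsInto.lintegral_extension_le (hV : ReflectsInto φ δ V S) (hφ : Continuous φ)
    (hδ : IsRegDist φ K δ) {Z : Rn (m + 1) → ℝ} {N : Rn (m + 1) → ℝ≥0∞} (hN : Measurable N)
    {c : ℝ≥0∞} (hc : c ≠ ⊤)
    (h1 : ∀ᵐ x ∂volume.restrict (V ∩ upper φ),
      ‖Z x‖ₑ ≤ c * ∫⁻ s in Set.Ioc (1 : ℝ) 2, N (x - (s * δ x) • vert))
    (h2 : ∀ x ∈ V ∩ subgraph φ, ‖Z x‖ₑ ≤ N x) :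
    ∫⁻ x in V, ‖Z x‖ₑ ≤ (2 * c + 1) * ∫⁻ x in S, N x := by
  have hup := (isOpen_upper hφ).measurableSet
  have hae : V =ᵐ[volume] ((V ∩ upper φ) ∪ (V ∩ subgraph φ) : Set (Rn (m + 1))) := by
    have h0 : ∀ᵐ x : Rn (m + 1), height φ x ≠ 0 :=
      measure_eq_zero_iff_ae_notMem.1 (volume_graph_eq_zero hφ)
    filter_upwards [h0] with x hx
    refine propext ⟨fun h => ?_, fun h => h.elim (fun h => h.1) fun h => h.1⟩
    rcases lt_or_gt_of_ne hx with hx | hx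
    · exact Or.inr ⟨h, mem_subgraph.2 hx⟩
    · exact Or.inl ⟨h, hx⟩
  rw [setLIntegral_congr hae]
  refine (lintegral_union_le _ _ _).trans ?_
  rw [add_mul, one_mul]
  refine add_le_add ?_ ?_
  · refine (lintegral_mono_ae h1).trans ?_
    rw [lintegral_const_mul' _ _ hc, mul_comm 2 c, mul_assoc]
    gcongr
    exact hV.lintegral_le hφ hδ hN
  · exact (setLIntegral_mono' (hV.measurableSet_left.inter (isOpen_subgraph hφ).measurableSet)
      h2).trans (lintegral_mono_set hV.inter_subset)

lemma enorm_vavg_le {W : ℝ} (hW : ∀ s ∈ Set.Icc (1 : ℝ) 2, |θ s| ≤ W) {h : Rn (m + 1) → ℝ}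
    {N : Rn (m + 1) → ℝ≥0∞} (hN : ∀ y, ‖h y‖ₑ ≤ N y) :
    ‖vavg δ θ h x‖ₑ ≤ ENNReal.ofReal W * ∫⁻ s in Set.Ioc (1 : ℝ) 2, N (x - (s * δ x) • vert) := by
  unfold vavg
  rw [intervalIntegral.integral_of_le (by norm_num), ← lintegral_const_mul' _ _ (by simp)]
  refine (enorm_integral_le_lintegral_enorm _).trans
    (setLIntegral_mono' measurableSet_Ioc fun s hs => ?_)
  rw [enorm_mul, Real.enorm_eq_ofReal_abs (θ s)]
  exact mul_le_mul' (ENNReal.ofReal_le_ofReal (hW s ⟨hs.1.le, hs.2⟩)) (hN _)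

lemma vavg_sub (hθ : Continuous θ) {a b : Rn (m + 1) → ℝ}
    (ha : AvgIntegrable δ a x)
    (hb : AvgIntegrable δ b x) :
    vavg δ θ (fun y => a y - b y) x = vavg δ θ a x - vavg δ θ b x := by
  unfold vavg
  rw [← intervalIntegral.integral_sub (ha.intervalIntegrable hθ) (hb.intervalIntegrable hθ)]
  simp only [mul_sub]

lemma vavg_half_add (hθ : Continuous θ) {a b : Rn (m + 1) → ℝ}
    (ha : AvgIntegrable δ a x)
    (hb : AvgIntegrable δ b x) :
    vavg δ θ (fun y => 1 / 2 * (a y + b y)) x = 1 / 2 * (vavg δ θ a x + vavg δ θ b x) := by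
  unfold vavg
  rw [← intervalIntegral.integral_add (ha.intervalIntegrable hθ) (hb.intervalIntegrable hθ), ← intervalIntegral.integral_const_mul]
  refine intervalIntegral.integral_congr fun s _ => ?_
  ring

lemma measurable_vavg (hδ : Measurable δ) (hθ : Continuous θ) {h : Rn (m + 1) → ℝ}
    (hm : Measurable h) : Measurable (vavg δ θ h) := by
  have h1 : Measurable fun z : Rn (m + 1) × ℝ => θ z.2 * h (z.1 - (z.2 * δ z.1) • vert) := by
    have := hθ.measurable
    fun_prop
  have h2 := (StronglyMeasurable.integral_prod_right
    (f := fun x s => θ s * h (x - (s * δ x) • vert)) h1.stronglyMeasurable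
    (ν := volume.restrict (Set.Ioc (1 : ℝ) 2))).measurable
  unfold vavg
  simpa only [intervalIntegral.integral_of_le (one_le_two : (1 : ℝ) ≤ 2)] using h2

lemma continuous_mul_psi : Continuous fun s => s * psi s := by
  have := continuous_psi
  fun_prop

lemma continuous_sq_mul_psi : Continuous fun s => s ^ 2 * psi s := by
  have := continuous_psi
  fun_prop

lemma measurable_reflMap (hδ : Measurable δ) {u : Rn (m + 1) → Rn (m + 1)}
    (hu : ∀ i, Measurable fun x => u x i) (i : Fin (m + 1)) :
    Measurable fun x => reflMap δ u x i :=
  (measurable_vavg hδ continuous_psi (hu i)).sub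
    ((measurable_fderiv_apply_const ℝ δ (basisVec i)).mul
      (measurable_vavg hδ continuous_mul_psi (hu (Fin.last m))))

lemma measurable_reflGrad (hδ : Measurable δ) {G : Rn (m + 1) → Mat (m + 1)}
    (hG : ∀ i j, Measurable fun x => G x i j) (i j : Fin (m + 1)) :
    Measurable fun x => reflGrad δ G x i j := by
  have g1 : ∀ i, Measurable fun x => fderiv ℝ δ x (basisVec i) := fun i =>
    measurable_fderiv_apply_const ℝ δ (basisVec i)
  have g2 : Measurable fun x => fderiv ℝ (fderiv ℝ δ) x (basisVec j) (basisVec i) :=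
    (ContinuousLinearMap.measurable_apply (basisVec i)).comp
      (measurable_fderiv_apply_const ℝ (fderiv ℝ δ) (basisVec j))
  exact (((((measurable_vavg hδ continuous_psi (hG i j)).sub
    ((g1 i).mul (measurable_vavg hδ continuous_mul_psi (hG _ j)))).sub
    ((g1 j).mul (measurable_vavg hδ continuous_mul_psi (hG i _)))).add
    (((g1 i).mul (g1 j)).mul (measurable_vavg hδ continuous_sq_mul_psi (hG _ _)))).sub
    ((hδ.mul g2).mul (measurable_vavg hδ continuous_psiPrim (hG _ _))))

lemma IsRegDist.abs_fderiv_apply_le (hδ : IsRegDist φ K δ) (hx : x ∈ upper φ) (i : Fin (m + 1)) :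
    |fderiv ℝ δ x (basisVec i)| ≤ K := by
  have := (fderiv ℝ δ x).le_opNorm (basisVec i)
  rw [norm_basisVec, mul_one] at this
  exact this.trans (hδ.norm_fderiv_le x hx)

lemma IsRegDist.pos (hδ : IsRegDist φ K δ) (hx : x ∈ upper φ) : 0 < δ x := by
  have h1 := hδ.two_mul_height_le x hx
  have h2 := mem_upper.1 hx
  linarith

lemma IsRegDist.abs_mul_hessian_le (hδ : IsRegDist φ K δ) (hx : x ∈ upper φ)
    (i j : Fin (m + 1)) :
    |δ x * fderiv ℝ (fderiv ℝ δ) x (basisVec j) (basisVec i)| ≤ K := by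
  have h1 := (fderiv ℝ (fderiv ℝ δ) x (basisVec j)).le_opNorm (basisVec i)
  have h2 := (fderiv ℝ (fderiv ℝ δ) x).le_opNorm (basisVec j)
  rw [norm_basisVec, mul_one] at h1 h2
  have h0 := (hδ.pos hx).le
  rw [abs_mul, abs_of_nonneg h0]
  exact (mul_le_mul_of_nonneg_left (h1.trans h2) h0).trans (hδ.mul_norm_fderiv_fderiv_le x hx)

lemma IsRegDist.hessian_symm (hφ : Continuous φ) (hδ : IsRegDist φ K δ) (hx : x ∈ upper φ)
    (v w : Rn (m + 1)) : fderiv ℝ (fderiv ℝ δ) x v w = fderiv ℝ (fderiv ℝ δ) x w v := by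
  refine second_derivative_symmetric_of_eventually_of_real (f := δ) (f' := fderiv ℝ δ) ?_
    (hδ.differentiableAt_fderiv x hx).hasFDerivAt v w
  filter_upwards [(isOpen_upper hφ).mem_nhds hx] with y hy
  exact (hδ.differentiableAt y hy).hasFDerivAt

lemma enorm_mul_le_ofReal_mul {a b c : ℝ} {B : ℝ≥0∞} (ha : |a| ≤ c) (hb : ‖b‖ₑ ≤ B) :
    ‖a * b‖ₑ ≤ ENNReal.ofReal c * B := by
  rw [enorm_mul, Real.enorm_eq_ofReal_abs a]
  exact mul_le_mul' (ENNReal.ofReal_le_ofReal ha) hb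

lemma enorm_reflMap_le (hδ : IsRegDist φ K δ) (hx : x ∈ upper φ) (u : Rn (m + 1) → Rn (m + 1))
    (i : Fin (m + 1)) : ‖reflMap δ u x i‖ₑ ≤ ENNReal.ofReal (10 + 20 * K) *
      ∫⁻ s in Set.Ioc (1 : ℝ) 2, ∑ k, ‖u (x - (s * δ x) • vert) k‖ₑ := by
  have hK0 := hδ.nonneg
  have hN : ∀ k y, ‖u y k‖ₑ ≤ ∑ k, ‖u y k‖ₑ := fun k y =>
    Finset.single_le_sum (f := fun k => ‖u y k‖ₑ) (fun _ _ => zero_le) (Finset.mem_univ k)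
  have t1 := enorm_vavg_le (δ := δ) (x := x) (fun s hs => abs_psi_le hs) (hN i)
  have t2 := enorm_vavg_le (δ := δ) (x := x) (fun s hs => abs_mul_psi_le hs) (hN (Fin.last m))
  refine enorm_sub_le.trans ((add_le_add t1
    (enorm_mul_le_ofReal_mul (hδ.abs_fderiv_apply_le hx i) t2)).trans (le_of_eq ?_))
  rw [ENNReal.ofReal_add (by norm_num) (by positivity), mul_comm 20 K, ENNReal.ofReal_mul hK0]
  ring

/-- The constant in the pointwise bound of `reflGrad` by a vertical average. -/
def reflConst (K : ℝ) : ℝ := 10 + 124 * K + 40 * K ^ 2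

lemma enorm_reflGrad_le (hδ : IsRegDist φ K δ) (hx : x ∈ upper φ) (G : Rn (m + 1) → Mat (m + 1))
    (i j : Fin (m + 1)) : ‖reflGrad δ G x i j‖ₑ ≤ ENNReal.ofReal (reflConst K) *
      ∫⁻ s in Set.Ioc (1 : ℝ) 2, ENNReal.ofReal (matNorm (G (x - (s * δ x) • vert))) := by
  have hK0 := hδ.nonneg
  have hN : ∀ i j y, ‖G y i j‖ₑ ≤ ENNReal.ofReal (matNorm (G y)) := fun i j y =>
    enorm_apply_le_matNorm (G y) i j
  have g := hδ.abs_fderiv_apply_le hx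
  have t1 := enorm_vavg_le (δ := δ) (x := x) (fun s hs => abs_psi_le hs) (hN i j)
  have t2 := enorm_vavg_le (δ := δ) (x := x) (fun s hs => abs_mul_psi_le hs) (hN (Fin.last m) j)
  have t3 := enorm_vavg_le (δ := δ) (x := x) (fun s hs => abs_mul_psi_le hs) (hN i (Fin.last m))
  have t4 := enorm_vavg_le (δ := δ) (x := x) (fun s hs => abs_sq_mul_psi_le hs)
    (hN (Fin.last m) (Fin.last m))
  have t5 := enorm_vavg_le (δ := δ) (x := x) (fun s hs => abs_psiPrim_le hs)
    (hN (Fin.last m) (Fin.last m))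
  have g2 : |fderiv ℝ δ x (basisVec i) * fderiv ℝ δ x (basisVec j)| ≤ K * K :=
    (abs_mul _ _).trans_le (mul_le_mul (g i) (g j) (abs_nonneg _) hK0)
  refine enorm_sub_le.trans ((add_le_add ((enorm_add_le _ _).trans (add_le_add (enorm_sub_le.trans
    (add_le_add (enorm_sub_le.trans (add_le_add t1 (enorm_mul_le_ofReal_mul (g i) t2)))
      (enorm_mul_le_ofReal_mul (g j) t3))) (enorm_mul_le_ofReal_mul g2 t4)))
    (enorm_mul_le_ofReal_mul (hδ.abs_mul_hessian_le hx i j) t5)).trans (le_of_eq ?_))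
  have e : reflConst K = 10 + K * 20 + K * 20 + K * K * 40 + K * 84 := by
    unfold reflConst; ring
  rw [e, ENNReal.ofReal_add (by positivity) (by positivity),
    ENNReal.ofReal_add (by positivity) (by positivity),
    ENNReal.ofReal_add (by positivity) (by positivity),
    ENNReal.ofReal_add (by positivity) (by positivity), ENNReal.ofReal_mul (by positivity),
    ENNReal.ofReal_mul (p := K * K) (by positivity), ENNReal.ofReal_mul (p := K) hK0 (q := 84),
    ENNReal.ofReal_mul (p := K) hK0 (q := 20),
    ENNReal.ofReal_mul (p := K) hK0 (q := K)]
  generalize ∫⁻ s in Set.Ioc (1 : ℝ) 2, ENNReal.ofReal (matNorm (G (x - (s * δ x) • vert))) = J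
  ring

lemma ofReal_matNorm_reflGrad_le (hδ : IsRegDist φ K δ) (hx : x ∈ upper φ)
    (G : Rn (m + 1) → Mat (m + 1)) : ENNReal.ofReal (matNorm (reflGrad δ G x))
      ≤ ENNReal.ofReal ((m + 1) ^ 2 * reflConst K) *
      ∫⁻ s in Set.Ioc (1 : ℝ) 2, ENNReal.ofReal (matNorm (G (x - (s * δ x) • vert))) := by
  refine (ofReal_matNorm_le_sum _).trans ((Finset.sum_le_sum fun i _ =>
    Finset.sum_le_sum fun j _ => enorm_reflGrad_le hδ hx G i j).trans (le_of_eq ?_))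
  simp only [Finset.sum_const, Finset.card_univ, Fintype.card_fin, nsmul_eq_mul]
  have : ((m : ℝ) + 1) ^ 2 = ((m + 1 : ℕ) : ℝ) * ((m + 1 : ℕ) : ℝ) := by push_cast; ring
  rw [this, mul_assoc, ENNReal.ofReal_mul (by positivity), ENNReal.ofReal_mul (by positivity),
    ENNReal.ofReal_natCast]
  ring

lemma reflMap_sub {u w : Rn (m + 1) → Rn (m + 1)}
    (hu : ∀ i, AvgIntegrable δ (fun y => u y i) x)
    (hw : ∀ i, AvgIntegrable δ (fun y => w y i) x) :
    reflMap δ (u - w) x = reflMap δ u x - reflMap δ w x := by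
  ext i
  have h1 := vavg_sub continuous_psi (hu i) (hw i)
  have h2 := vavg_sub continuous_mul_psi (hu (Fin.last m)) (hw (Fin.last m))
  simp only [reflMap, Pi.sub_apply, PiLp.sub_apply, h1, h2]
  ring

lemma reflGrad_sub {G H : Rn (m + 1) → Mat (m + 1)}
    (hG : ∀ i j, AvgIntegrable δ (fun y => G y i j) x)
    (hH : ∀ i j, AvgIntegrable δ (fun y => H y i j) x) :
    reflGrad δ (G - H) x = reflGrad δ G x - reflGrad δ H x := by
  ext i j
  have h1 := vavg_sub continuous_psi (hG i j) (hH i j)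
  have h2 := vavg_sub continuous_mul_psi (hG (Fin.last m) j) (hH (Fin.last m) j)
  have h3 := vavg_sub continuous_mul_psi (hG i (Fin.last m)) (hH i (Fin.last m))
  have h4 := vavg_sub continuous_sq_mul_psi (hG (Fin.last m) (Fin.last m))
    (hH (Fin.last m) (Fin.last m))
  have h5 := vavg_sub continuous_psiPrim (hG (Fin.last m) (Fin.last m))
    (hH (Fin.last m) (Fin.last m))
  simp only [reflGrad, Pi.sub_apply, Matrix.sub_apply, h1, h2, h3, h4, h5]
  ring

lemma symPart_apply {n : ℕ} (A : Mat n) (i j : Fin n) :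
    symPart A i j = 1 / 2 * (A i j + A j i) := by
  simp [symPart]

lemma reflGrad_symPart (hφ : Continuous φ) (hδ : IsRegDist φ K δ) (hx : x ∈ upper φ)
    {G : Rn (m + 1) → Mat (m + 1)}
    (hG : ∀ i j, AvgIntegrable δ (fun y => G y i j) x) :
    reflGrad δ (fun y => symPart (G y)) x = symPart (reflGrad δ G x) := by
  ext i j
  have h1 := vavg_half_add continuous_psi (hG i j) (hG j i)
  have h2 := vavg_half_add continuous_mul_psi (hG (Fin.last m) j) (hG j (Fin.last m))
  have h3 := vavg_half_add continuous_mul_psi (hG i (Fin.last m)) (hG (Fin.last m) i)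
  have h4 := vavg_half_add continuous_sq_mul_psi (hG (Fin.last m) (Fin.last m))
    (hG (Fin.last m) (Fin.last m))
  have h5 := vavg_half_add continuous_psiPrim (hG (Fin.last m) (Fin.last m))
    (hG (Fin.last m) (Fin.last m))
  have h6 := hδ.hessian_symm hφ hx (basisVec i) (basisVec j)
  simp only [symPart_apply, reflGrad, h1, h2, h3, h4, h5, h6]
  ring

end Bounds

/-! ### The extension of a Sobolev map -/

section Sobolev

variable {δ : Rn (m + 1) → ℝ} {V S : Set (Rn (m + 1))} {K : ℝ}
  {u w : Rn (m + 1) → Rn (m + 1)} {G H : Rn (m + 1) → Mat (m + 1)}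

lemma measurable_extMap (hφ : Continuous φ) (hδ : Measurable δ)
    (hu : ∀ i, Measurable fun x => u x i) (i : Fin (m + 1)) :
    Measurable fun x => extMap φ δ u x i := by
  classical
  have : (fun x => extMap φ δ u x i)
      = (upper φ).piecewise (fun x => reflMap δ u x i) fun x => u x i := by
    ext x
    by_cases hx : x ∈ upper φ
    · rw [extMap_of_mem hx, Set.piecewise_eq_of_mem _ _ _ hx]
    · rw [extMap_of_notMem hx, Set.piecewise_eq_of_notMem _ _ _ hx]
  rw [this]
  exact (measurable_reflMap hδ hu i).piecewise (isOpen_upper hφ).measurableSet (hu i)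

lemma measurable_extGrad (hφ : Continuous φ) (hδ : Measurable δ)
    (hG : ∀ i j, Measurable fun x => G x i j) (i j : Fin (m + 1)) :
    Measurable fun x => extGrad φ δ G x i j := by
  classical
  have : (fun x => extGrad φ δ G x i j)
      = (upper φ).piecewise (fun x => reflGrad δ G x i j) fun x => G x i j := by
    ext x
    by_cases hx : x ∈ upper φ
    · rw [extGrad_of_mem hx, Set.piecewise_eq_of_mem _ _ _ hx]
    · rw [extGrad_of_notMem hx, Set.piecewise_eq_of_notMem _ _ _ hx]
  rw [this]
  exact (measurable_reflGrad hδ hG i j).piecewise (isOpen_upper hφ).measurableSet (hG i j)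

lemma ReflectsInto.lintegral_extMap_le (hV : ReflectsInto φ δ V S) (hφ : Continuous φ)
    (hδ : IsRegDist φ K δ) (hu : ∀ i, Measurable fun x => u x i) (i : Fin (m + 1)) :
    ∫⁻ x in V, ‖extMap φ δ u x i‖ₑ
      ≤ (2 * ENNReal.ofReal (10 + 20 * K) + 1) * ∑ k, ∫⁻ x in S, ‖u x k‖ₑ := by
  rw [← lintegral_finsetSum _ fun k _ => (hu k).enorm]
  refine hV.lintegral_extension_le hφ hδ (Z := fun x => extMap φ δ u x i)
    (N := fun x => ∑ k, ‖u x k‖ₑ)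
    (Finset.measurable_fun_sum _ fun k _ => (hu k).enorm) (by simp) ?_ fun x hx => ?_
  · refine (ae_restrict_iff' (hV.measurableSet_left.inter (isOpen_upper hφ).measurableSet)).2
      (ae_of_all _ fun x hx => ?_)
    rw [extMap_of_mem hx.2]
    exact enorm_reflMap_le hδ hx.2 u i
  · rw [extMap_of_notMem (notMem_upper hx.2)]
    exact Finset.single_le_sum (f := fun k => ‖u x k‖ₑ) (fun _ _ => zero_le) (Finset.mem_univ i)

lemma ReflectsInto.lintegral_extGrad_le (hV : ReflectsInto φ δ V S) (hφ : Continuous φ)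
    (hδ : IsRegDist φ K δ) (hG : ∀ i j, Measurable fun x => G x i j) (i j : Fin (m + 1)) :
    ∫⁻ x in V, ‖extGrad φ δ G x i j‖ₑ
      ≤ (2 * ENNReal.ofReal (reflConst K) + 1) * ∑ k, ∑ l, ∫⁻ x in S, ‖G x k l‖ₑ := by
  have h1 : ∑ k, ∑ l, ∫⁻ x in S, ‖G x k l‖ₑ = ∫⁻ x in S, ∑ k, ∑ l, ‖G x k l‖ₑ := by
    rw [lintegral_finsetSum _ fun k _ => Finset.measurable_fun_sum _ fun l _ => (hG k l).enorm]
    exact Finset.sum_congr rfl fun k _ => (lintegral_finsetSum _ fun l _ => (hG k l).enorm).symm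
  rw [h1]
  refine (hV.lintegral_extension_le hφ hδ (Z := fun x => extGrad φ δ G x i j)
    (N := fun x => ENNReal.ofReal (matNorm (G x))) (c := ENNReal.ofReal (reflConst K))
    (measurable_matNorm hG).ennreal_ofReal (by simp) ?_ fun x hx => ?_).trans
    (mul_le_mul' le_rfl (lintegral_mono fun x => ofReal_matNorm_le_sum (G x)))
  · refine (ae_restrict_iff' (hV.measurableSet_left.inter (isOpen_upper hφ).measurableSet)).2
      (ae_of_all _ fun x hx => ?_)
    rw [extGrad_of_mem hx.2]
    exact enorm_reflGrad_le hδ hx.2 G i j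
  · rw [extGrad_of_notMem (notMem_upper hx.2)]
    exact enorm_apply_le_matNorm (G x) i j

lemma ReflectsInto.ae_restrict_of_upper (hV : ReflectsInto φ δ V S) (hφ : Continuous φ)
    {P : Rn (m + 1) → Prop} (h1 : ∀ᵐ x ∂volume.restrict (V ∩ upper φ), x ∈ upper φ → P x)
    (h2 : ∀ x, x ∉ upper φ → P x) : ∀ᵐ x ∂volume.restrict V, P x := by
  rw [ae_restrict_iff' (hV.measurableSet_left.inter (isOpen_upper hφ).measurableSet)] at h1
  rw [ae_restrict_iff' hV.measurableSet_left]
  filter_upwards [h1] with x hx hxV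
  by_cases hxu : x ∈ upper φ
  · exact hx ⟨hxV, hxu⟩ hxu
  · exact h2 x hxu

lemma ReflectsInto.extMap_sub (hV : ReflectsInto φ δ V S) (hφ : Continuous φ)
    (hδ : IsRegDist φ K δ) (hu : ∀ i, Measurable fun x => u x i)
    (hui : ∀ i, IntegrableOn (fun x => u x i) S) (hw : ∀ i, Measurable fun x => w x i)
    (hwi : ∀ i, IntegrableOn (fun x => w x i) S) :
    ∀ᵐ x ∂volume.restrict V, extMap φ δ (u - w) x = extMap φ δ u x - extMap φ δ w x := by
  refine hV.ae_restrict_of_upper hφ ?_ fun x hx => ?_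
  · filter_upwards [ae_all_iff.2 fun i => hV.ae_avgIntegrable hφ hδ (hu i) (hui i),
      ae_all_iff.2 fun i => hV.ae_avgIntegrable hφ hδ (hw i) (hwi i)] with x h1 h2 hx
    rw [extMap_of_mem hx, extMap_of_mem hx, extMap_of_mem hx, reflMap_sub h1 h2]
  · rw [extMap_of_notMem hx, extMap_of_notMem hx, extMap_of_notMem hx, Pi.sub_apply]

lemma ReflectsInto.extGrad_sub (hV : ReflectsInto φ δ V S) (hφ : Continuous φ)
    (hδ : IsRegDist φ K δ) (hG : ∀ i j, Measurable fun x => G x i j)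
    (hGi : ∀ i j, IntegrableOn (fun x => G x i j) S) (hH : ∀ i j, Measurable fun x => H x i j)
    (hHi : ∀ i j, IntegrableOn (fun x => H x i j) S) :
    ∀ᵐ x ∂volume.restrict V, extGrad φ δ (G - H) x = extGrad φ δ G x - extGrad φ δ H x := by
  refine hV.ae_restrict_of_upper hφ ?_ fun x hx => ?_
  · filter_upwards [ae_all_iff.2 fun i => ae_all_iff.2 fun j =>
        hV.ae_avgIntegrable hφ hδ (hG i j) (hGi i j),
      ae_all_iff.2 fun i => ae_all_iff.2 fun j =>
        hV.ae_avgIntegrable hφ hδ (hH i j) (hHi i j)] with x h1 h2 hx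
    rw [extGrad_of_mem hx, extGrad_of_mem hx, extGrad_of_mem hx, reflGrad_sub h1 h2]
  · rw [extGrad_of_notMem hx, extGrad_of_notMem hx, extGrad_of_notMem hx, Pi.sub_apply]

lemma ReflectsInto.extGrad_symPart (hV : ReflectsInto φ δ V S) (hφ : Continuous φ)
    (hδ : IsRegDist φ K δ) (hG : ∀ i j, Measurable fun x => G x i j)
    (hGi : ∀ i j, IntegrableOn (fun x => G x i j) S) :
    ∀ᵐ x ∂volume.restrict V,
      extGrad φ δ (fun y => symPart (G y)) x = symPart (extGrad φ δ G x) := by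
  refine hV.ae_restrict_of_upper hφ ?_ fun x hx => ?_
  · filter_upwards [ae_all_iff.2 fun i => ae_all_iff.2 fun j =>
        hV.ae_avgIntegrable hφ hδ (hG i j) (hGi i j)] with x h1 hx
    rw [extGrad_of_mem hx, extGrad_of_mem hx, reflGrad_symPart hφ hδ hx h1]
  · rw [extGrad_of_notMem hx, extGrad_of_notMem hx]

lemma ReflectsInto.integrableOn_extMap (hV : ReflectsInto φ δ V S) (hφ : Continuous φ)
    (hδ : IsRegDist φ K δ) (hu : ∀ i, Measurable fun x => u x i)
    (hui : ∀ i, IntegrableOn (fun x => u x i) S) (i : Fin (m + 1)) :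
    IntegrableOn (fun x => extMap φ δ u x i) V := by
  refine ⟨(measurable_extMap hφ hδ.measurable hu i).aestronglyMeasurable, ?_⟩
  refine (hV.lintegral_extMap_le hφ hδ hu i).trans_lt (ENNReal.mul_lt_top (by finiteness) ?_)
  exact ENNReal.sum_lt_top.2 fun k _ => (hui k).2

lemma ReflectsInto.integrableOn_extGrad (hV : ReflectsInto φ δ V S) (hφ : Continuous φ)
    (hδ : IsRegDist φ K δ) (hG : ∀ i j, Measurable fun x => G x i j)
    (hGi : ∀ i j, IntegrableOn (fun x => G x i j) S) (i j : Fin (m + 1)) :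
    IntegrableOn (fun x => extGrad φ δ G x i j) V := by
  refine ⟨(measurable_extGrad hφ hδ.measurable hG i j).aestronglyMeasurable, ?_⟩
  refine (hV.lintegral_extGrad_le hφ hδ hG i j).trans_lt (ENNReal.mul_lt_top (by finiteness) ?_)
  exact ENNReal.sum_lt_top.2 fun k _ => ENNReal.sum_lt_top.2 fun l _ => (hGi k l).2

lemma integrableOn_of_lintegral_sub_le {a b : Rn (m + 1) → ℝ} (ha : Measurable a)
    (hb : IntegrableOn b S) {ε : ℝ≥0∞} (hε : ε ≠ ⊤) (h : ∫⁻ x in S, ‖a x - b x‖ₑ ≤ ε) :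
    IntegrableOn a S := by
  have h1 : IntegrableOn (fun x => a x - b x) S :=
    ⟨ha.aestronglyMeasurable.sub hb.1, h.trans_lt hε.lt_top⟩
  have h2 := h1.add hb
  refine h2.congr (ae_of_all _ fun x => ?_)
  simp

/-- The extension of a Sobolev map by reflection is a Sobolev map, whose weak gradient is the
extension of the gradient. The identity holds for smooth maps and both sides are continuous with
respect to the convergence provided by smooth approximation. -/
theorem isW11WithGrad_extMap {L : ℝ≥0} (hφ : LipschitzWith L φ) (hδ : IsRegDist φ K δ)
    {R R' : ℝ} (hR : R' < R)
    (hV : ReflectsInto φ δ V (Metric.ball 0 R' ∩ subgraph φ))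
    (hum : ∀ i, Measurable fun x => u x i) (hGm : ∀ i j, Measurable fun x => G x i j)
    (hui : ∀ i, Integrable fun x => u x i) (hGi : ∀ i j, Integrable fun x => G x i j)
    (hu0 : ∀ x, x ∉ Metric.ball 0 R ∩ subgraph φ → u x = 0)
    (hG0 : ∀ x, x ∉ Metric.ball 0 R ∩ subgraph φ → G x = 0)
    (hw : ∀ i j, IsWeakPartialDeriv (Metric.ball 0 R ∩ subgraph φ) (fun x => u x i) j
      fun x => G x i j) :
    IsW11WithGrad V (extMap φ δ u) (extGrad φ δ G) := by
  have hφc := hφ.continuous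
  have hEu := hV.integrableOn_extMap hφc hδ hum fun i => (hui i).integrableOn
  have hEG := hV.integrableOn_extGrad hφc hδ hGm fun i j => (hGi i j).integrableOn
  refine ⟨hEu, hEG, fun i j η hη hηc hηV => ?_⟩
  obtain ⟨B₀, hB₀⟩ := hη.continuous.bounded_above_of_compact_support hηc
  have hη' : Continuous fun x => fderiv ℝ η x (basisVec j) := by
    have := hη.continuous_fderiv (by simp)
    fun_prop
  obtain ⟨B₁, hB₁⟩ := hη'.bounded_above_of_compact_support (hηc.fderiv_apply ℝ (basisVec j))
  have hηz : ∀ x, x ∉ V → η x = 0 := fun x hx => image_eq_zero_of_notMem_tsupport fun h => hx (hηV h)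
  have hηz' : ∀ x, x ∉ V → fderiv ℝ η x (basisVec j) = 0 := fun x hx => by
    rw [fderiv_of_notMem_tsupport ℝ fun h => hx (hηV h)]
    rfl
  have hmul1 : ∀ {a : Rn (m + 1) → ℝ}, IntegrableOn a V →
      IntegrableOn (fun x => a x * fderiv ℝ η x (basisVec j)) V := fun ha =>
    ha.mul_bdd hη'.aestronglyMeasurable (ae_of_all _ hB₁)
  have hmul2 : ∀ {a : Rn (m + 1) → ℝ}, IntegrableOn a V →
      IntegrableOn (fun x => a x * η x) V := fun ha =>
    ha.mul_bdd hη.continuous.aestronglyMeasurable (ae_of_all _ hB₀)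
  change ∫ x in V, extMap φ δ u x i * fderiv ℝ η x (basisVec j) = _
  set c : ℝ≥0∞ := ENNReal.ofReal B₁ * ((2 * ENNReal.ofReal (10 + 20 * K) + 1) * (m + 1 : ℕ))
    + ENNReal.ofReal B₀ * ((2 * ENNReal.ofReal (reflConst K) + 1) * ((m + 1 : ℕ) * (m + 1 : ℕ)))
    with hc
  have hctop : c ≠ ⊤ := by rw [hc]; finiteness
  set A : ℝ := ∫ x in V, extMap φ δ u x i * fderiv ℝ η x (basisVec j) with hA
  set A' : ℝ := ∫ x in V, extGrad φ δ G x i j * η x with hA'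
  have key : ∀ ε : ℝ≥0, 0 < ε → ‖A + A'‖ₑ ≤ c * ε := by
    intro ε hε
    obtain ⟨w, M, hw1, hwM, hwu, hwG⟩ := exists_smooth_approx hφ hR hum hGm hui hGi hu0 hG0 hw
      (ε := ε) (by exact_mod_cast hε)
    have hwm : ∀ i, Measurable fun x => w x i := fun i => (hw1 i).continuous.measurable
    have hGwm : ∀ i j, Measurable fun x => gradMat w x i j := fun i j =>
      measurable_fderiv_apply_const ℝ (fun y => w y i) (basisVec j)
    have hwu' : ∀ i, ∫⁻ x in Metric.ball 0 R' ∩ subgraph φ, ‖w x i - u x i‖ₑ ≤ ε := fun i =>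
      (setLIntegral_le_lintegral _ _).trans (hwu i)
    have hwi : ∀ i, IntegrableOn (fun x => w x i) (Metric.ball 0 R' ∩ subgraph φ) := fun i =>
      integrableOn_of_lintegral_sub_le (hwm i) (hui i).integrableOn ENNReal.coe_ne_top (hwu' i)
    have hGwi : ∀ i j, IntegrableOn (fun x => gradMat w x i j) (Metric.ball 0 R' ∩ subgraph φ) :=
      fun i j => integrableOn_of_lintegral_sub_le (hGwm i j) (hGi i j).integrableOn
        ENNReal.coe_ne_top (hwG i j)
    have hEw := hV.integrableOn_extMap hφc hδ hwm hwi
    have hEGw := hV.integrableOn_extGrad hφc hδ hGwm hGwi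
    have hsm := integral_extMap_mul_fderiv hφ hδ hw1 hwM hη hηc i j
    have s1 : ∫ x in V, extMap φ δ w x i * fderiv ℝ η x (basisVec j)
        = ∫ x, extMap φ δ w x i * fderiv ℝ η x (basisVec j) :=
      setIntegral_eq_integral_of_forall_compl_eq_zero fun x hx => by rw [hηz' x hx, mul_zero]
    have s2 : ∫ x in V, extGrad φ δ (gradMat w) x i j * η x
        = ∫ x, extGrad φ δ (gradMat w) x i j * η x :=
      setIntegral_eq_integral_of_forall_compl_eq_zero fun x hx => by rw [hηz x hx, mul_zero]
    have hdiff : A + A' = -((∫ x in V, extMap φ δ (w - u) x i * fderiv ℝ η x (basisVec j))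
        + ∫ x in V, extGrad φ δ (gradMat w - G) x i j * η x) := by
      have e1 : ∫ x in V, extMap φ δ (w - u) x i * fderiv ℝ η x (basisVec j)
          = (∫ x in V, extMap φ δ w x i * fderiv ℝ η x (basisVec j)) - A := by
        rw [hA, ← integral_sub (hmul1 (hEw i)) (hmul1 (hEu i))]
        refine integral_congr_ae ?_
        filter_upwards [hV.extMap_sub hφc hδ hwm hwi hum fun i => (hui i).integrableOn] with x hx
        rw [hx, PiLp.sub_apply, sub_mul]
      have e2 : ∫ x in V, extGrad φ δ (gradMat w - G) x i j * η x
          = (∫ x in V, extGrad φ δ (gradMat w) x i j * η x) - A' := by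
        rw [hA', ← integral_sub (hmul2 (hEGw i j)) (hmul2 (hEG i j))]
        refine integral_congr_ae ?_
        filter_upwards [hV.extGrad_sub hφc hδ hGwm hGwi hGm fun i j => (hGi i j).integrableOn]
          with x hx
        rw [hx, Matrix.sub_apply, sub_mul]
      rw [e1, e2, s1, s2, hsm]
      ring
    have hbd : ∀ {a b : Rn (m + 1) → ℝ} {B : ℝ}, (∀ x, ‖b x‖ ≤ B) →
        ‖∫ x in V, a x * b x‖ₑ ≤ ENNReal.ofReal B * ∫⁻ x in V, ‖a x‖ₑ := fun {a b B} hb => by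
      refine (enorm_integral_le_lintegral_enorm _).trans ?_
      rw [← lintegral_const_mul' _ _ (by simp)]
      refine lintegral_mono fun x => ?_
      rw [enorm_mul, mul_comm, Real.enorm_eq_ofReal_abs (b x)]
      exact mul_le_mul' (ENNReal.ofReal_le_ofReal (hb x)) le_rfl
    rw [hdiff, enorm_neg]
    refine (enorm_add_le _ _).trans ((add_le_add (hbd hB₁) (hbd hB₀)).trans ?_)
    rw [hc, add_mul, mul_assoc, mul_assoc, mul_assoc, mul_assoc]
    refine add_le_add (mul_le_mul' le_rfl ?_) (mul_le_mul' le_rfl ?_)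
    · refine (hV.lintegral_extMap_le hφc hδ (u := w - u) (fun i => (hwm i).sub (hum i)) i).trans
        (mul_le_mul' le_rfl ((Finset.sum_le_sum fun k _ => hwu' k).trans ?_))
      simp
    · refine (hV.lintegral_extGrad_le hφc hδ (G := gradMat w - G)
        (fun i j => (hGwm i j).sub (hGm i j)) i j).trans
        (mul_le_mul' le_rfl ((Finset.sum_le_sum fun k _ => Finset.sum_le_sum fun l _ =>
          hwG k l).trans ?_))
      simp [mul_assoc]
  have hzero : ‖A + A'‖ₑ = 0 := by
    refine le_antisymm (ENNReal.le_of_forall_pos_le_add fun ε hε _ => ?_) zero_le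
    have h1 := key (ε / (c.toNNReal + 1)) (by positivity)
    refine h1.trans ?_
    rw [zero_add, ← ENNReal.coe_toNNReal hctop, ← ENNReal.coe_mul, ENNReal.coe_le_coe,
      ENNReal.toNNReal_coe, mul_div_assoc', div_le_iff₀ (by positivity), mul_comm ε]
    gcongr
    exact le_add_of_nonneg_right zero_le_one
  rw [enorm_eq_zero] at hzero
  linarith

end Sobolev

/-! ### Extension of log-Hölder continuous exponents -/

/-- The log-Hölder modulus of continuity `1 / log (e + 1 / s)`, with value `0` at `s = 0`. -/
def logMod (s : ℝ) : ℝ := if s ≤ 0 then 0 else (Real.log (Real.exp 1 + 1 / s))⁻¹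

lemma logMod_of_pos {s : ℝ} (hs : 0 < s) : logMod s = (Real.log (Real.exp 1 + 1 / s))⁻¹ :=
  if_neg hs.not_ge

@[simp] lemma logMod_zero : logMod 0 = 0 := if_pos le_rfl

lemma one_le_log_exp_add {t : ℝ} (ht : 0 ≤ t) : 1 ≤ Real.log (Real.exp 1 + t) := by
  rw [Real.le_log_iff_exp_le (by positivity)]
  linarith

lemma logMod_nonneg (s : ℝ) : 0 ≤ logMod s := by
  unfold logMod
  split_ifs with h
  · exact le_rfl
  · exact inv_nonneg.2 (zero_le_one.trans (one_le_log_exp_add (by rw [not_le] at h; positivity)))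

lemma logMod_mono {s t : ℝ} (h : s ≤ t) : logMod s ≤ logMod t := by
  rcases le_or_gt s 0 with hs | hs
  · rw [logMod, if_pos hs]
    exact logMod_nonneg t
  · have ht := hs.trans_le h
    rw [logMod_of_pos hs, logMod_of_pos ht]
    have h1 := one_le_log_exp_add (t := 1 / t) (by positivity)
    gcongr

/-- `logMod s / s` is nonincreasing, by concavity of the logarithm. -/
lemma mul_logMod_le {s t : ℝ} (hs : 0 < s) (h : s ≤ t) : s * logMod t ≤ t * logMod s := by
  have ht := hs.trans_le h
  have hlt := one_le_log_exp_add (t := 1 / t) (by positivity)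
  have hls := one_le_log_exp_add (t := 1 / s) (by positivity)
  rw [logMod_of_pos hs, logMod_of_pos ht, ← div_eq_mul_inv, ← div_eq_mul_inv,
    div_le_div_iff₀ (by linarith) (by linarith)]
  have h0 : 0 ≤ 1 - s / t := by rw [sub_nonneg, div_le_one ht]; exact h
  have hconc := strictConcaveOn_log_Ioi.concaveOn.2
    (Set.mem_Ioi.2 (by positivity : 0 < Real.exp 1 + 1 / s)) (Set.mem_Ioi.2 (Real.exp_pos 1))
    (by positivity : 0 ≤ s / t) h0 (by ring)
  have e : s / t * (Real.exp 1 + 1 / s) + (1 - s / t) * Real.exp 1 = Real.exp 1 + 1 / t := by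
    field_simp
    ring
  simp only [smul_eq_mul] at hconc
  rw [e, Real.log_exp, mul_one] at hconc
  have h2 : s / t * Real.log (Real.exp 1 + 1 / s) ≤ Real.log (Real.exp 1 + 1 / t) := by linarith
  rw [div_mul_eq_mul_div, div_le_iff₀ ht] at h2
  linarith

lemma logMod_add_le {s t : ℝ} (hs : 0 ≤ s) (ht : 0 ≤ t) :
    logMod (s + t) ≤ logMod s + logMod t := by
  rcases hs.eq_or_lt with rfl | hs
  · simp
  rcases ht.eq_or_lt with rfl | ht
  · simp
  have h1 := mul_logMod_le hs (le_add_of_nonneg_right ht.le : s ≤ s + t)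
  have h2 := mul_logMod_le ht (le_add_of_nonneg_left hs.le : t ≤ s + t)
  have h3 : (s + t) * logMod (s + t) ≤ (s + t) * (logMod s + logMod t) := by linarith
  exact le_of_mul_le_mul_left h3 (by positivity)

lemma logMod_mul_le {κ s : ℝ} (hκ : 1 ≤ κ) (hs : 0 ≤ s) : logMod (κ * s) ≤ κ * logMod s := by
  rcases hs.eq_or_lt with rfl | hs
  · simp
  have h1 := mul_logMod_le hs (le_mul_of_one_le_left hs.le hκ)
  have h2 : s * logMod (κ * s) ≤ s * (κ * logMod s) := by linarith
  exact le_of_mul_le_mul_left h2 hs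

lemma exists_logMod_lt {ε : ℝ} (hε : 0 < ε) : ∃ d : ℝ, 0 < d ∧ ∀ s, s < d → logMod s < ε := by
  refine ⟨Real.exp (-ε⁻¹), Real.exp_pos _, fun s hs => ?_⟩
  rcases le_or_gt s 0 with h | h
  · rwa [logMod, if_pos h]
  rw [logMod_of_pos h]
  refine inv_lt_of_inv_lt₀ hε ?_
  rw [Real.lt_log_iff_exp_lt (by positivity)]
  have h1 : Real.exp ε⁻¹ < 1 / s := by
    rw [Real.exp_neg] at hs
    rw [one_div]
    exact (lt_inv_comm₀ (Real.exp_pos _) h).2 hs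
  linarith [Real.exp_pos 1]

section Exponent

variable {n : ℕ} {S : Set (Rn n)} {p q : Rn n → ℝ} {a b c A κ : ℝ}

lemma continuousOn_of_logMod (hp : ∀ x ∈ S, ∀ y ∈ S, |p x - p y| ≤ c * logMod ‖x - y‖) :
    ContinuousOn p S := by
  rw [Metric.continuousOn_iff]
  intro x hx ε hε
  obtain ⟨d, hd, hd'⟩ := exists_logMod_lt (ε := ε / (|c| + 1)) (by positivity)
  refine ⟨d, hd, fun y hy hyx => ?_⟩
  rw [dist_eq_norm] at hyx
  have h1 := hd' _ hyx
  rw [lt_div_iff₀ (by positivity)] at h1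
  have h2 : c * logMod ‖y - x‖ ≤ |c| * logMod ‖y - x‖ :=
    mul_le_mul_of_nonneg_right (le_abs_self c) (logMod_nonneg _)
  rw [Real.dist_eq]
  linarith [hp y hy x hx, logMod_nonneg ‖y - x‖]

lemma LocallyLogHolder.exists_logMod (hp : LocallyLogHolder S p) :
    ∃ c, 0 ≤ c ∧ ∀ x ∈ S, ∀ y ∈ S, |p x - p y| ≤ c * logMod ‖x - y‖ := by
  obtain ⟨c, hc, h⟩ := hp
  refine ⟨c, hc, fun x hx y hy => ?_⟩
  rcases eq_or_ne x y with rfl | hxy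
  · simp
  · rw [logMod_of_pos (norm_pos_iff.2 (sub_ne_zero.2 hxy)), ← div_eq_mul_inv]
    exact h x hx y hy hxy

/-- McShane-type extension of `p` from `S`, with modulus of continuity `A · logMod`, truncated
from below at `a`. -/
def extExp (S : Set (Rn n)) (a A : ℝ) (p : Rn n → ℝ) (x : Rn n) : ℝ :=
  max a (sSup ((fun y => p y - A * logMod ‖x - y‖) '' S))

lemma extExp_le (hne : S.Nonempty) {x : Rn n} {b : ℝ} (hab : a ≤ b)
    (h : ∀ y ∈ S, p y - A * logMod ‖x - y‖ ≤ b) : extExp S a A p x ≤ b :=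
  max_le hab (csSup_le (hne.image _) (Set.forall_mem_image.2 h))

lemma bddAbove_extExp (hA : 0 ≤ A) (hb : ∀ x ∈ S, p x ≤ b) (x : Rn n) :
    BddAbove ((fun y => p y - A * logMod ‖x - y‖) '' S) :=
  ⟨b, Set.forall_mem_image.2 fun y hy => by
    have := hb y hy
    have := mul_nonneg hA (logMod_nonneg ‖x - y‖)
    linarith⟩

lemma le_extExp (hA : 0 ≤ A) (hb : ∀ x ∈ S, p x ≤ b) (x : Rn n) {y : Rn n} (hy : y ∈ S) :
    p y - A * logMod ‖x - y‖ ≤ extExp S a A p x :=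
  (le_csSup (bddAbove_extExp hA hb x) (Set.mem_image_of_mem _ hy)).trans (le_max_right _ _)

lemma extExp_eq (hne : S.Nonempty) (hA : 0 ≤ A) (ha : ∀ x ∈ S, a ≤ p x) (hb : ∀ x ∈ S, p x ≤ b)
    (hp : ∀ x ∈ S, ∀ y ∈ S, |p x - p y| ≤ A * logMod ‖x - y‖) {x : Rn n} (hx : x ∈ S) :
    extExp S a A p x = p x := by
  refine le_antisymm (extExp_le hne (ha x hx) fun y hy => ?_) ?_
  · have := (abs_le.1 (hp x hx y hy)).1
    linarith
  · simpa using le_extExp (a := a) hA hb x hx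

lemma abs_extExp_sub_le (hne : S.Nonempty) (hA : 0 ≤ A) (hb : ∀ x ∈ S, p x ≤ b) (x y : Rn n) :
    |extExp S a A p x - extExp S a A p y| ≤ A * logMod ‖x - y‖ := by
  have key : ∀ x y, extExp S a A p x ≤ extExp S a A p y + A * logMod ‖x - y‖ := fun x y => by
    have h0 := mul_nonneg hA (logMod_nonneg ‖x - y‖)
    refine extExp_le hne ?_ fun z hz => ?_
    · have : a ≤ extExp S a A p y := le_max_left _ _
      linarith
    · have h1 := le_extExp (a := a) hA hb y hz
      have h2 : logMod ‖y - z‖ ≤ logMod ‖x - z‖ + logMod ‖x - y‖ := by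
        refine (logMod_mono ?_).trans (logMod_add_le (norm_nonneg _) (norm_nonneg _))
        have := norm_sub_le (x - z) (x - y)
        rwa [sub_sub_sub_cancel_left] at this
      nlinarith
  rw [abs_le]
  have h1 := key x y
  have h2 := key y x
  rw [norm_sub_rev] at h2
  constructor <;> linarith

/-- If `z ∈ S` is, up to a factor, a closest point to `x`, the extended exponent at `x` does not
exceed the exponent at `z`. -/
lemma extExp_le_of_near (hne : S.Nonempty) (ha : ∀ x ∈ S, a ≤ p x) (hc : 0 ≤ c) (hκ : 1 ≤ κ)
    (hp : ∀ x ∈ S, ∀ y ∈ S, |p x - p y| ≤ c * logMod ‖x - y‖) {x z : Rn n} (hz : z ∈ S)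
    (hxz : ∀ y ∈ S, ‖x - z‖ ≤ (κ - 1) * ‖x - y‖) : extExp S a (c * κ) p x ≤ p z := by
  refine extExp_le hne (ha z hz) fun y hy => ?_
  have h1 := (abs_le.1 (hp y hy z hz)).2
  have h2 : ‖y - z‖ ≤ κ * ‖x - y‖ := by
    have h3 := norm_sub_le (x - z) (x - y)
    rw [sub_sub_sub_cancel_left] at h3
    have := hxz y hy
    linarith
  have h3 := (logMod_mono h2).trans (logMod_mul_le hκ (norm_nonneg _))
  have h4 := mul_le_mul_of_nonneg_left h3 hc
  linarith

/-- An almost everywhere inequality between continuous functions on an open set holds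
everywhere. -/
lemma forall_le_of_ae_le {β : Type*} [TopologicalSpace β] [LinearOrder β] [OrderClosedTopology β]
    (hS : IsOpen S) {f g : Rn n → β} (hf : ContinuousOn f S) (hg : ContinuousOn g S)
    (h : ∀ᵐ x ∂volume.restrict S, f x ≤ g x) : ∀ x ∈ S, f x ≤ g x := by
  have ho : IsOpen (S ∩ (fun x => (g x, f x)) ⁻¹' {z | z.1 < z.2}) :=
    (hg.prodMk hf).isOpen_inter_preimage hS (isOpen_lt continuous_fst continuous_snd)
  have h0 : volume (S ∩ (fun x => (g x, f x)) ⁻¹' {z | z.1 < z.2}) = 0 := by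
    rw [ae_restrict_iff' hS.measurableSet] at h
    refine measure_mono_null (fun x hx => ?_) (ae_iff.1 h)
    exact fun h' => (h' hx.1).not_gt hx.2
  have h1 := ho.eq_empty_of_measure_zero h0
  intro x hx
  by_contra hlt
  have : x ∈ S ∩ (fun x => (g x, f x)) ⁻¹' {z | z.1 < z.2} := ⟨hx, not_le.1 hlt⟩
  rw [h1] at this
  exact this

/-- The exponent bounds `p⁻` and `p⁺` are finite and, by continuity, hold everywhere. -/
lemma IsLogExponent.exists_bounds (hS : IsOpen S) (hne : S.Nonempty) (hp : IsLogExponent S p) :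
    ∃ a b : ℝ, (a : EReal) = expInf S p ∧ (b : EReal) = expSup S p ∧ 1 ≤ a ∧
      (∀ x ∈ S, a ≤ p x) ∧ ∀ x ∈ S, p x ≤ b := by
  obtain ⟨c, -, hc⟩ := hp.locallyLogHolder.exists_logMod
  have hcont : ContinuousOn (fun x => (p x : EReal)) S :=
    continuous_coe_real_ereal.comp_continuousOn (continuousOn_of_logMod hc)
  have hinf : ∀ x ∈ S, expInf S p ≤ p x :=
    forall_le_of_ae_le hS continuousOn_const hcont ae_essInf_le
  have hsup : ∀ x ∈ S, (p x : EReal) ≤ expSup S p :=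
    forall_le_of_ae_le hS hcont continuousOn_const ae_le_essSup
  have h1 : (1 : EReal) ≤ expInf S p := by
    refine le_essInf_of_ae_le _ ((ae_restrict_iff' hS.measurableSet).2 (ae_of_all _ fun x hx => ?_))
    exact EReal.coe_le_coe_iff.2 (hp.isExponent.one_le x hx)
  obtain ⟨x₀, hx₀⟩ := hne
  have ha : ((expInf S p).toReal : EReal) = expInf S p := by
    refine EReal.coe_toReal ((hinf x₀ hx₀).trans_lt (EReal.coe_lt_top _)).ne ?_
    exact ((EReal.bot_lt_coe 1).trans_le h1).ne'
  have hb : ((expSup S p).toReal : EReal) = expSup S p :=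
    EReal.coe_toReal hp.isExponent.sup_lt_top.ne
      ((EReal.bot_lt_coe _).trans_le (hsup x₀ hx₀)).ne'
  refine ⟨_, _, ha, hb, ?_, fun x hx => ?_, fun x hx => ?_⟩
  · rw [← EReal.coe_le_coe_iff, ha]
    exact h1
  · rw [← EReal.coe_le_coe_iff, ha]
    exact hinf x hx
  · rw [← EReal.coe_le_coe_iff, hb]
    exact hsup x hx

lemma isLogExponent_ball {r : ℝ} {p' : Rn n → ℝ} (hA : 0 ≤ A)
    (hp : ∀ x y, |p' x - p' y| ≤ A * logMod ‖x - y‖) (h1 : ∀ x, 1 ≤ p' x) (hb : ∀ x, p' x ≤ b) :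
    IsLogExponent (Metric.ball 0 r) p' := by
  have hc : Continuous p' :=
    continuousOn_univ.1 (continuousOn_of_logMod (S := Set.univ) fun x _ y _ => hp x y)
  refine ⟨⟨hc.aemeasurable, fun x _ => h1 x, ?_⟩, ⟨A, hA, fun x _ y _ hxy => ?_⟩, ?_⟩
  · refine (essSup_le_of_ae_le (b : EReal) (ae_of_all _ fun x => ?_)).trans_lt (EReal.coe_lt_top b)
    exact EReal.coe_le_coe_iff.2 (hb x)
  · have := hp x y
    rwa [logMod_of_pos (norm_pos_iff.2 (sub_ne_zero.2 hxy)), ← div_eq_mul_inv] at this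
  · have hb1 : 1 ≤ b := (h1 0).trans (hb 0)
    refine ⟨1, b * Real.log (Real.exp 1 + |r|), ?_, fun x hx => ?_⟩
    · have := one_le_log_exp_add (abs_nonneg r)
      positivity
    · have hxr : ‖x‖ ≤ |r| := (mem_ball_zero_iff.1 hx).le.trans (le_abs_self r)
      have h2 := one_le_log_exp_add (norm_nonneg x)
      have h3 : Real.log (Real.exp 1 + ‖x‖) ≤ Real.log (Real.exp 1 + |r|) := by gcongr
      rw [le_div_iff₀ (by linarith), abs_of_nonneg (by linarith [h1 x])]
      have := h1 x
      have := hb x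
      gcongr
      linarith

/-- Two ordered log-Hölder exponents extend from `S` to ordered log-Hölder exponents that satisfy
the same bounds, and that near `S` do not exceed the original exponents at comparably close points
of `S`. The last property replaces any reflection formula for the exponents. -/
theorem exists_extension_exponents (hS : IsOpen S) (hne : S.Nonempty) (hp : IsLogExponent S p)
    (hq : IsLogExponent S q) (hpq : ∀ᵐ x ∂volume.restrict S, p x ≤ q x) (hκ : 1 ≤ κ) (r : ℝ) :
    ∃ p' q' : Rn n → ℝ, IsLogExponent (Metric.ball 0 r) p' ∧ IsLogExponent (Metric.ball 0 r) q' ∧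
      (Continuous p' ∧ Continuous q') ∧
      (∀ x, 1 ≤ p' x ∧ 1 ≤ q' x) ∧
      (∀ x ∈ S, p' x = p x ∧ q' x = q x) ∧
      (∀ x, expInf S p ≤ p' x ∧ p' x ≤ expSup S p) ∧
      (∀ x, expInf S q ≤ q' x ∧ q' x ≤ expSup S q) ∧ (∀ x, p' x ≤ q' x) ∧
      ∀ x, ∀ z ∈ S, (∀ y ∈ S, ‖x - z‖ ≤ (κ - 1) * ‖x - y‖) → p' x ≤ p z ∧ q' x ≤ q z := by
  obtain ⟨a₁, b₁, ha₁, hb₁, h1₁, hap, hbp⟩ := hp.exists_bounds hS hne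
  obtain ⟨a₂, b₂, ha₂, hb₂, h1₂, haq, hbq⟩ := hq.exists_bounds hS hne
  obtain ⟨c₁, hc₁, hcp⟩ := hp.locallyLogHolder.exists_logMod
  obtain ⟨c₂, hc₂, hcq⟩ := hq.locallyLogHolder.exists_logMod
  have hple := forall_le_of_ae_le hS (continuousOn_of_logMod hcp) (continuousOn_of_logMod hcq) hpq
  have ha : a₁ ≤ a₂ := by
    rw [← EReal.coe_le_coe_iff, ha₁, ha₂]
    exact essInf_mono_ae (hpq.mono fun x hx => EReal.coe_le_coe_iff.2 hx)
  -- The same modulus for both exponents makes the extension monotone.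
  set c := max c₁ c₂ with hc
  have hc0 : 0 ≤ c := hc₁.trans (le_max_left _ _)
  have hmod : ∀ {p : Rn n → ℝ} {c' : ℝ}, c' ≤ c →
      (∀ x ∈ S, ∀ y ∈ S, |p x - p y| ≤ c' * logMod ‖x - y‖) →
      ∀ x ∈ S, ∀ y ∈ S, |p x - p y| ≤ c * logMod ‖x - y‖ := fun hc' h x hx y hy =>
    (h x hx y hy).trans (mul_le_mul_of_nonneg_right hc' (logMod_nonneg _))
  replace hcp := hmod (le_max_left _ _) hcp
  replace hcq := hmod (le_max_right _ _) hcq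
  have hA : 0 ≤ c * κ := by positivity
  have hcA : c ≤ c * κ := le_mul_of_one_le_right hc0 hκ
  have hmodA : ∀ {p : Rn n → ℝ}, (∀ x ∈ S, ∀ y ∈ S, |p x - p y| ≤ c * logMod ‖x - y‖) →
      ∀ x ∈ S, ∀ y ∈ S, |p x - p y| ≤ c * κ * logMod ‖x - y‖ := fun h x hx y hy =>
    (h x hx y hy).trans (mul_le_mul_of_nonneg_right hcA (logMod_nonneg _))
  have hle : ∀ {p : Rn n → ℝ} {a b : ℝ}, (∀ x ∈ S, a ≤ p x) → (∀ x ∈ S, p x ≤ b) → ∀ x,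
      extExp S a (c * κ) p x ≤ b := fun ha' hb' x => by
    obtain ⟨x₀, hx₀⟩ := hne
    refine extExp_le ⟨x₀, hx₀⟩ ((ha' x₀ hx₀).trans (hb' x₀ hx₀)) fun y hy => ?_
    have := mul_nonneg hA (logMod_nonneg ‖x - y‖)
    linarith [hb' y hy]
  have hcont : ∀ {p : Rn n → ℝ} {a b : ℝ}, (∀ x ∈ S, p x ≤ b) →
      Continuous (extExp S a (c * κ) p) := fun hb' =>
    continuousOn_univ.1 (continuousOn_of_logMod (S := Set.univ) fun x _ y _ =>
      abs_extExp_sub_le hne hA hb' x y)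
  have hlow : ∀ {p : Rn n → ℝ} {a : ℝ} (x : Rn n), a ≤ extExp S a (c * κ) p x :=
    fun x => le_max_left _ _
  refine ⟨extExp S a₁ (c * κ) p, extExp S a₂ (c * κ) q,
    isLogExponent_ball hA (abs_extExp_sub_le hne hA hbp) (fun x => h1₁.trans (hlow x)) (hle hap hbp),
    isLogExponent_ball hA (abs_extExp_sub_le hne hA hbq) (fun x => h1₂.trans (hlow x)) (hle haq hbq),
    ⟨hcont hbp, hcont hbq⟩, fun x => ⟨h1₁.trans (hlow x), h1₂.trans (hlow x)⟩,
    fun x hx => ⟨extExp_eq hne hA hap hbp (hmodA hcp) hx, extExp_eq hne hA haq hbq (hmodA hcq) hx⟩,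
    fun x => ⟨?_, ?_⟩, fun x => ⟨?_, ?_⟩, fun x => ?_, fun x z hz hxz =>
    ⟨extExp_le_of_near hne hap hc0 hκ hcp hz hxz, extExp_le_of_near hne haq hc0 hκ hcq hz hxz⟩⟩
  · rw [← ha₁, EReal.coe_le_coe_iff]
    exact hlow x
  · rw [← hb₁, EReal.coe_le_coe_iff]
    exact hle hap hbp x
  · rw [← ha₂, EReal.coe_le_coe_iff]
    exact hlow x
  · rw [← hb₂, EReal.coe_le_coe_iff]
    exact hle haq hbq x
  · refine extExp_le hne (ha.trans (hlow x)) fun y hy => ?_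
    exact (sub_le_sub_right (hple y hy) _).trans (le_extExp hA hbq x hy)

end Exponent

/-! ### Modular estimates for the extension -/

/-- Jensen's inequality for powers, for functions with values in `[0, ∞]`. -/
lemma lintegral_rpow_le_of_isProbabilityMeasure {α : Type*} [MeasurableSpace α] {μ : Measure α}
    [IsProbabilityMeasure μ] {F : α → ℝ≥0∞} (hF : Measurable F) {q : ℝ} (hq : 1 ≤ q) :
    (∫⁻ x, F x ∂μ) ^ q ≤ ∫⁻ x, F x ^ q ∂μ := by
  have h := eLpNorm'_le_eLpNorm'_of_exponent_le (f := F) zero_lt_one hq μ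
    hF.aestronglyMeasurable
  simp only [eLpNorm', enorm_eq_self, ENNReal.rpow_one, div_one] at h
  have h2 := ENNReal.rpow_le_rpow h (zero_le_one.trans hq)
  rwa [one_div, ENNReal.rpow_inv_rpow (by linarith)] at h2

lemma rpow_le_one_add_rpow (z : ℝ≥0∞) {a b : ℝ} (ha : 0 ≤ a) (hab : a ≤ b) :
    z ^ a ≤ 1 + z ^ b := by
  rcases le_total z 1 with h | h
  · exact (ENNReal.rpow_le_one h ha).trans le_self_add
  · exact (ENNReal.rpow_le_rpow_of_exponent_le h hab).trans le_add_self

section Modular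

variable {n : ℕ} {S V : Set (Rn n)} {p p' : Rn n → ℝ} {f f' : Rn n → Mat n} {t C b : ℝ}

lemma modular_congr (h : ∀ᵐ x ∂volume.restrict S, f x = f' x) : modular S p f t = modular S p f' t :=
  lintegral_congr_ae (h.mono fun x hx => by simp only [hx])

lemma modular_congr_exponent (hS : MeasurableSet S) (h : ∀ x ∈ S, p x = p' x) :
    modular S p f t = modular S p' f t :=
  setLIntegral_congr_fun hS fun x hx => by simp only [h x hx]

/-- The modular of `f / t` is at most `1` for large `t`. -/
lemma MemLpVar.exists_modular_le_one (hS : MeasurableSet S) (hp : ∀ x ∈ S, 1 ≤ p x)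
    (hf : MemLpVar S p f) : ∃ t, 0 < t ∧ modular S p f t ≤ 1 := by
  set M := (modular S p f 1).toReal
  have hM : 0 ≤ M := ENNReal.toReal_nonneg
  refine ⟨1 + M, by positivity, ?_⟩
  calc modular S p f (1 + M)
      ≤ ∫⁻ x in S, ENNReal.ofReal (1 + M)⁻¹ * ENNReal.ofReal ((matNorm (f x) / 1) ^ p x) := by
        refine setLIntegral_mono' hS fun x hx => ?_
        have h0 := matNorm_nonneg (f x)
        rw [← ENNReal.ofReal_mul (by positivity), div_one, div_eq_mul_inv,
          Real.mul_rpow h0 (by positivity), mul_comm]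
        refine ENNReal.ofReal_le_ofReal (mul_le_mul_of_nonneg_right ?_ (by positivity))
        refine Real.rpow_le_self_of_le_one (by positivity) ?_ (hp x hx)
        exact inv_le_one_of_one_le₀ (by linarith)
    _ = ENNReal.ofReal (1 + M)⁻¹ * modular S p f 1 := lintegral_const_mul' _ _ (by simp)
    _ ≤ 1 := by
        rw [← ENNReal.ofReal_toReal hf.modular_lt_top.ne, ← ENNReal.ofReal_mul (by positivity),
          ENNReal.ofReal_le_one, inv_mul_le_one₀ (by positivity)]
        change M ≤ _
        linarith

/-- A bound of the modulars implies the corresponding bound of the Luxemburg norms. -/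
lemma normLpVar_le_mul (hC : 0 < C) (hne : ∃ t, 0 < t ∧ modular S p f t ≤ 1)
    (h : ∀ t, 0 < t → modular S p f t ≤ 1 → modular V p' f' (C * t) ≤ 1) :
    normLpVar V p' f' ≤ C * normLpVar S p f := by
  rw [← div_le_iff₀' hC]
  refine le_csInf hne fun t ht => ?_
  rw [div_le_iff₀' hC]
  exact csInf_le ⟨0, fun s hs => hs.1.le⟩ ⟨mul_pos hC ht.1, h t ht.1 ht.2⟩

lemma modular_one_lt_top (hV : MeasurableSet V) (hp0 : ∀ x ∈ V, 0 ≤ p x) (hp : ∀ x ∈ V, p x ≤ b)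
    (ht : 0 < t) (h : modular V p f t ≤ 1) : modular V p f 1 < ⊤ := by
  calc modular V p f 1
      ≤ ∫⁻ x in V, ENNReal.ofReal ((1 + t) ^ b) * ENNReal.ofReal ((matNorm (f x) / t) ^ p x) := by
        refine setLIntegral_mono' hV fun x hx => ?_
        have h0 := matNorm_nonneg (f x)
        rw [← ENNReal.ofReal_mul (by positivity), div_one]
        refine ENNReal.ofReal_le_ofReal ?_
        calc matNorm (f x) ^ p x = t ^ p x * (matNorm (f x) / t) ^ p x := by
              rw [← Real.mul_rpow ht.le (by positivity), mul_div_cancel₀ _ ht.ne']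
          _ ≤ (1 + t) ^ b * (matNorm (f x) / t) ^ p x := by
              refine mul_le_mul_of_nonneg_right ?_ (by positivity)
              exact (Real.rpow_le_rpow ht.le (by linarith) (hp0 x hx)).trans
                (Real.rpow_le_rpow_of_exponent_le (by linarith) (hp x hx))
    _ = ENNReal.ofReal ((1 + t) ^ b) * modular V p f t := lintegral_const_mul' _ _ (by simp)
    _ < ⊤ := ENNReal.mul_lt_top (by simp) (h.trans_lt (by simp))

/-- On sets of finite measure, `L^{p(·)}` is contained in `L¹`. -/
lemma MemLpVar.integrableOn (hS : MeasurableSet S) (hSf : volume S ≠ ⊤) (hp : ∀ x ∈ S, 1 ≤ p x)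
    (hf : MemLpVar S p f) (i j : Fin n) : IntegrableOn (fun x => f x i j) S := by
  refine ⟨(hf.measurable i j).aestronglyMeasurable, ?_⟩
  calc ∫⁻ x in S, ‖f x i j‖ₑ ≤ ∫⁻ x in S, (1 + ENNReal.ofReal ((matNorm (f x) / 1) ^ p x)) := by
        refine setLIntegral_mono' hS fun x hx => ?_
        have h1 := rpow_le_one_add_rpow (ENNReal.ofReal (matNorm (f x))) zero_le_one
          (hp x hx)
        rw [ENNReal.rpow_one, ENNReal.ofReal_rpow_of_nonneg (matNorm_nonneg _)
          (zero_le_one.trans (hp x hx))] at h1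
        rw [div_one]
        exact (enorm_apply_le_matNorm (f x) i j).trans h1
    _ = volume S + modular S p f 1 := by
        rw [lintegral_add_left measurable_const, setLIntegral_const, one_mul]
        rfl
    _ < ⊤ := ENNReal.add_lt_top.2 ⟨hSf.lt_top, hf.modular_lt_top⟩

end Modular

section ModularExtension

variable {δ : Rn (m + 1) → ℝ} {V S : Set (Rn (m + 1))} {K M t : ℝ} {p : Rn (m + 1) → ℝ}
  {f : Rn (m + 1) → Mat (m + 1)}

/-- The constant in the pointwise bound of the extension by averages over the reflected points. -/
def extConst (m : ℕ) (K : ℝ) : ℝ := (m + 1) ^ 2 * reflConst K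

lemma one_le_extConst (m : ℕ) (hK : 0 ≤ K) : 1 ≤ extConst m K := by
  have h1 : 1 ≤ ((m : ℝ) + 1) ^ 2 := one_le_pow₀ (by linarith [m.cast_nonneg (α := ℝ)])
  have h2 : 1 ≤ reflConst K := by
    unfold reflConst
    nlinarith
  exact one_le_mul_of_one_le_of_one_le h1 h2

/-- The modular of the extension, in terms of the modular of the original field. The exponent at
`x` does not exceed the exponent at the reflected points, so that Jensen's inequality with the
exponent `p x` and `zᵃ ≤ 1 + zᵇ` for `a ≤ b` apply. -/
theorem ReflectsInto.modular_extGrad_le (hV : ReflectsInto φ δ V S) (hφ : Continuous φ)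
    (hδ : IsRegDist φ K δ) (hf : ∀ i j, Measurable fun x => f x i j) (hp : Measurable p)
    (hp1 : ∀ x, 1 ≤ p x)
    (hple : ∀ x ∈ V ∩ upper φ, ∀ s ∈ Set.Ioc (1 : ℝ) 2, p x ≤ p (x - (s * δ x) • vert))
    (hM : 1 ≤ M) (ht : 0 < t) :
    modular V p (extGrad φ δ f) (extConst m K * M * t)
      ≤ 3 * (ENNReal.ofReal M⁻¹ * (volume S + modular S p f t)) := by
  have hC := one_le_extConst m hδ.nonneg
  set C := extConst m K with hCdef
  have hM0 : 0 < M := by linarith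
  have hC0 : 0 < C := by linarith
  have hfm := measurable_matNorm hf
  -- `‖Z x‖ₑ` is the integrand of the left-hand side, `N` that of the right-hand side.
  set Z : Rn (m + 1) → ℝ := fun x => (matNorm (extGrad φ δ f x) / (C * M * t)) ^ p x with hZ
  set F : Rn (m + 1) → ℝ≥0∞ := fun x => ENNReal.ofReal (matNorm (f x) / t) with hF
  set N : Rn (m + 1) → ℝ≥0∞ := fun x => ENNReal.ofReal M⁻¹ * (1 + F x ^ p x) with hN
  have hFm : Measurable F := by fun_prop
  have hNm : Measurable N := (measurable_const.add (hFm.pow hp)).const_mul _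
  have hZe : ∀ x, ‖Z x‖ₑ
      = ENNReal.ofReal (matNorm (extGrad φ δ f x) / (C * M * t)) ^ p x := fun x => by
    have h0 := matNorm_nonneg (extGrad φ δ f x)
    rw [Real.enorm_of_nonneg (by positivity),
      ENNReal.ofReal_rpow_of_nonneg (by positivity) (by linarith [hp1 x])]
  have hpow : ∀ (e : ℝ), 1 ≤ e → ENNReal.ofReal M⁻¹ ^ e ≤ ENNReal.ofReal M⁻¹ := fun e he =>
    ENNReal.rpow_le_self_of_le_one
      (ENNReal.ofReal_le_one.2 (inv_le_one_of_one_le₀ hM)) he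
  have h1 : ∀ x ∈ V ∩ upper φ,
      ‖Z x‖ₑ ≤ 1 * ∫⁻ s in Set.Ioc (1 : ℝ) 2, N (x - (s * δ x) • vert) := fun x hx => by
    have hm : Measurable fun s : ℝ => F (x - (s * δ x) • vert) := by fun_prop
    have : IsProbabilityMeasure (volume.restrict (Set.Ioc (1 : ℝ) 2)) := ⟨by
      rw [Measure.restrict_apply_univ, Real.volume_Ioc]
      norm_num⟩
    have h2 : ENNReal.ofReal (matNorm (extGrad φ δ f x) / (C * M * t))
        ≤ ENNReal.ofReal M⁻¹ * ∫⁻ s in Set.Ioc (1 : ℝ) 2, F (x - (s * δ x) • vert) := by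
      rw [extGrad_of_mem hx.2]
      have h3 := ofReal_matNorm_reflGrad_le hδ hx.2 f
      have e1 : ∀ a : ℝ, a / (C * M * t) = (C * M * t)⁻¹ * a := fun a => by ring
      have e2 : ∀ a : ℝ, a / t = t⁻¹ * a := fun a => by ring
      have e3 : (C * M * t)⁻¹ * C = M⁻¹ * t⁻¹ := by field_simp
      simp only [hF, e1, e2]
      simp only [ENNReal.ofReal_mul (inv_nonneg.2 ht.le)]
      rw [lintegral_const_mul' _ _ (by simp), ← mul_assoc, ← ENNReal.ofReal_mul (by positivity),
        ← e3, ENNReal.ofReal_mul (by positivity), ENNReal.ofReal_mul (by positivity),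
        mul_assoc (ENNReal.ofReal _)]
      exact mul_le_mul' le_rfl h3
    rw [hZe, one_mul]
    calc _ ≤ (ENNReal.ofReal M⁻¹ * ∫⁻ s in Set.Ioc (1 : ℝ) 2, F (x - (s * δ x) • vert)) ^ p x :=
          ENNReal.rpow_le_rpow h2 (by linarith [hp1 x])
      _ ≤ ENNReal.ofReal M⁻¹ * ∫⁻ s in Set.Ioc (1 : ℝ) 2, F (x - (s * δ x) • vert) ^ p x := by
          rw [ENNReal.mul_rpow_of_nonneg _ _ (by linarith [hp1 x])]
          exact mul_le_mul' (hpow _ (hp1 x)) (lintegral_rpow_le_of_isProbabilityMeasure hm (hp1 x))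
      _ ≤ ENNReal.ofReal M⁻¹ * ∫⁻ s in Set.Ioc (1 : ℝ) 2,
            (1 + F (x - (s * δ x) • vert) ^ p (x - (s * δ x) • vert)) := by
          refine mul_le_mul' le_rfl (setLIntegral_mono' measurableSet_Ioc fun s hs => ?_)
          exact rpow_le_one_add_rpow _ (by linarith [hp1 x]) (hple x hx s hs)
      _ = _ := (lintegral_const_mul' _ _ (by simp)).symm
  -- Below the graph the extension is `f` itself, and `1 ≤ C` suffices.
  have h2 : ∀ x ∈ V ∩ subgraph φ, ‖Z x‖ₑ ≤ N x := fun x hx => by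
    rw [hZe, extGrad_of_notMem (notMem_upper hx.2)]
    have h3 : matNorm (f x) / (C * M * t) ≤ M⁻¹ * (matNorm (f x) / t) := by
      have h0 := matNorm_nonneg (f x)
      have e : matNorm (f x) / (C * M * t) = C⁻¹ * (M⁻¹ * (matNorm (f x) / t)) := by
        field_simp
      rw [e]
      exact mul_le_of_le_one_left (by positivity) (inv_le_one_of_one_le₀ hC)
    refine (ENNReal.rpow_le_rpow (ENNReal.ofReal_le_ofReal h3) (by linarith [hp1 x])).trans ?_
    rw [ENNReal.ofReal_mul (by positivity), ENNReal.mul_rpow_of_nonneg _ _ (by linarith [hp1 x])]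
    exact mul_le_mul' (hpow _ (hp1 x)) le_add_self
  have h3 := hV.lintegral_extension_le hφ hδ hNm (c := 1) (by simp)
    ((ae_restrict_iff' (hV.measurableSet_left.inter (isOpen_upper hφ).measurableSet)).2
      (ae_of_all _ h1)) h2
  have e1 : ∫⁻ x in V, ‖Z x‖ₑ = modular V p (extGrad φ δ f) (C * M * t) := by
    refine lintegral_congr fun x => ?_
    have h0 := matNorm_nonneg (extGrad φ δ f x)
    rw [Real.enorm_of_nonneg (by positivity)]
  have e2 : ∫⁻ x in S, N x = ENNReal.ofReal M⁻¹ * (volume S + modular S p f t) := by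
    rw [lintegral_const_mul' _ _ (by simp), lintegral_add_left measurable_const,
      setLIntegral_const, one_mul]
    refine congrArg (fun z => ENNReal.ofReal M⁻¹ * (volume S + z)) (lintegral_congr fun x => ?_)
    have h0 := matNorm_nonneg (f x)
    rw [hF, ENNReal.ofReal_rpow_of_nonneg (by positivity) (by linarith [hp1 x])]
  rw [e1, e2] at h3
  exact h3.trans_eq (by norm_num)

/-- The dilation factor `3 (v + 1)` absorbs both the factor `3` and the measure of `S`, which makes
the unit ball of the modular map to a multiple of the unit ball. -/
lemma ReflectsInto.modular_extGrad_le_one (hV : ReflectsInto φ δ V S) (hφ : Continuous φ)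
    (hδ : IsRegDist φ K δ) (hf : ∀ i j, Measurable fun x => f x i j) (hp : Measurable p)
    (hp1 : ∀ x, 1 ≤ p x)
    (hple : ∀ x ∈ V ∩ upper φ, ∀ s ∈ Set.Ioc (1 : ℝ) 2, p x ≤ p (x - (s * δ x) • vert))
    {v : ℝ} (hv : 0 ≤ v) (hSv : volume S ≤ ENNReal.ofReal v) (ht : 0 < t)
    (h : modular S p f t ≤ 1) :
    modular V p (extGrad φ δ f) (extConst m K * (3 * (v + 1)) * t) ≤ 1 := by
  refine (hV.modular_extGrad_le hφ hδ hf hp hp1 hple (by linarith) ht).trans ?_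
  calc 3 * (ENNReal.ofReal (3 * (v + 1))⁻¹ * (volume S + modular S p f t))
      ≤ ENNReal.ofReal 3 * (ENNReal.ofReal (3 * (v + 1))⁻¹ *
          (ENNReal.ofReal v + ENNReal.ofReal 1)) := by
        rw [ENNReal.ofReal_one]
        gcongr
        simp
    _ = 1 := by
        rw [← ENNReal.ofReal_add hv zero_le_one, ← ENNReal.ofReal_mul (by positivity),
          ← ENNReal.ofReal_mul (by norm_num), ← ENNReal.ofReal_one]
        congr 1
        field_simp

end ModularExtension

/-! ### Geometry of the reflection near a boundary point -/

section Geometry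

variable {δ : Rn (m + 1) → ℝ} {L : ℝ≥0} {K R' r s : ℝ} {x y : Rn (m + 1)}

lemma height_zero (h0 : φ 0 = 0) : height φ 0 = 0 := by
  have : firstCoords (0 : Rn (m + 1)) = 0 := by
    ext i
    simp [firstCoords]
  simp [height, this, h0]

/-- The reflected points are, up to a factor, as close as any point below the graph. -/
lemma IsRegDist.norm_smul_vert_le (hδ : IsRegDist φ K δ) (hφ : LipschitzWith L φ)
    (hx : x ∈ upper φ) (hs : s ∈ Set.Ioc (1 : ℝ) 2) (hy : height φ y ≤ 0) :
    ‖(s * δ x) • (vert : Rn (m + 1))‖ ≤ 2 * K * (1 + L) * ‖x - y‖ := by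
  have hpos := hδ.pos hx
  have h1 := (abs_le.1 (abs_height_sub_le hφ x y)).2
  have h2 := hδ.le_mul_height x hx
  have hK := hδ.nonneg
  rw [norm_smul, norm_vert, mul_one, Real.norm_of_nonneg (mul_nonneg (by linarith [hs.1]) hpos.le)]
  calc s * δ x ≤ 2 * δ x := mul_le_mul_of_nonneg_right hs.2 hpos.le
    _ ≤ 2 * (K * height φ x) := by linarith
    _ ≤ 2 * (K * ((1 + L) * ‖x - y‖)) := by gcongr; linarith
    _ = _ := by ring

lemma reflectsInto_ball (hδ : IsRegDist φ K δ) (hφ : LipschitzWith L φ) (h0 : φ 0 = 0)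
    (hr : r * (1 + 2 * K * (1 + L)) ≤ R') :
    ReflectsInto φ δ (Metric.ball 0 r) (Metric.ball 0 R' ∩ subgraph φ) := by
  have hK := hδ.nonneg
  have hκ : 0 ≤ 2 * K * (1 + (L : ℝ)) := by positivity
  refine ⟨Metric.isOpen_ball.measurableSet,
    (Metric.isOpen_ball.inter (isOpen_subgraph hφ.continuous)).measurableSet,
    Set.inter_subset_right, fun x hx => ⟨?_, hx.2⟩, fun x hx s hs => ⟨?_, ?_⟩⟩
  · have h1 := mem_ball_zero_iff.1 hx.1
    refine mem_ball_zero_iff.2 (h1.trans_le (le_trans ?_ hr))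
    exact le_mul_of_one_le_right ((norm_nonneg x).trans h1.le) (by linarith)
  · have h1 := mem_ball_zero_iff.1 hx.1
    have h2 := hδ.norm_smul_vert_le hφ hx.2 hs (height_zero h0).le
    rw [sub_zero] at h2
    refine mem_ball_zero_iff.2 ((norm_sub_le _ _).trans_lt ?_)
    calc ‖x‖ + ‖(s * δ x) • (vert : Rn (m + 1))‖ ≤ ‖x‖ * (1 + 2 * K * (1 + L)) := by linarith
      _ < r * (1 + 2 * K * (1 + L)) := by gcongr
      _ ≤ R' := hr
  · rw [mem_subgraph, height_sub_smul_vert]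
    have hpos := hδ.pos hx.2
    have h1 := hδ.two_mul_height_le x hx.2
    have h2 := mem_upper.1 hx.2
    nlinarith [hs.1]

lemma ball_inter_subgraph_nonempty (h0 : φ 0 = 0) {R : ℝ} (hR : 0 < R) :
    (Metric.ball 0 R ∩ subgraph φ).Nonempty := by
  refine ⟨0 - (R / 2) • vert, mem_ball_zero_iff.2 ?_, ?_⟩
  · rw [zero_sub, norm_neg, norm_smul, norm_vert, mul_one, Real.norm_of_nonneg (by positivity)]
    linarith
  · rw [mem_subgraph, height_sub_smul_vert, height_zero h0]
    linarith

end Geometry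

/-! ### Measurable representatives and the extension of a decomposed gradient -/

section Representative

variable {n : ℕ} {S : Set (Rn n)}

lemma exists_measurable_representative (hS : MeasurableSet S) {w : Rn n → ℝ}
    (hw : AEMeasurable w (volume.restrict S)) : ∃ w₀, Measurable w₀ ∧ (∀ x, x ∉ S → w₀ x = 0) ∧
      ∀ᵐ x ∂volume.restrict S, w x = w₀ x := by
  refine ⟨S.indicator (hw.mk w), hw.measurable_mk.indicator hS,
    fun x hx => Set.indicator_of_notMem hx _, ?_⟩
  filter_upwards [hw.ae_eq_mk, ae_restrict_mem hS] with x hx hxS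
  rw [hx, Set.indicator_of_mem hxS]

lemma exists_measurable_representative_map (hS : MeasurableSet S) {u : Rn n → Rn n}
    (hu : ∀ i, AEMeasurable (fun x => u x i) (volume.restrict S)) : ∃ u₀ : Rn n → Rn n,
      (∀ i, Measurable fun x => u₀ x i) ∧ (∀ x, x ∉ S → u₀ x = 0) ∧
      ∀ᵐ x ∂volume.restrict S, u x = u₀ x := by
  choose w hwm hw0 hw using fun i => exists_measurable_representative hS (hu i)
  refine ⟨fun x => WithLp.toLp 2 fun i => w i x, hwm, fun x hx => ?_, ?_⟩
  · ext i
    exact hw0 i x hx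
  · filter_upwards [ae_all_iff.2 hw] with x hx
    ext i
    exact hx i

lemma exists_measurable_representative_mat (hS : MeasurableSet S) {G : Rn n → Mat n}
    (hG : ∀ i j, AEMeasurable (fun x => G x i j) (volume.restrict S)) : ∃ G₀ : Rn n → Mat n,
      (∀ i j, Measurable fun x => G₀ x i j) ∧ (∀ x, x ∉ S → G₀ x = 0) ∧
      ∀ᵐ x ∂volume.restrict S, G x = G₀ x := by
  choose w hwm hw0 hw using fun i j => exists_measurable_representative hS (hG i j)
  refine ⟨fun x => Matrix.of fun i j => w i j x, hwm, fun x hx => ?_, ?_⟩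
  · ext i j
    exact hw0 i j x hx
  · filter_upwards [ae_all_iff.2 fun i => ae_all_iff.2 (hw i)] with x hx
    ext i j
    exact hx i j

lemma integrable_of_ae_eq {w w₀ : Rn n → ℝ} (hw : IntegrableOn w S)
    (h0 : ∀ x, x ∉ S → w₀ x = 0) (h : ∀ᵐ x ∂volume.restrict S, w x = w₀ x) : Integrable w₀ := by
  have h1 : IntegrableOn w₀ S := Integrable.congr hw h
  refine (integrableOn_iff_integrable_of_support_subset fun x hx => ?_).1 h1
  by_contra hxS
  exact hx (h0 x hxS)

lemma IsWeakPartialDeriv.congr {w v w₀ v₀ : Rn n → ℝ} {j : Fin n}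
    (h : IsWeakPartialDeriv S w j v) (hw : ∀ᵐ x ∂volume.restrict S, w x = w₀ x)
    (hv : ∀ᵐ x ∂volume.restrict S, v x = v₀ x) : IsWeakPartialDeriv S w₀ j v₀ :=
  fun η hη hηc hηS => by
    have h1 := integral_congr_ae (hw.mono fun x hx =>
      congrArg (· * fderiv ℝ η x (EuclideanSpace.single j 1)) hx)
    have h2 := integral_congr_ae (hv.mono fun x hx => congrArg (· * η x) hx)
    have h3 := h η hη hηc hηS
    beta_reduce at h1 h2
    rw [← h1, ← h2]
    exact h3

end Representative

section Extension

variable {δ : Rn (m + 1) → ℝ} {V S S' : Set (Rn (m + 1))} {K b v : ℝ}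
  {p p' : Rn (m + 1) → ℝ} {f f₀ : Rn (m + 1) → Mat (m + 1)}

/-- Boundedness of the extension operator on variable exponent spaces, for exponents that do not
increase under reflection. -/
theorem ReflectsInto.memLpVar_extGrad (hV : ReflectsInto φ δ V S') (hφ : Continuous φ)
    (hδ : IsRegDist φ K δ) (hS : MeasurableSet S) (hSS : S' ⊆ S)
    (hp' : Measurable p') (h1p' : ∀ x, 1 ≤ p' x) (hbp' : ∀ x, p' x ≤ b)
    (hpp : ∀ x ∈ S, p' x = p x)
    (hple : ∀ x ∈ V ∩ upper φ, ∀ s ∈ Set.Ioc (1 : ℝ) 2, p' x ≤ p' (x - (s * δ x) • vert))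
    (hv : 0 ≤ v) (hSv : volume S' ≤ ENNReal.ofReal v) (hf : MemLpVar S p f)
    (hf₀ : ∀ i j, Measurable fun x => f₀ x i j) (hff : ∀ᵐ x ∂volume.restrict S, f x = f₀ x) :
    MemLpVar V p' (extGrad φ δ f₀) ∧
      normLpVar V p' (extGrad φ δ f₀) ≤ extConst m K * (3 * (v + 1)) * normLpVar S p f := by
  have hC : 0 < extConst m K * (3 * (v + 1)) := by
    have := one_le_extConst m hδ.nonneg
    positivity
  have key : ∀ t, 0 < t → modular S p f t ≤ 1 →
      modular V p' (extGrad φ δ f₀) (extConst m K * (3 * (v + 1)) * t) ≤ 1 := fun t ht h => by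
    refine hV.modular_extGrad_le_one hφ hδ hf₀ hp' h1p' hple hv hSv ht (le_trans ?_ h)
    rw [modular_congr hff, ← modular_congr_exponent hS hpp]
    exact lintegral_mono_set hSS
  have hne := hf.exists_modular_le_one hS fun x hx => (hpp x hx) ▸ h1p' x
  refine ⟨⟨fun i j => (measurable_extGrad hφ hδ.measurable hf₀ i j).aemeasurable, ?_⟩,
    normLpVar_le_mul hC hne key⟩
  obtain ⟨t, ht, hmt⟩ := hne
  exact modular_one_lt_top hV.measurableSet_left (fun x _ => zero_le_one.trans (h1p' x))
    (fun x _ => hbp' x) (mul_pos hC ht) (key t ht hmt)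

end Extension

lemma expInf_le_expSup_ball {n : ℕ} {r : ℝ} (hr : 0 < r) (p : Rn n → ℝ) :
    expInf (Metric.ball 0 r) p ≤ expSup (Metric.ball 0 r) p := by
  have : (volume.restrict (Metric.ball (0 : Rn n) r)) ≠ 0 := by
    rw [Ne, Measure.restrict_eq_zero]
    exact (Metric.measure_ball_pos volume 0 hr).ne'
  have : (ae (volume.restrict (Metric.ball (0 : Rn n) r))).NeBot := ae_neBot.2 this
  exact Filter.liminf_le_limsup

end VarExp

end

open VarExp

/-- Extension of Sobolev maps with a mixed-growth symmetric gradient, in dimension `n = m + 1`. -/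
theorem theorem4p1 (m : ℕ) (L : ℝ≥0) (hL : 0 < L) (R : ℝ) (hR : 0 < R) :
    -- the radius depends on `n`, `L` and `R` only
    ∃ r : ℝ, 0 < r ∧ r < R ∧
    ∀ p q : VarExp.Rn (m + 1) → ℝ,
    -- the constant depends on `n`, `L`, `R`, `p` and `q` only
    ∃ C : ℝ, 0 < C ∧
    ∀ φ : VarExp.Rn m → ℝ, LipschitzWith L φ → φ 0 = 0 →
    VarExp.IsLogExponent (Metric.ball 0 R ∩ VarExp.subgraph φ) p →
    VarExp.IsLogExponent (Metric.ball 0 R ∩ VarExp.subgraph φ) q →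
    (∀ᵐ x ∂volume.restrict (Metric.ball 0 R ∩ VarExp.subgraph φ), p x ≤ q x) →
    ∀ (u : VarExp.Rn (m + 1) → VarExp.Rn (m + 1))
      (Du f g : VarExp.Rn (m + 1) → VarExp.Mat (m + 1)),
    VarExp.IsW11WithGrad (Metric.ball 0 R ∩ VarExp.subgraph φ) u Du →
    VarExp.MemLpVar (Metric.ball 0 R ∩ VarExp.subgraph φ) p f →
    VarExp.MemLpVar (Metric.ball 0 R ∩ VarExp.subgraph φ) q g →
    (∀ᵐ x ∂volume.restrict (Metric.ball 0 R ∩ VarExp.subgraph φ),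
      VarExp.symPart (Du x) = f x + g x) →
    ∃ (p' q' : VarExp.Rn (m + 1) → ℝ)
      (u' : VarExp.Rn (m + 1) → VarExp.Rn (m + 1))
      (Du' f' g' : VarExp.Rn (m + 1) → VarExp.Mat (m + 1)),
      -- the spaces
      VarExp.IsLogExponent (Metric.ball 0 r) p' ∧
      VarExp.IsLogExponent (Metric.ball 0 r) q' ∧
      VarExp.IsW11WithGrad (Metric.ball 0 r) u' Du' ∧
      VarExp.MemLpVar (Metric.ball 0 r) p' f' ∧
      VarExp.MemLpVar (Metric.ball 0 r) q' g' ∧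
      -- the exponents
      (∀ᵐ x ∂volume.restrict (Metric.ball 0 r ∩ VarExp.subgraph φ), p' x = p x ∧ q' x = q x) ∧
      VarExp.expInf (Metric.ball 0 R ∩ VarExp.subgraph φ) p
        ≤ VarExp.expInf (Metric.ball 0 r) p' ∧
      VarExp.expInf (Metric.ball 0 r) p' ≤ VarExp.expSup (Metric.ball 0 r) p' ∧
      VarExp.expSup (Metric.ball 0 r) p'
        ≤ VarExp.expSup (Metric.ball 0 R ∩ VarExp.subgraph φ) p ∧
      VarExp.expInf (Metric.ball 0 R ∩ VarExp.subgraph φ) q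
        ≤ VarExp.expInf (Metric.ball 0 r) q' ∧
      VarExp.expInf (Metric.ball 0 r) q' ≤ VarExp.expSup (Metric.ball 0 r) q' ∧
      VarExp.expSup (Metric.ball 0 r) q'
        ≤ VarExp.expSup (Metric.ball 0 R ∩ VarExp.subgraph φ) q ∧
      (∀ᵐ x ∂volume.restrict (Metric.ball 0 r), p' x ≤ q' x) ∧
      -- the maps
      (∀ᵐ x ∂volume.restrict (Metric.ball 0 r ∩ VarExp.subgraph φ),
        u' x = u x ∧ f' x = f x ∧ g' x = g x) ∧
      (∀ᵐ x ∂volume.restrict (Metric.ball 0 r), VarExp.symPart (Du' x) = f' x + g' x) ∧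
      -- the estimates
      VarExp.normLpVar (Metric.ball 0 r) p' f'
        ≤ C * VarExp.normLpVar (Metric.ball 0 R ∩ VarExp.subgraph φ) p f ∧
      VarExp.normLpVar (Metric.ball 0 r) q' g'
        ≤ C * VarExp.normLpVar (Metric.ball 0 R ∩ VarExp.subgraph φ) q g := by
  obtain ⟨K, hK, hreg⟩ := exists_isRegDist m L
  set κ : ℝ := 1 + 2 * K * (1 + L) with hκ
  have hκ1 : 1 < κ := by
    have : 0 < 2 * K * (1 + (L : ℝ)) := by positivity
    linarith
  -- The reflections move a point `x` of `B_r` by at most `(κ - 1) |x|`, hence within `B_{R/2}`.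
  set r : ℝ := R / 2 / κ with hr
  have hr0 : 0 < r := by positivity
  have hrR : r < R := (div_le_self (by positivity) hκ1.le).trans_lt (by linarith)
  set v : ℝ := (volume (Metric.ball (0 : Rn (m + 1)) (R / 2))).toReal with hvdef
  have hv : 0 ≤ v := ENNReal.toReal_nonneg
  have hC : 0 < extConst m K * (3 * (v + 1)) := by
    have := one_le_extConst m hK.le
    positivity
  refine ⟨r, hr0, hrR, fun p q => ⟨extConst m K * (3 * (v + 1)), hC, ?_⟩⟩
  intro φ hφ h0 hp hq hpq u Du f g hu hf hg hfg
  obtain ⟨δ, hδ⟩ := hreg φ hφ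
  have hφc := hφ.continuous
  set S := Metric.ball (0 : Rn (m + 1)) R ∩ subgraph φ with hSdef
  have hSo : IsOpen S := Metric.isOpen_ball.inter (isOpen_subgraph hφc)
  have hS := hSo.measurableSet
  have hSne : S.Nonempty := ball_inter_subgraph_nonempty h0 hR
  have hSfin : volume S ≠ ⊤ :=
    ((measure_mono Set.inter_subset_left).trans_lt Metric.isBounded_ball.measure_lt_top).ne
  have hV := reflectsInto_ball (R' := R / 2) (r := r) hδ hφ h0
    (by rw [← hκ, hr, div_mul_cancel₀ _ (by positivity)])
  have hSS : Metric.ball (0 : Rn (m + 1)) (R / 2) ∩ subgraph φ ⊆ S :=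
    Set.inter_subset_inter_left _ (Metric.ball_subset_ball (by linarith))
  have hSv : volume (Metric.ball (0 : Rn (m + 1)) (R / 2) ∩ subgraph φ) ≤ ENNReal.ofReal v := by
    rw [hvdef, ENNReal.ofReal_toReal Metric.isBounded_ball.measure_lt_top.ne]
    exact measure_mono Set.inter_subset_left
  have hVS : Metric.ball (0 : Rn (m + 1)) r ∩ subgraph φ ⊆ S :=
    Set.inter_subset_inter_left _ (Metric.ball_subset_ball hrR.le)
  -- The exponents: the reflected points are comparably close to any point of `S`.
  obtain ⟨p', q', hp', hq', ⟨hpc, hqc⟩, h1, heq, hpb, hqb, hple, hnear⟩ :=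
    exists_extension_exponents hSo hSne hp hq hpq hκ1.le r
  have hrefl : ∀ x ∈ Metric.ball (0 : Rn (m + 1)) r ∩ upper φ, ∀ s ∈ Set.Ioc (1 : ℝ) 2,
      p' x ≤ p' (x - (s * δ x) • vert) ∧ q' x ≤ q' (x - (s * δ x) • vert) := fun x hx s hs => by
    have hz := hSS (hV.mem x hx s hs)
    rw [(heq _ hz).1, (heq _ hz).2]
    refine hnear x _ hz fun y hy => ?_
    rw [sub_sub_cancel, hκ, add_sub_cancel_left]
    exact hδ.norm_smul_vert_le hφ hx.2 hs (mem_subgraph.1 hy.2).le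
  obtain ⟨-, b₁, -, hb₁, -⟩ := hp.exists_bounds hSo hSne
  obtain ⟨-, b₂, -, hb₂, -⟩ := hq.exists_bounds hSo hSne
  -- Representatives that are measurable everywhere and vanish outside `S`.
  obtain ⟨u₀, hum, hu0, huu⟩ := exists_measurable_representative_map hS fun i =>
    (hu.integrable i).1.aemeasurable
  obtain ⟨D₀, hDm, hD0, hDD⟩ := exists_measurable_representative_mat hS fun i j =>
    (hu.grad_integrable i j).1.aemeasurable
  obtain ⟨g₀, hgm, hg0, hgg⟩ := exists_measurable_representative_mat hS hg.measurable
  have hui : ∀ i, Integrable fun x => u₀ x i := fun i =>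
    integrable_of_ae_eq (hu.integrable i) (fun x hx => by simp [hu0 x hx])
      (huu.mono fun x hx => by simp only [hx])
  have hDi : ∀ i j, Integrable fun x => D₀ x i j := fun i j =>
    integrable_of_ae_eq (hu.grad_integrable i j) (fun x hx => by simp [hD0 x hx])
      (hDD.mono fun x hx => by simp only [hx])
  have hgi : ∀ i j, Integrable fun x => g₀ x i j := fun i j =>
    integrable_of_ae_eq (hg.integrableOn hS hSfin hq.isExponent.one_le i j)
      (fun x hx => by simp [hg0 x hx]) (hgg.mono fun x hx => by simp only [hx])
  have hsm : ∀ i j, Measurable fun x => symPart (D₀ x) i j := fun i j => by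
    simp only [symPart_apply]
    exact ((hDm i j).add (hDm j i)).const_mul _
  have hsi : ∀ i j, Integrable fun x => symPart (D₀ x) i j := fun i j => by
    simp only [symPart_apply]
    exact ((hDi i j).add (hDi j i)).const_mul _
  -- Taking `f₀` as the difference makes the decomposition hold everywhere.
  set f₀ : Rn (m + 1) → Mat (m + 1) := (fun x => symPart (D₀ x)) - g₀ with hf₀
  have hfm : ∀ i j, Measurable fun x => f₀ x i j := fun i j => (hsm i j).sub (hgm i j)
  have hff : ∀ᵐ x ∂volume.restrict S, f x = f₀ x := by
    filter_upwards [hfg, hDD, hgg] with x h1 h2 h3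
    rw [h2, h3] at h1
    rw [hf₀, Pi.sub_apply, h1, add_sub_cancel_right]
  have hF := hV.memLpVar_extGrad hφc hδ hS hSS hpc.measurable (fun x => (h1 x).1)
    (fun x => EReal.coe_le_coe_iff.1 ((hpb x).2.trans_eq hb₁.symm)) (fun x hx => (heq x hx).1)
    (fun x hx s hs => (hrefl x hx s hs).1) hv hSv hf hfm hff
  have hG := hV.memLpVar_extGrad hφc hδ hS hSS hqc.measurable (fun x => (h1 x).2)
    (fun x => EReal.coe_le_coe_iff.1 ((hqb x).2.trans_eq hb₂.symm)) (fun x hx => (heq x hx).2)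
    (fun x hx s hs => (hrefl x hx s hs).2) hv hSv hg hgm hgg
  have hVm : MeasurableSet (Metric.ball (0 : Rn (m + 1)) r ∩ subgraph φ) :=
    (Metric.isOpen_ball.inter (isOpen_subgraph hφc)).measurableSet
  refine ⟨p', q', extMap φ δ u₀, extGrad φ δ D₀, extGrad φ δ f₀, extGrad φ δ g₀, hp', hq',
    ?_, hF.1, hG.1, ?_, ?_, expInf_le_expSup_ball hr0 p', ?_, ?_, expInf_le_expSup_ball hr0 q', ?_,
    ae_of_all _ hple, ?_, ?_, hF.2, hG.2⟩
  · exact isW11WithGrad_extMap hφ hδ (by linarith) hV hum hDm hui hDi hu0 hD0 fun i j =>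
      (hu.isWeakPartialDeriv i j).congr (huu.mono fun x hx => by simp only [hx])
        (hDD.mono fun x hx => by simp only [hx])
  · exact (ae_restrict_iff' hVm).2 (ae_of_all _ fun x hx => heq x (hVS hx))
  · exact le_essInf_of_ae_le _ (ae_of_all _ fun x => (hpb x).1)
  · exact essSup_le_of_ae_le _ (ae_of_all _ fun x => (hpb x).2)
  · exact le_essInf_of_ae_le _ (ae_of_all _ fun x => (hqb x).1)
  · exact essSup_le_of_ae_le _ (ae_of_all _ fun x => (hqb x).2)
  · filter_upwards [ae_restrict_of_ae_restrict_of_subset hVS huu,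
      ae_restrict_of_ae_restrict_of_subset hVS hff,
      ae_restrict_of_ae_restrict_of_subset hVS hgg, ae_restrict_mem hVm] with x h1 h2 h3 hx
    have hx' := notMem_upper hx.2
    rw [extMap_of_notMem hx', extGrad_of_notMem hx', extGrad_of_notMem hx', h1, h2, h3]
    exact ⟨rfl, rfl, rfl⟩
  · filter_upwards [hV.extGrad_symPart hφc hδ hDm fun i j => (hDi i j).integrableOn,
      hV.extGrad_sub hφc hδ hsm (fun i j => (hsi i j).integrableOn) hgm
        fun i j => (hgi i j).integrableOn] with x h1 h2
    rw [hf₀, h2, h1, sub_add_cancel]
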